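/- Setting. Let $V:\mathbb R\to[0,\infty)$ be smooth and even, and let $\gamma>0$. Configurations are $\omega=(r_x,p_x)_{x\in\mathbb Z}$. For $T>0$ let $\mu_T$ be the product probability measure on $(\mathbb R\times\mathbb R)^{\mathbb Z}$ with one-site density proportional to $e^{-(p^2/2+V(r))/T}$ (well defined in both regimes below), and let $\mathrm{Var}_T$ be the variance under $\mu_T$. Let $\mathcal H_T$ be the completion of the space of local square integrable functions for the semi-inner product $$\ll f,g\gg\;=\sum_{x\in\mathbb Z}\{\mu_T(f\,\theta_xg)-\mu_T(f)\mu_T(g)\},$$ where $\theta_x$ is the shift by $x$. On compactly supported local $C^1$ functions define $$\mathfrak L f=\sum_x\big[(p_x-p_{x-1})\partial_{r_x}f+(V'(r_{x+1})-V'(r_x))\partial_{p_x}f\big]+\gamma\sum_x\,[f(\omega^x)-f(\omega)],$$ where $\omega^x$ is $\omega$ with $p_x$ replaced by $-p_x$. Assume that, for every $T>0$, the closure of $\mathfrak L$ in $\mathcal H_T$ (again written $\mathfrak L$) is the generator of a strongly continuous semigroup on $\mathcal H_T$. Let $j_{0,1}=-p_0V'(r_1)$ and let the thermal conductivity be $$\kappa(T)=T^{-2}\lim_{\lambda\downarrow0}\ll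 j_{0,1},(\lambda-\mathfrak L)^{-1}j_{0,1}\gg .$$ **High temperature.** Suppose that $V(r)=Ar^\alpha+W(r)$ for $r\ge1$, where $A>0$, $\alpha>1$, and $W$ is smooth with $W,W'$ bounded on $[1,\infty)$. Then, for every $T>0$, the resolvent equation $(\lambda-\mathfrak L)u=j_{0,1}$ has exactly one solution for each $\lambda>0$ and the limit defining $\kappa(T)$ exists. There is a constant $C>0$ such that, for all sufficiently large $T$, $$\kappa(T)\le \frac{C}{T^{2/\alpha-1}}.$$ In particular $\kappa(T)\to0$ as $T\to\infty$ if $1<\alpha<2$. Moreover, as $T\to\infty$, $$\mathrm{Var}_T(V'(r_0))\sim C_\infty T^{2-2/\alpha},\qquad C_\infty=A^2\alpha^2\,\frac{\int_0^\infty s^{2\alpha-2}e^{-As^\alpha}ds}{\int_0^\infty e^{-As^\alpha}ds}.$$ **Low temperature.** Suppose that $V(r)>0$ for $r\ne0$, that $V(r)\sim Ar^\delta$ as $r\downarrow0$ with $A>0$ and $\delta\ge2$, and that $V(r)=Br^\alpha+W(r)$ for $r\ge1$, where $B>0$, $\alpha>0$, and $W$ is smooth with $W,W'$ bounded on $[1,\infty)$.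 Then, for every $T>0$, the resolvent equation has exactly one solution for each $\lambda>0$ and the limit defining $\kappa(T)$ exists. There is a constant $C>0$ such that, for all sufficiently small $T>0$, $$\kappa(T)\le C\,T^{1-2/\delta}.$$ In particular $\kappa(T)\to0$ as $T\downarrow0$ if $\delta>2$. Moreover, as $T\downarrow0$, $$\mathrm{Var}_T(V'(r_0))\sim C_0T^{2-2/\delta},\qquad C_0=A^2\delta^2\,\frac{\int_0^\infty s^{2\delta-2}e^{-As^\delta}ds}{\int_0^\infty e^{-As^\delta}ds}.$$ -/

import Mathlib

open MeasureTheory ProbabilityTheory Filter Topology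


noncomputable section

namespace FlipChain

/-- A configuration of the infinite chain: `(ω x).1 = r_x` is the interparticle distance and
`(ω x).2 = p_x` is the momentum at site `x`. -/
abbrev Config : Type := ℤ → ℝ × ℝ

/-- Energy of one site, `p² / 2 + V r`. -/
def siteEnergy (V : ℝ → ℝ) (z : ℝ × ℝ) : ℝ := z.2 ^ 2 / 2 + V z.1

open Classical in
/-- One-site Gibbs measure at temperature `T` and zero tension: the probability measure on `ℝ × ℝ`
with density proportional to `exp (-(p² / 2 + V r) / T)`. If this weight is not integrable there
is no such measure, and a Dirac mass is used as a default value. -/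
def siteMeasure (V : ℝ → ℝ) (T : ℝ) : Measure (ℝ × ℝ) :=
  if Integrable (fun z : ℝ × ℝ => Real.exp (-siteEnergy V z / T)) volume then
    (volume : Measure (ℝ × ℝ)).tilted (fun z => -siteEnergy V z / T)
  else Measure.dirac 0

instance (V : ℝ → ℝ) (T : ℝ) : IsProbabilityMeasure (siteMeasure V T) := by
  unfold siteMeasure
  split_ifs with h
  · exact isProbabilityMeasure_tilted h
  · infer_instance

/-- The infinite-volume Gibbs measure `μ_{0,T}`: the product of the one-site Gibbs measures. -/
def gibbs (V : ℝ → ℝ) (T : ℝ) : Measure Config := Measure.infinitePi fun _ : ℤ => siteMeasure V T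

instance (V : ℝ → ℝ) (T : ℝ) : IsProbabilityMeasure (gibbs V T) := by
  unfold gibbs; infer_instance

/-- The space shift `(θ_x ω)_z = ω_{x+z}`. -/
def shift (x : ℤ) (ω : Config) : Config := fun z => ω (x + z)

/-! ### The Hilbert space of local functions modulo gradients -/

/-- Measurable local functions that are square integrable for `μ`. -/
def localL2 (μ : Measure Config) : Submodule ℝ (Config → ℝ) where
  carrier := {f | Measurable f ∧ (∃ Λ : Finset ℤ, DependsOn f (Λ : Set ℤ)) ∧ MemLp f 2 μ}
  zero_mem' := ⟨measurable_const, ⟨∅, fun _ _ _ => rfl⟩, MemLp.zero⟩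
  add_mem' := by
    rintro f g ⟨hf, ⟨Λ, hΛ⟩, hf2⟩ ⟨hg, ⟨Λ', hΛ'⟩, hg2⟩
    refine ⟨hf.add hg, ⟨Λ ∪ Λ', fun a b hab => ?_⟩, hf2.add hg2⟩
    simp only [Pi.add_apply]
    rw [hΛ fun i hi => hab i (by simp_all), hΛ' fun i hi => hab i (by simp_all)]
  smul_mem' := by
    rintro c f ⟨hf, ⟨Λ, hΛ⟩, hf2⟩
    refine ⟨hf.const_smul c, ⟨Λ, fun a b hab => ?_⟩, hf2.const_smul c⟩
    simp only [Pi.smul_apply]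
    rw [hΛ hab]

/-- The semi-inner product
`≪f, g≫ = ∑_{x ∈ ℤ} (μ(f · θ_x g) - μ(f) μ(g))`, where `(θ_x g)(ω) = g(θ_x ω)`.
For a shift invariant product measure and local functions only finitely many terms are nonzero. -/
def semiInner (μ : Measure Config) (f g : Config → ℝ) : ℝ :=
  ∑ᶠ x : ℤ, cov[f, fun ω => g (shift x ω); μ]

lemma measurable_shift (x : ℤ) : Measurable (shift x) :=
  measurable_pi_lambda _ fun z => measurable_pi_apply (x + z)

lemma measurePreserving_shift (V : ℝ → ℝ) (T : ℝ) (x : ℤ) :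
    MeasurePreserving (shift x) (gibbs V T) (gibbs V T) :=
  ⟨measurable_shift x, Measure.map_infinitePi_infinitePi_of_inj
    (P := fun _ : ℤ => siteMeasure V T) (f := fun z : ℤ => x + z) (add_right_injective x)⟩

lemma shift_mem {V : ℝ → ℝ} {T : ℝ} {f : Config → ℝ} (hf : f ∈ localL2 (gibbs V T)) (x : ℤ) :
    (fun ω => f (shift x ω)) ∈ localL2 (gibbs V T) := by
  obtain ⟨hm, ⟨Λ, hΛ⟩, h2⟩ := hf
  refine ⟨hm.comp (measurable_shift x), ⟨Λ.image (fun z => x + z), fun a b hab => ?_⟩,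
    h2.comp_measurePreserving (measurePreserving_shift V T x)⟩
  exact hΛ fun i hi => hab (x + i) (by simpa using hi)

lemma cov_shift {V : ℝ → ℝ} {T : ℝ} {f g : Config → ℝ} (hf : f ∈ localL2 (gibbs V T))
    (hg : g ∈ localL2 (gibbs V T)) (x : ℤ) :
    cov[fun ω => f (shift x ω), fun ω => g (shift x ω); gibbs V T] = cov[f, g; gibbs V T] := by
  have h := measurePreserving_shift V T x
  conv_rhs => rw [← h.map_eq]
  rw [covariance_map_fun hf.1.aestronglyMeasurable hg.1.aestronglyMeasurable
    (measurable_shift x).aemeasurable]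

lemma shift_shift (x y : ℤ) (ω : Config) : shift x (shift y ω) = shift (x + y) ω := by
  funext z
  simp only [shift]
  congr 1
  ring

lemma cov_shift_shift {V : ℝ → ℝ} {T : ℝ} {f g : Config → ℝ} (hf : f ∈ localL2 (gibbs V T))
    (hg : g ∈ localL2 (gibbs V T)) (x y : ℤ) :
    cov[fun ω => f (shift x ω), fun ω => g (shift y ω); gibbs V T]
      = cov[f, fun ω => g (shift (y - x) ω); gibbs V T] := by
  rw [← cov_shift hf (shift_mem hg (y - x)) x]
  simp only [shift_shift, sub_add_cancel]

lemma exists_comp {f : Config → ℝ} (hm : Measurable f) {Λ : Finset ℤ}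
    (hΛ : DependsOn f (Λ : Set ℤ)) :
    ∃ φ : (Λ → ℝ × ℝ) → ℝ, Measurable φ ∧ f = fun ω => φ (fun i => ω i) := by
  classical
  refine ⟨fun y => f (fun z => if h : z ∈ Λ then y ⟨z, h⟩ else 0), hm.comp ?_, ?_⟩
  · refine measurable_pi_lambda _ fun z => ?_
    by_cases h : z ∈ Λ
    · simpa [h] using measurable_pi_apply _
    · simp [h]
  · funext ω
    refine hΛ fun i hi => ?_
    have hi' : i ∈ Λ := hi
    simp [hi']

/-- Local functions of disjoint sets of coordinates are uncorrelated. -/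
lemma cov_eq_zero {V : ℝ → ℝ} {T : ℝ} {f g : Config → ℝ} (hf : f ∈ localL2 (gibbs V T))
    (hg : g ∈ localL2 (gibbs V T)) {Λ Λ' : Finset ℤ} (hΛ : DependsOn f (Λ : Set ℤ))
    (hΛ' : DependsOn g (Λ' : Set ℤ)) (hd : Disjoint Λ Λ') : cov[f, g; gibbs V T] = 0 := by
  obtain ⟨φ, hφ, rfl⟩ := exists_comp hf.1 hΛ
  obtain ⟨ψ, hψ, rfl⟩ := exists_comp hg.1 hΛ'
  have hi : iIndepFun (fun (i : ℤ) (ω : Config) => ω i) (gibbs V T) :=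
    iIndepFun_infinitePi (P := fun _ : ℤ => siteMeasure V T) (X := fun _ z => z)
      (fun _ => measurable_id)
  have h := hi.indepFun_finset Λ Λ' hd (fun i => measurable_pi_apply i)
  exact (h.comp hφ hψ).covariance_eq_zero hf.2.2 hg.2.2

lemma finite_support {V : ℝ → ℝ} {T : ℝ} {f g : Config → ℝ} (hf : f ∈ localL2 (gibbs V T))
    (hg : g ∈ localL2 (gibbs V T)) :
    (Function.support fun x : ℤ => cov[f, fun ω => g (shift x ω); gibbs V T]).Finite := by
  obtain ⟨Λ, hΛ⟩ := hf.2.1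
  obtain ⟨Λ', hΛ'⟩ := hg.2.1
  refine ((Λ ×ˢ Λ').image (fun p => p.1 - p.2)).finite_toSet.subset fun x hx => ?_
  by_contra hcon
  refine hx (cov_eq_zero hf (shift_mem hg x) (Λ' := Λ'.image (fun z => x + z)) hΛ
    (fun a b hab => hΛ' fun i hi => hab (x + i) (by simpa using hi)) ?_)
  rw [Finset.disjoint_left]
  intro a ha ha'
  obtain ⟨b, hb, rfl⟩ := Finset.mem_image.1 ha'
  exact hcon (by
    simp only [Finset.coe_image, Set.mem_image, Finset.mem_coe]
    exact ⟨(x + b, b), Finset.mem_product.2 ⟨ha, hb⟩, by simp⟩)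

lemma semiInner_comm {V : ℝ → ℝ} {T : ℝ} {f g : Config → ℝ} (hf : f ∈ localL2 (gibbs V T))
    (hg : g ∈ localL2 (gibbs V T)) :
    semiInner (gibbs V T) f g = semiInner (gibbs V T) g f := by
  unfold semiInner
  rw [← finsum_comp_equiv (Equiv.neg ℤ)]
  refine finsum_congr fun x => ?_
  have h := cov_shift_shift hg hf x 0
  simp only [zero_sub] at h
  rw [Equiv.neg_apply]
  have h0 : (fun ω => f (shift 0 ω)) = f := by
    funext ω; congr 1; funext z; simp [shift]
  rw [h0] at h
  rw [← cov_shift hf (shift_mem hg (-x)) x, covariance_comm]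
  simp only [shift_shift, neg_add_cancel]
  have h0' : (fun ω => g (shift 0 ω)) = g := by
    funext ω; congr 1; funext z; simp [shift]
  rw [h0']

lemma semiInner_add_left {V : ℝ → ℝ} {T : ℝ} {f g h : Config → ℝ}
    (hf : f ∈ localL2 (gibbs V T)) (hg : g ∈ localL2 (gibbs V T))
    (hh : h ∈ localL2 (gibbs V T)) :
    semiInner (gibbs V T) (f + g) h
      = semiInner (gibbs V T) f h + semiInner (gibbs V T) g h := by
  unfold semiInner
  rw [← finsum_add_distrib (finite_support hf hh) (finite_support hg hh)]
  exact finsum_congr fun x => covariance_add_left hf.2.2 hg.2.2 (shift_mem hh x).2.2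

lemma semiInner_smul_left (μ : Measure Config) (c : ℝ) (f g : Config → ℝ) :
    semiInner μ (c • f) g = c * semiInner μ f g := by
  unfold semiInner
  rw [← smul_eq_mul, smul_finsum]
  exact finsum_congr fun x => covariance_smul_left c

lemma semiInner_self_nonneg {V : ℝ → ℝ} {T : ℝ} {f : Config → ℝ}
    (hf : f ∈ localL2 (gibbs V T)) : 0 ≤ semiInner (gibbs V T) f f := by
  classical
  set c : ℤ → ℝ := fun x => cov[f, fun ω => f (shift x ω); gibbs V T] with hc
  have hfin := finite_support hf hf
  obtain ⟨K, hK⟩ : ∃ K : ℕ, ∀ x : ℤ, c x ≠ 0 → |x| ≤ K := by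
    obtain ⟨B, hB⟩ := (hfin.image (fun x : ℤ => x.natAbs)).bddAbove
    refine ⟨B, fun x hx => ?_⟩
    have h : x.natAbs ≤ B := hB (Set.mem_image_of_mem _ hx)
    rw [Int.abs_eq_natAbs]
    exact_mod_cast h
  have hsum : ∀ s : Finset ℤ, (∀ x, c x ≠ 0 → x ∈ s) → ∑ x ∈ s, c x = ∑ᶠ x, c x := fun s hs =>
    (finsum_eq_sum_of_support_subset c (fun x hx => hs x hx)).symm
  set S := ∑ᶠ x, c x with hS
  set M := ∑ᶠ x, |c x| with hM
  have habs : ∀ s : Finset ℤ, ∑ x ∈ s, c x ≤ S + 2 * M := by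
    intro s
    have hM' : ∀ t : Finset ℤ, hfin.toFinset ⊆ t → ∑ x ∈ t, |c x| = M := fun t ht =>
      (finsum_eq_sum_of_support_subset (fun x => |c x|) (fun x hx => ht (by
        rw [Set.Finite.mem_toFinset]
        exact fun h0 => hx (by simpa using h0)))).symm
    have h1 : ∑ x ∈ s, c x ≤ M := calc
      ∑ x ∈ s, c x ≤ ∑ x ∈ s, |c x| := Finset.sum_le_sum fun x _ => le_abs_self _
      _ ≤ ∑ x ∈ s ∪ hfin.toFinset, |c x| :=
        Finset.sum_le_sum_of_subset_of_nonneg Finset.subset_union_left fun _ _ _ => abs_nonneg _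
      _ = M := hM' _ Finset.subset_union_right
    have h2 : -M ≤ S := by
      rw [← hsum hfin.toFinset fun x hx => by simpa using hx, ← hM' _ (subset_refl _),
        ← Finset.sum_neg_distrib]
      exact Finset.sum_le_sum fun x _ => neg_abs_le _
    linarith
  have hM0 : 0 ≤ M := finsum_nonneg fun x => abs_nonneg _
  have key : ∀ N : ℕ, 0 ≤ (N : ℝ) * S + 2 * K * (2 * M) := by
    intro N
    have hv : 0 ≤ cov[∑ i ∈ Finset.range N, (fun ω => f (shift (i : ℤ) ω)),
        ∑ i ∈ Finset.range N, (fun ω => f (shift (i : ℤ) ω)); gibbs V T] := by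
      rw [covariance_self]
      · exact variance_nonneg _ _
      · exact (Finset.aemeasurable_sum _ fun i _ =>
          (hf.1.comp (measurable_shift i)).aemeasurable)
    rw [covariance_sum_sum' (fun i _ => (shift_mem hf _).2.2)
      (fun i _ => (shift_mem hf _).2.2)] at hv
    have hrow : ∀ i ∈ Finset.range N, ∑ j ∈ Finset.range N,
        cov[fun ω => f (shift (i : ℤ) ω), fun ω => f (shift (j : ℤ) ω); gibbs V T]
          ≤ S + if i ∈ Finset.range K ∪ Finset.Ico (N - K) N then 2 * M else 0 := by
      intro i hi
      have hi' := Finset.mem_range.1 hi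
      have e : ∑ j ∈ Finset.range N,
          cov[fun ω => f (shift (i : ℤ) ω), fun ω => f (shift (j : ℤ) ω); gibbs V T]
            = ∑ x ∈ (Finset.range N).image (fun j : ℕ => (j : ℤ) - i), c x := by
        rw [Finset.sum_image (fun a _ b _ hab => by simpa using hab)]
        exact Finset.sum_congr rfl fun j _ => cov_shift_shift hf hf i j
      rw [e]
      split_ifs with hb
      · exact habs _
      · rw [hsum _ fun x hx => ?_]
        · simp
        have h1 := abs_le.1 (hK x hx)
        simp only [Finset.mem_union, Finset.mem_range, Finset.mem_Ico, not_or, not_and,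
          not_lt] at hb
        refine Finset.mem_image.2 ⟨(x + i).toNat, Finset.mem_range.2 ?_, ?_⟩ <;> omega
    have h3 := hv.trans (Finset.sum_le_sum hrow)
    rw [Finset.sum_add_distrib, Finset.sum_const, Finset.card_range, nsmul_eq_mul,
      ← Finset.sum_filter, Finset.sum_const, nsmul_eq_mul] at h3
    have h4 : ((Finset.range N).filter
        (fun i => i ∈ Finset.range K ∪ Finset.Ico (N - K) N)).card ≤ 2 * K := by
      refine (Finset.card_le_card (t := Finset.range K ∪ Finset.Ico (N - K) N)
        fun i hi => (Finset.mem_filter.1 hi).2).trans ?_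
      refine (Finset.card_union_le _ _).trans ?_
      simp only [Finset.card_range, Nat.card_Ico]
      omega
    have h5 : ((((Finset.range N).filter
        (fun i => i ∈ Finset.range K ∪ Finset.Ico (N - K) N)).card : ℕ) : ℝ) * (2 * M)
          ≤ 2 * K * (2 * M) := by
      refine mul_le_mul_of_nonneg_right ?_ (by linarith)
      exact_mod_cast h4
    linarith
  by_contra hneg
  have hneg' : S < 0 := not_le.1 hneg
  obtain ⟨N, hN⟩ := exists_nat_gt (2 * K * (2 * M) / (-S))
  rw [div_lt_iff₀ (by linarith)] at hN
  have := key N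
  linarith

/-- The space of local functions, as the carrier of the seminorm of `≪·, ·≫`. -/
def LocalFun (V : ℝ → ℝ) (T : ℝ) : Type := ↥(localL2 (gibbs V T))

instance (V : ℝ → ℝ) (T : ℝ) : AddCommGroup (LocalFun V T) :=
  inferInstanceAs (AddCommGroup ↥(localL2 (gibbs V T)))

instance (V : ℝ → ℝ) (T : ℝ) : Module ℝ (LocalFun V T) :=
  inferInstanceAs (Module ℝ ↥(localL2 (gibbs V T)))

/-- `≪·, ·≫` is a positive semidefinite symmetric bilinear form on local functions. -/
@[reducible] def localFunCore (V : ℝ → ℝ) (T : ℝ) : PreInnerProductSpace.Core ℝ (LocalFun V T) where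
  inner f g := semiInner (gibbs V T) f.1 g.1
  conj_inner_symm f g := semiInner_comm g.2 f.2
  re_inner_nonneg f := semiInner_self_nonneg f.2
  add_left f g h := semiInner_add_left f.2 g.2 h.2
  smul_left f g c := semiInner_smul_left _ c f.1 g.1

instance (V : ℝ → ℝ) (T : ℝ) : SeminormedAddCommGroup (LocalFun V T) :=
  @InnerProductSpace.Core.toSeminormedAddCommGroup ℝ (LocalFun V T) _ _ _ (localFunCore V T)

instance (V : ℝ → ℝ) (T : ℝ) : InnerProductSpace ℝ (LocalFun V T) :=
  InnerProductSpace.ofCore (localFunCore V T)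

lemma inner_localFun (V : ℝ → ℝ) (T : ℝ) (f g : LocalFun V T) :
    inner ℝ f g = semiInner (gibbs V T) f.1 g.1 := rfl

/-- The Hilbert space `ℋ_{0,T}`: the completion of the local functions for `≪·, ·≫` (functions of
seminorm zero, in particular all discrete gradients `θ_1 f - f`, are identified with zero). -/
abbrev HilbertH (V : ℝ → ℝ) (T : ℝ) : Type := UniformSpace.Completion (LocalFun V T)

open Classical in
/-- The class in `ℋ_{0,T}` of a local square integrable function (`0` for any other function). -/
def cls (V : ℝ → ℝ) (T : ℝ) (f : Config → ℝ) : HilbertH V T :=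
  if h : f ∈ localL2 (gibbs V T) then
    UniformSpace.Completion.coe' (show LocalFun V T from ⟨f, h⟩)
  else 0

/-! ### The dynamics -/

/-- `C¹` functions of finitely many coordinates with compact support in those coordinates. -/
def IsC01 (f : Config → ℝ) : Prop :=
  ∃ (Λ : Finset ℤ) (φ : (Λ → ℝ × ℝ) → ℝ), ContDiff ℝ 1 φ ∧ HasCompactSupport φ ∧
    f = fun ω => φ (fun i => ω i)

/-- The partial derivative `∂_{r_x} f`. -/
def partialR (x : ℤ) (f : Config → ℝ) (ω : Config) : ℝ :=
  deriv (fun s : ℝ => f (Function.update ω x (s, (ω x).2))) (ω x).1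

/-- The partial derivative `∂_{p_x} f`. -/
def partialP (x : ℤ) (f : Config → ℝ) (ω : Config) : ℝ :=
  deriv (fun s : ℝ => f (Function.update ω x ((ω x).1, s))) (ω x).2

/-- The configuration `ω^x`, in which the momentum at `x` has been flipped. -/
def flip (x : ℤ) (ω : Config) : Config := Function.update ω x ((ω x).1, -(ω x).2)

/-- The Liouville operator
`∑_x (p_x - p_{x-1}) ∂_{r_x} f + (V'(r_{x+1}) - V'(r_x)) ∂_{p_x} f`
(a finite sum when `f` is local). -/
def liouville (V : ℝ → ℝ) (f : Config → ℝ) (ω : Config) : ℝ :=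
  ∑ᶠ x : ℤ, (((ω x).2 - (ω (x - 1)).2) * partialR x f ω
    + (deriv V (ω (x + 1)).1 - deriv V (ω x).1) * partialP x f ω)

/-- The noise operator `∑_x (f(ω^x) - f(ω))` (a finite sum when `f` is local). -/
def noise (f : Config → ℝ) (ω : Config) : ℝ := ∑ᶠ x : ℤ, (f (flip x ω) - f ω)

/-- The formal generator: Liouville operator plus `γ` times the noise. -/
def formalGen (V : ℝ → ℝ) (γ : ℝ) (f : Config → ℝ) (ω : Config) : ℝ :=
  liouville V f ω + γ * noise f ω

/-- The graph in `ℋ × ℋ` of the closure of the formal generator on compactly supported local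
`C¹` functions. -/
def genGraph (V : ℝ → ℝ) (γ T : ℝ) : Set (HilbertH V T × HilbertH V T) :=
  closure {z | ∃ f : Config → ℝ, IsC01 f ∧ z = (cls V T f, cls V T (formalGen V γ f))}

/-- A strongly continuous one-parameter semigroup of bounded operators on a Banach space. -/
structure IsC0Semigroup {E : Type*} [NormedAddCommGroup E] [NormedSpace ℝ E]
    (P : ℝ → E →L[ℝ] E) : Prop where
  zero : P 0 = ContinuousLinearMap.id ℝ E
  add : ∀ s t : ℝ, 0 ≤ s → 0 ≤ t → P (s + t) = (P s).comp (P t)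
  cont : ∀ u : E, Tendsto (fun t => P t u) (𝓝[>] 0) (𝓝 u)

/-- The graph of the infinitesimal generator of a semigroup. -/
def semigroupGenGraph {E : Type*} [NormedAddCommGroup E] [NormedSpace ℝ E]
    (P : ℝ → E →L[ℝ] E) : Set (E × E) :=
  {z | Tendsto (fun t : ℝ => t⁻¹ • (P t z.1 - z.1)) (𝓝[>] 0) (𝓝 z.2)}

/-- The infinite dynamics exists at temperature `T`: some strongly continuous semigroup on
`ℋ_{0,T}` has a generator which extends the formal generator and has the compactly supported
local `C¹` functions as a core. -/
def DynamicsExists (V : ℝ → ℝ) (γ T : ℝ) : Prop :=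
  ∃ P : ℝ → HilbertH V T →L[ℝ] HilbertH V T,
    IsC0Semigroup P ∧ semigroupGenGraph P = genGraph V γ T

/-! ### The conductivity -/

/-- The energy current `j_{0,1} = -p_0 V'(r_1)`. -/
def current (V : ℝ → ℝ) (ω : Config) : ℝ := -(ω 0).2 * deriv V (ω 1).1

open Classical in
/-- The resolvent `(lam - L)⁻¹ g`, where `L` is the closed operator with graph `genGraph V γ T`
(`0` if the equation `lam u - L u = g` has no solution). -/
def resolvent (V : ℝ → ℝ) (γ T lam : ℝ) (g : HilbertH V T) : HilbertH V T :=
  if h : ∃ u : HilbertH V T, (u, lam • u - g) ∈ genGraph V γ T then h.choose else 0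

/-- `T⁻² ≪j_{0,1}, (lam - L)⁻¹ j_{0,1}≫`. -/
def greenKubo (V : ℝ → ℝ) (γ T lam : ℝ) : ℝ :=
  (T ^ 2)⁻¹ * inner ℝ (cls V T (current V)) (resolvent V γ T lam (cls V T (current V)))

/-- The thermal conductivity at zero tension, given by the Green-Kubo formula
`κ(T) = T⁻² lim_{lam ↓ 0} ≪j_{0,1}, (lam - L)⁻¹ j_{0,1}≫`. -/
def conductivity (V : ℝ → ℝ) (γ T : ℝ) : ℝ := limUnder (𝓝[>] 0) (greenKubo V γ T)

/-- The Green-Kubo formula makes sense at temperature `T`: the resolvent equation has exactly one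
solution for every `lam > 0`, and the limit defining `conductivity` exists. -/
def GreenKuboConverges (V : ℝ → ℝ) (γ T : ℝ) : Prop :=
  (∀ lam : ℝ, 0 < lam → ∃! u : HilbertH V T,
    (u, lam • u - cls V T (current V)) ∈ genGraph V γ T) ∧
  Tendsto (greenKubo V γ T) (𝓝[>] 0) (𝓝 (conductivity V γ T))

/-- The variance of `V'(r_0)` under the Gibbs measure at temperature `T`. -/
def forceVar (V : ℝ → ℝ) (T : ℝ) : ℝ := Var[fun ω : Config => deriv V (ω 0).1; gibbs V T]

/-- `A² a² ∫_0^∞ s^{2a-2} e^{-A s^a} ds / ∫_0^∞ e^{-A s^a} ds`. -/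
def varConst (A a : ℝ) : ℝ :=
  A ^ 2 * a ^ 2 * (∫ s in Set.Ioi (0 : ℝ), s ^ (2 * a - 2) * Real.exp (-A * s ^ a)) /
    ∫ s in Set.Ioi (0 : ℝ), Real.exp (-A * s ^ a)

end FlipChain

end

/-! At each fixed temperature one has $0\le\kappa(T)\le \mathrm{Var}_T(V'(r_0))/(2\gamma T)$
(`GibbsRegular.greenKubo_bound`); the powers of $T$ then come from Laplace-type asymptotics of the
variance.

The bound rests on the momentum reversal $R$. Write $L=A+\gamma S$ with $A$ the Liouville operator
and $S$ the noise. Stationarity of the Gibbs measure and the Leibniz rule make $A$ antisymmetric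
(`semiInner_liouville`), and $A$ anticommutes with $R$. The noise is symmetric, commutes with $R$
and satisfies $-S\ge 1-R$ (`inner_noiseL_le`): on functions odd in exactly $k$ of the momenta $-S$
acts as $2k$, and $k\ge1$ for functions odd under $R$. Hence $\ll f,Lf\gg\le-2\gamma\|f_{odd}\|^2$
and $RL$ is symmetric, and both properties pass to the closed graph. The current $j$ is odd under
$R$. Pairing $(\lambda-L)u_\lambda=j$ with $u_\lambda$ therefore controls exactly the part of
$u_\lambda$ that $j$ sees, and $Q(\lambda)=\ll j,u_\lambda\gg$ is at most $\|j\|^2/(2\gamma)$, where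
$\|j\|^2=T\,\mathrm{Var}_T(V'(r_0))$.

For the limit, symmetry of $RL$ gives $Q'(\lambda)=\ll Ru_\lambda,u_\lambda\gg$, which is bounded
below because only the odd part of $u_\lambda$ contributes negatively. So $Q$ plus a linear function
is monotone and bounded below near $0$ (`exists_tendsto_resolvent_form`); no convergence of
$u_\lambda$ itself is needed. Solvability of the resolvent equation is where the semigroup enters:
dissipativity gives uniqueness and closed range, and decay of $e^{-\lambda t}P_t$ on the domain
excludes a nonzero vector orthogonal to the range (`exists_resolvent_of_dissipative`).

For the variance, substitute $r=T^{1/a}s$, with $a=\alpha$ at high and $a=\delta$ at low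
temperature. Then $V(T^{1/a}s)/T\to As^a$, the rescaled force converges as well, and dominated
convergence applies (`isEquivalent_forceVar`). At low temperature $V\sim Ar^\delta$ has to be
differentiated; this is legitimate because $V$ is smooth at $0$, so that Taylor's formula forces
$\delta$ to be the order of the first nonvanishing derivative (`tendsto_deriv_div_rpow`). -/

noncomputable section

namespace FlipChain

/-! ### Strongly continuous semigroups and their generators -/

section Semigroup

variable {E : Type*} [NormedAddCommGroup E] [NormedSpace ℝ E] {P : ℝ → E →L[ℝ] E}

theorem IsC0Semigroup.map_add (hP : IsC0Semigroup P) {s t : ℝ} (hs : 0 ≤ s) (ht : 0 ≤ t) (u : E) :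
    P (s + t) u = P s (P t u) := by
  rw [hP.add s t hs ht]; rfl

theorem IsC0Semigroup.map_zero (hP : IsC0Semigroup P) (u : E) : P 0 u = u := by
  rw [hP.zero]; rfl

/-- Otherwise operators at times tending to $0$ would have unbounded norms although their orbits
converge, against Banach–Steinhaus. -/
theorem IsC0Semigroup.exists_local_bound [CompleteSpace E] (hP : IsC0Semigroup P) :
    ∃ δ > 0, ∃ M : ℝ, ∀ t ∈ Set.Icc 0 δ, ‖P t‖ ≤ M := by
  by_contra hcon
  push Not at hcon
  -- The extra `‖P 0‖` forces the chosen times to be nonzero, so that right continuity at $0$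
  -- applies along them.
  have h1 : ∀ n : ℕ, ∃ t ∈ Set.Icc (0 : ℝ) (1 / (n + 1)), (n : ℝ) + ‖P 0‖ < ‖P t‖ := fun n =>
    hcon (1 / ((n : ℝ) + 1)) (by positivity) _
  choose t ht hn using h1
  have hpos : ∀ n, 0 < t n := fun n => by
    refine lt_of_le_of_ne (ht n).1 fun h0 => ?_
    have := hn n
    rw [← h0] at this
    have h3 : (0 : ℝ) ≤ n := n.cast_nonneg
    linarith
  have hlim : Tendsto t atTop (𝓝[>] 0) := by
    refine tendsto_nhdsWithin_iff.2 ⟨?_, Eventually.of_forall hpos⟩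
    exact squeeze_zero (fun n => (ht n).1) (fun n => (ht n).2) tendsto_one_div_add_atTop_nhds_zero_nat
  obtain ⟨C, hC⟩ := banach_steinhaus (g := fun n => P (t n)) fun u => by
    obtain ⟨C, hC⟩ := (((hP.cont u).comp hlim).norm).bddAbove_range
    exact ⟨C, fun n => hC ⟨n, rfl⟩⟩
  obtain ⟨n, hn'⟩ := exists_nat_gt C
  have h3 := hn n
  have h4 := hC n
  have h5 := norm_nonneg (P 0)
  linarith

theorem IsC0Semigroup.continuousOn [CompleteSpace E] (hP : IsC0Semigroup P) (u : E) :
    ContinuousOn (fun t => P t u) (Set.Ici 0) := by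
  have hright : ∀ t : ℝ, 0 ≤ t → ContinuousWithinAt (fun t => P t u) (Set.Ici t) t := by
    intro t ht
    rw [← continuousWithinAt_Ioi_iff_Ici]
    have h1 : Tendsto (fun s => P t (P (s - t) u)) (𝓝[>] t) (𝓝 (P t u)) := by
      refine ((P t).continuous.tendsto u).comp ((hP.cont u).comp ?_)
      refine tendsto_nhdsWithin_iff.2 ⟨?_, ?_⟩
      · have : Tendsto (fun s : ℝ => s - t) (𝓝 t) (𝓝 (t - t)) :=
          (continuous_id.sub continuous_const).tendsto t
        rw [sub_self] at this
        exact this.mono_left nhdsWithin_le_nhds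
      · filter_upwards [self_mem_nhdsWithin] with s hs
        simpa using hs
    refine h1.congr' ?_
    filter_upwards [self_mem_nhdsWithin] with s hs
    rw [← hP.map_add ht (sub_nonneg.2 (le_of_lt hs))]
    congr 2; ring
  obtain ⟨δ, hδ, M, hM⟩ := hP.exists_local_bound
  intro t ht
  rcases eq_or_lt_of_le (show (0 : ℝ) ≤ t from ht) with h0 | h0
  · rw [← h0]; exact hright 0 le_rfl
  refine ContinuousAt.continuousWithinAt ?_
  rw [continuousAt_iff_continuous_left_right]
  refine ⟨?_, hright t h0.le⟩
  rw [← continuousWithinAt_Iio_iff_Iic]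
  -- For left continuity, $P_t-P_s=P_{t-\eta}P_{s-(t-\eta)}(P_{t-s}-1)$. The middle factor has time
  -- at most $\delta$, where the uniform bound holds, and the first factor is fixed.
  set η := min δ t with hη
  have hη0 : 0 < η := lt_min hδ h0
  have h2 : Tendsto (fun s => ‖P (t - η)‖ * M * ‖u - P (t - s) u‖) (𝓝[<] t) (𝓝 0) := by
    have : Tendsto (fun s => P (t - s) u) (𝓝[<] t) (𝓝 u) := by
      refine (hP.cont u).comp (tendsto_nhdsWithin_iff.2 ⟨?_, ?_⟩)
      · have : Tendsto (fun s : ℝ => t - s) (𝓝 t) (𝓝 (t - t)) :=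
          (continuous_const.sub continuous_id).tendsto t
        rw [sub_self] at this
        exact this.mono_left nhdsWithin_le_nhds
      · filter_upwards [self_mem_nhdsWithin] with s hs
        simpa using hs
    simpa using (((tendsto_const_nhds (x := u)).sub this).norm.const_mul (‖P (t - η)‖ * M))
  refine tendsto_iff_norm_sub_tendsto_zero.2 (squeeze_zero' (Eventually.of_forall fun _ =>
    norm_nonneg _) ?_ h2)
  have hmem : Set.Ioo (t - η) t ∈ 𝓝[<] t := Ioo_mem_nhdsLT (by linarith)
  filter_upwards [hmem] with s hs
  have hηδ : η ≤ δ := min_le_left _ _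
  have hηt : η ≤ t := min_le_right _ _
  have e1 : P t u = P s (P (t - s) u) := by
    rw [← hP.map_add (by linarith [hs.1]) (by linarith [hs.2])]; congr 2; ring
  have e2 : ∀ w, P s w = P (t - η) (P (s - (t - η)) w) := fun w => by
    rw [← hP.map_add (by linarith [hs.1]) (by linarith [hs.1])]; congr 2; ring
  rw [e1, ← _root_.map_sub, e2, mul_assoc]
  refine ((P (t - η)).le_opNorm _).trans ?_
  gcongr
  refine ((P _).le_opNorm _).trans ?_
  gcongr
  exact hM _ ⟨by linarith [hs.1], by linarith [hs.2]⟩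

theorem semigroupGenGraph_map (hP : IsC0Semigroup P) {z : E × E} (hz : z ∈ semigroupGenGraph P)
    {t : ℝ} (ht : 0 ≤ t) : (P t z.1, P t z.2) ∈ semigroupGenGraph P := by
  have h : Tendsto (fun h : ℝ => P t (h⁻¹ • (P h z.1 - z.1))) (𝓝[>] 0) (𝓝 (P t z.2)) :=
    ((P t).continuous.tendsto _).comp hz
  refine h.congr' ?_
  filter_upwards [self_mem_nhdsWithin] with h hh
  have hh' : 0 ≤ h := le_of_lt hh
  rw [map_smul, _root_.map_sub, ← hP.map_add ht hh', add_comm, hP.map_add hh' ht]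

theorem semigroupGenGraph_hasDerivWithinAt (hP : IsC0Semigroup P) {z : E × E}
    (hz : z ∈ semigroupGenGraph P) {t : ℝ} (ht : 0 ≤ t) :
    HasDerivWithinAt (fun s => P s z.1) (P t z.2) (Set.Ici t) t := by
  rw [← hasDerivWithinAt_Ioi_iff_Ici, hasDerivWithinAt_iff_tendsto_slope']
  · have h : Tendsto (fun h : ℝ => h⁻¹ • (P h (P t z.1) - P t z.1)) (𝓝[>] 0) (𝓝 (P t z.2)) :=
      semigroupGenGraph_map hP hz ht
    have h2 : Tendsto (fun s : ℝ => s - t) (𝓝[>] t) (𝓝[>] 0) := by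
      refine tendsto_nhdsWithin_iff.2 ⟨?_, ?_⟩
      · have : Tendsto (fun s : ℝ => s - t) (𝓝 t) (𝓝 (t - t)) :=
          (continuous_id.sub continuous_const).tendsto t
        rw [sub_self] at this
        exact this.mono_left nhdsWithin_le_nhds
      · filter_upwards [self_mem_nhdsWithin] with s hs
        simpa using hs
    refine (h.comp h2).congr' ?_
    filter_upwards [self_mem_nhdsWithin] with s hs
    simp only [Function.comp_apply, slope, vsub_eq_sub]
    rw [← hP.map_add (sub_nonneg.2 (le_of_lt hs)) ht, sub_add_cancel]
  · simp

theorem semigroupGenGraph_add {z w : E × E} (hz : z ∈ semigroupGenGraph P)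
    (hw : w ∈ semigroupGenGraph P) : z + w ∈ semigroupGenGraph P := by
  refine (Tendsto.add hz hw).congr fun t => ?_
  simp only [Prod.fst_add, _root_.map_add, ← smul_add]
  congr 1; abel

theorem semigroupGenGraph_smul (c : ℝ) {z : E × E} (hz : z ∈ semigroupGenGraph P) :
    c • z ∈ semigroupGenGraph P := by
  refine (Tendsto.const_smul hz c).congr fun t => ?_
  simp only [Prod.smul_fst, map_smul, ← smul_sub]
  rw [smul_comm]

theorem semigroupGenGraph_zero : (0 : E × E) ∈ semigroupGenGraph P := by
  simp [semigroupGenGraph]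

/-- The graph of the generator of a semigroup, as a submodule. -/
def semigroupGenSubmodule (P : ℝ → E →L[ℝ] E) : Submodule ℝ (E × E) where
  carrier := semigroupGenGraph P
  add_mem' := semigroupGenGraph_add
  zero_mem' := semigroupGenGraph_zero
  smul_mem' := semigroupGenGraph_smul

/-- Applying $P_h$ shifts the window of integration, so the difference quotient reduces to averages
of the orbit near $t$ and near $0$. -/
theorem semigroupGenGraph_integral [CompleteSpace E] (hP : IsC0Semigroup P) (u : E) {t : ℝ}
    (ht : 0 ≤ t) : (∫ s in (0 : ℝ)..t, P s u, P t u - u) ∈ semigroupGenGraph P := by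
  -- extend the orbit continuously to the whole line
  set φ : ℝ → E := fun s => P (max s 0) u with hφ
  have hφc : Continuous φ := by
    have := (hP.continuousOn u).comp_continuous (f := fun s : ℝ => max s 0)
      (by fun_prop) (fun s => le_max_right s 0)
    exact this
  have hφe : ∀ s, 0 ≤ s → φ s = P s u := fun s hs => by simp [hφ, max_eq_left hs]
  have hii : ∀ a b, IntervalIntegrable φ volume a b := fun a b => hφc.intervalIntegrable a b
  set F : ℝ → E := fun x => ∫ s in (0 : ℝ)..x, φ s with hF
  have hF' : ∀ x, HasDerivAt F (φ x) x := fun x =>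
    intervalIntegral.integral_hasDerivAt_right (hii 0 x)
      (hφc.stronglyMeasurableAtFilter _ _) hφc.continuousAt
  have e0 : ∫ s in (0 : ℝ)..t, P s u = F t := by
    refine intervalIntegral.integral_congr fun s hs => ?_
    rw [Set.uIcc_of_le ht] at hs
    exact (hφe s hs.1).symm
  have e1 : ∀ h, 0 ≤ h → P h (F t) - F t = (F (t + h) - F t) - (F h - F 0) := by
    intro h hh
    have : P h (F t) = ∫ s in (0 : ℝ)..t, φ (s + h) := by
      rw [hF, ← ContinuousLinearMap.intervalIntegral_comp_comm _ (hii 0 t)]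
      refine intervalIntegral.integral_congr fun s hs => ?_
      rw [Set.uIcc_of_le ht] at hs
      rw [hφe s hs.1, hφe _ (by linarith [hs.1]), add_comm s h, hP.map_add hh hs.1]
    rw [this, intervalIntegral.integral_comp_add_right, zero_add]
    have h2 : (∫ s in h..t + h, φ s) = F (t + h) - F h := by
      rw [hF, intervalIntegral.integral_interval_sub_left (hii _ _) (hii _ _)]
    have h3 : F 0 = 0 := by simp [hF]
    rw [h2, h3]; abel
  have d1 := ((hF' t).tendsto_slope_zero_right)
  have d2 := ((hF' 0).tendsto_slope_zero_right)
  have := d1.sub d2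
  rw [hφe t ht, hφe 0 le_rfl, hP.map_zero] at this
  show Tendsto _ _ _
  simp only [e0]
  refine this.congr' ?_
  filter_upwards [self_mem_nhdsWithin] with h hh
  rw [e1 h (le_of_lt hh), zero_add, smul_sub _ (F (t + h) - F t)]

/-- The averages $t^{-1}\int_0^tP_su\,ds$ lie in the domain and converge to $u$. -/
theorem dense_generator_domain [CompleteSpace E] (hP : IsC0Semigroup P) :
    Dense {u : E | ∃ w, (u, w) ∈ semigroupGenGraph P} := by
  intro u
  set φ : ℝ → E := fun s => P (max s 0) u with hφ
  have hφc : Continuous φ := by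
    have := (hP.continuousOn u).comp_continuous (f := fun s : ℝ => max s 0)
      (by fun_prop) (fun s => le_max_right s 0)
    exact this
  have hF' : HasDerivAt (fun x => ∫ s in (0 : ℝ)..x, φ s) (φ 0) 0 :=
    intervalIntegral.integral_hasDerivAt_right (hφc.intervalIntegrable _ _)
      (hφc.stronglyMeasurableAtFilter _ _) hφc.continuousAt
  have h1 := hF'.tendsto_slope_zero_right
  have h0 : φ 0 = u := by simp [hφ, hP.map_zero]
  rw [h0] at h1
  refine mem_closure_of_tendsto h1 ?_
  filter_upwards [self_mem_nhdsWithin] with t ht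
  have ht' : 0 ≤ t := le_of_lt ht
  have h2 := semigroupGenGraph_smul t⁻¹ (semigroupGenGraph_integral hP u ht')
  have e0 : ∫ s in (0 : ℝ)..t, P s u = ∫ s in (0 : ℝ)..t, φ s := by
    refine intervalIntegral.integral_congr fun s hs => ?_
    rw [Set.uIcc_of_le ht'] at hs
    simp [hφ, max_eq_left hs.1]
  rw [e0] at h2
  refine ⟨t⁻¹ • (P t u - u), ?_⟩
  simpa using h2

end Semigroup

/-! ### Dissipative generators and the resolvent quadratic form at zero -/

section Dissipative

variable {E : Type*} [NormedAddCommGroup E] [InnerProductSpace ℝ E] {P : ℝ → E →L[ℝ] E}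

/-- The right derivative of $\|P_tz\|^2$ is $2\langle P_tz,LP_tz\rangle\le0$. Only vectors of the
domain are treated, which is all that the range argument uses. -/
theorem norm_map_le_of_dissipative [CompleteSpace E] (hP : IsC0Semigroup P)
    (hdis : ∀ z ∈ semigroupGenGraph P, inner ℝ z.1 z.2 ≤ 0) {z : E × E}
    (hz : z ∈ semigroupGenGraph P) {t : ℝ} (ht : 0 ≤ t) : ‖P t z.1‖ ≤ ‖z.1‖ := by
  have hc : ContinuousOn (fun s => P s z.1) (Set.Icc 0 t) :=
    (hP.continuousOn z.1).mono fun s hs => hs.1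
  have h := image_le_of_deriv_right_le_deriv_boundary (f := fun s => ‖P s z.1‖ ^ 2)
    (f' := fun s => 2 * inner ℝ (P s z.1) (P s z.2)) (a := 0) (b := t)
    (B := fun _ => ‖z.1‖ ^ 2) (B' := fun _ => 0) (hc.norm.pow 2) ?_ ?_ continuousOn_const
    (fun x _ => hasDerivWithinAt_const _ _ _) ?_ (x := t) ⟨ht, le_rfl⟩
  · exact le_of_sq_le_sq h (norm_nonneg _)
  · intro x hx
    exact (semigroupGenGraph_hasDerivWithinAt hP hz hx.1).norm_sq
  · simp [hP.map_zero]
  · intro x hx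
    have := hdis _ (semigroupGenGraph_map hP hz hx.1)
    simp only at this
    linarith

theorem norm_sub_le_of_dissipative {u w : E} (h : inner ℝ u w ≤ 0) (lam : ℝ) :
    lam * ‖u‖ ≤ ‖lam • u - w‖ := by
  rcases eq_or_ne u 0 with rfl | hu
  · simp
  have hu' : 0 < ‖u‖ := norm_pos_iff.2 hu
  have h1 := real_inner_le_norm u (lam • u - w)
  rw [inner_sub_right, real_inner_smul_right, real_inner_self_eq_norm_sq] at h1
  refine le_of_mul_le_mul_left (a := ‖u‖) ?_ hu'
  nlinarith

/-- The range of $\lambda-L$ is closed, since $\lambda-L$ is bounded below on the closed graph. It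
is also dense: a vector $v$ orthogonal to it makes $e^{-\lambda t}\langle v,P_tu\rangle$ constant in
$t$ for $u$ in the domain, while contractivity makes this quantity tend to $0$. -/
theorem exists_resolvent_of_dissipative [CompleteSpace E] (hP : IsC0Semigroup P)
    (hcl : IsClosed (semigroupGenGraph P))
    (hdis : ∀ z ∈ semigroupGenGraph P, inner ℝ z.1 z.2 ≤ 0) {lam : ℝ} (hlam : 0 < lam) (g : E) :
    ∃ u, (u, lam • u - g) ∈ semigroupGenGraph P := by
  set G := semigroupGenSubmodule P with hG
  have hcl' : IsClosed (G : Set (E × E)) := hcl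
  have : CompleteSpace G := hcl'.completeSpace_coe
  let Φ : G →L[ℝ] E :=
    ((lam • ContinuousLinearMap.fst ℝ E E) - ContinuousLinearMap.snd ℝ E E).comp G.subtypeL
  have hΦ : ∀ z : G, Φ z = lam • z.1.1 - z.1.2 := fun z => rfl
  -- With $n=\|\lambda u-w\|$, dissipativity gives $\|u\|\le n/\lambda$ and then
  -- $\|w\|\le\lambda\|u\|+n\le2n$; the sum of the two constants dominates the maximum norm of the
  -- pair.
  have hanti : AntilipschitzWith (Real.toNNReal (2 + 1 / lam)) Φ := by
    refine AddMonoidHomClass.antilipschitz_of_bound Φ fun z => ?_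
    rw [hΦ, Real.coe_toNNReal _ (by positivity)]
    have h1 := norm_sub_le_of_dissipative (hdis z.1 z.2) lam
    set n := ‖lam • z.1.1 - z.1.2‖ with hn
    have h2 : ‖z.1.1‖ ≤ 1 / lam * n := by
      rw [one_div, ← div_eq_inv_mul, le_div_iff₀ hlam]; linarith
    have h3 : ‖z.1.2‖ ≤ 2 * n := by
      have : z.1.2 = lam • z.1.1 - (lam • z.1.1 - z.1.2) := by abel
      rw [this]
      refine (norm_sub_le _ _).trans ?_
      rw [norm_smul, Real.norm_of_nonneg hlam.le]
      linarith
    have h4 : 0 ≤ 1 / lam * n := by positivity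
    have h5 : 0 ≤ n := norm_nonneg _
    show ‖z.1‖ ≤ _
    rw [Prod.norm_def]
    refine max_le ?_ ?_ <;> linarith
  have hclosed : IsClosed (Set.range Φ) := hanti.isClosed_range Φ.uniformContinuous
  let K : Submodule ℝ E := LinearMap.range (Φ : G →ₗ[ℝ] E)
  have hKc : IsClosed (K : Set E) := by
    have : (K : Set E) = Set.range Φ := by ext; simp [K]
    rw [this]; exact hclosed
  have : CompleteSpace K := hKc.completeSpace_coe
  have hbot : Kᗮ = ⊥ := by
    rw [Submodule.eq_bot_iff]
    intro v hv
    have horth : ∀ z ∈ semigroupGenGraph P, inner ℝ v (lam • z.1 - z.2) = 0 := fun z hz =>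
      (Submodule.mem_orthogonal' K v).1 hv _ ⟨⟨z, hz⟩, rfl⟩
    have hzero : ∀ z ∈ semigroupGenGraph P, inner ℝ v z.1 = 0 := by
      intro z hz
      have hconst : ∀ t : ℝ, 0 ≤ t → Real.exp (-lam * t) * inner ℝ v (P t z.1) = inner ℝ v z.1 := by
        intro t ht
        have := constant_of_has_deriv_right_zero
          (f := fun s => Real.exp (-lam * s) * inner ℝ v (P s z.1)) (a := 0) (b := t) ?_ ?_ t
          ⟨ht, le_rfl⟩
        · simpa [hP.map_zero] using this
        · have hc : ContinuousOn (fun s => P s z.1) (Set.Icc 0 t) :=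
            (hP.continuousOn z.1).mono fun s hs => hs.1
          exact (by fun_prop : Continuous fun s => Real.exp (-lam * s)).continuousOn.mul
            (continuousOn_const.inner hc)
        · intro x hx
          have h1 := semigroupGenGraph_hasDerivWithinAt hP hz hx.1
          have h2 : HasDerivWithinAt (fun s => (inner ℝ v (P s z.1) : ℝ)) (inner ℝ v (P x z.2))
              (Set.Ici x) x :=
            (innerSL ℝ v).hasFDerivAt.comp_hasDerivWithinAt x h1
          have h3 : HasDerivWithinAt (fun s : ℝ => Real.exp (-lam * s))
              (Real.exp (-lam * x) * (-lam * 1)) (Set.Ici x) x :=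
            (((hasDerivAt_id x).const_mul (-lam)).exp).hasDerivWithinAt
          have h4 := h3.mul h2
          have h5 := horth _ (semigroupGenGraph_map hP hz hx.1)
          simp only [inner_sub_right, real_inner_smul_right] at h5
          refine h4.congr_deriv ?_
          linear_combination (-Real.exp (-lam * x)) * h5
      have hb : ∀ t : ℝ, 0 ≤ t → |(inner ℝ v z.1 : ℝ)| ≤ Real.exp (-lam * t) * (‖v‖ * ‖z.1‖) := by
        intro t ht
        rw [← hconst t ht, abs_mul, abs_of_pos (Real.exp_pos _)]
        gcongr
        refine (abs_real_inner_le_norm _ _).trans ?_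
        gcongr
        exact norm_map_le_of_dissipative hP hdis hz ht
      have hlim : Tendsto (fun t : ℝ => Real.exp (-lam * t) * (‖v‖ * ‖z.1‖)) atTop (𝓝 0) := by
        have h1 : Tendsto (fun t : ℝ => -lam * t) atTop atBot :=
          tendsto_id.const_mul_atTop_of_neg (by linarith)
        simpa using (Real.tendsto_exp_atBot.comp h1).mul_const (‖v‖ * ‖z.1‖)
      have := ge_of_tendsto hlim (by
        filter_upwards [eventually_ge_atTop 0] with t ht using hb t ht)
      exact abs_nonpos_iff.1 this
    have hall : ∀ u : E, inner ℝ v u = 0 := by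
      intro u
      have hcl2 : IsClosed {u : E | inner ℝ v u = 0} :=
        isClosed_eq (by fun_prop) continuous_const
      refine (hcl2.closure_subset_iff.2 ?_) (dense_generator_domain hP u)
      rintro u ⟨w, hw⟩
      exact hzero _ hw
    exact inner_self_eq_zero.1 (hall v)
  have htop : K = ⊤ := (Submodule.orthogonal_eq_bot_iff).1 hbot
  have hg : g ∈ K := htop ▸ Submodule.mem_top
  obtain ⟨⟨⟨u, w⟩, hz⟩, hu⟩ := hg
  refine ⟨u, ?_⟩
  have hu' : lam • u - w = g := hu
  rw [← hu', sub_sub_cancel]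
  exact hz

/-- The difference $d$ of two solutions satisfies $Ld=\lambda d$, and dissipativity leaves only
$d=0$. -/
theorem resolvent_unique {G : Submodule ℝ (E × E)} (hdis : ∀ z ∈ G, inner ℝ z.1 z.2 ≤ 0)
    {lam : ℝ} (hlam : 0 < lam) {g u u' : E} (hu : (u, lam • u - g) ∈ G)
    (hu' : (u', lam • u' - g) ∈ G) : u = u' := by
  have h := hdis _ (G.sub_mem hu hu')
  have e : lam • u - g - (lam • u' - g) = lam • (u - u') := by rw [smul_sub]; abel
  simp only [Prod.mk_sub_mk, e, real_inner_smul_right, real_inner_self_eq_norm_sq] at h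
  have h1 : ‖u - u'‖ ^ 2 ≤ 0 := by
    by_contra hc
    have := mul_pos hlam (not_le.1 hc)
    linarith
  have h2 : ‖u - u'‖ = 0 := by
    have := sq_nonneg ‖u - u'‖
    exact pow_eq_zero_iff (two_ne_zero) |>.1 (le_antisymm h1 this)
  exact sub_eq_zero.1 (norm_eq_zero.1 h2)

/-- Resolvent quadratic form of a dissipative relation that is symmetric up to an isometry `R`,
at a vector odd under `R`: the form is nonnegative, bounded, and has a limit at `0`. -/
theorem exists_tendsto_resolvent_form {G : Submodule ℝ (E × E)} {R : E → E} {c : ℝ} (hc : 0 < c)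
    (hR : ∀ u, ‖R u‖ = ‖u‖) (hRs : ∀ u v, inner ℝ (R u) v = (inner ℝ u (R v) : ℝ))
    (hdis : ∀ z ∈ G, inner ℝ z.1 z.2 ≤ -(c * (‖z.1 - R z.1‖ / 2) ^ 2))
    (hsymm : ∀ z ∈ G, ∀ w ∈ G, inner ℝ (R z.1) w.2 = (inner ℝ (R w.1) z.2 : ℝ))
    {j : E} (hj : R j = -j) {u : ℝ → E} (hu : ∀ lam, 0 < lam → (u lam, lam • u lam - j) ∈ G) :
    ∃ q : ℝ, Tendsto (fun lam => (inner ℝ j (u lam) : ℝ)) (𝓝[>] 0) (𝓝 q) ∧ 0 ≤ q ∧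
      q ≤ ‖j‖ ^ 2 / c := by
  have hdis0 : ∀ z ∈ G, (inner ℝ z.1 z.2 : ℝ) ≤ 0 := fun z hz =>
    (hdis z hz).trans (by have : 0 ≤ c * (‖z.1 - R z.1‖ / 2) ^ 2 := by positivity
                          linarith)
  set Q : ℝ → ℝ := fun lam => inner ℝ j (u lam) with hQ
  -- `a lam` is the norm of the odd part of `u lam`; since `j` is odd, the form `Q` sees nothing
  -- else.
  set a : ℝ → ℝ := fun lam => ‖u lam - R (u lam)‖ / 2 with ha
  have ha0 : ∀ lam, 0 ≤ a lam := fun lam => by positivity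
  -- energy identity
  have henergy : ∀ lam, 0 < lam → c * a lam ^ 2 + lam * ‖u lam‖ ^ 2 ≤ Q lam := by
    intro lam hlam
    have h := hdis _ (hu lam hlam)
    simp only [inner_sub_right, real_inner_smul_right, real_inner_self_eq_norm_sq] at h
    rw [real_inner_comm] at h
    simp only [hQ, ha]
    linarith
  have hQle : ∀ lam, Q lam ≤ a lam * ‖j‖ := by
    intro lam
    have h1 : (inner ℝ (R (u lam)) j : ℝ) = -inner ℝ (u lam) j := by
      rw [hRs, hj, inner_neg_right]
    have h2 : Q lam = inner ℝ (u lam - R (u lam)) j / 2 := by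
      simp only [hQ]
      rw [inner_sub_left, h1, real_inner_comm]
      ring
    rw [h2]
    have := real_inner_le_norm (u lam - R (u lam)) j
    simp only [ha]
    linarith
  have hale : ∀ lam, 0 < lam → a lam ≤ ‖j‖ / c := by
    intro lam hlam
    have h1 := henergy lam hlam
    have h2 := hQle lam
    have h3 : 0 ≤ lam * ‖u lam‖ ^ 2 := by positivity
    rcases eq_or_lt_of_le (ha0 lam) with h0 | h0
    · rw [← h0]; positivity
    rw [le_div_iff₀ hc]
    refine le_of_mul_le_mul_left (a := a lam) ?_ h0
    nlinarith
  have hQ0 : ∀ lam, 0 < lam → 0 ≤ Q lam := fun lam hlam =>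
    le_trans (by positivity) (henergy lam hlam)
  have hQb : ∀ lam, 0 < lam → Q lam ≤ ‖j‖ ^ 2 / c := by
    intro lam hlam
    refine (hQle lam).trans ?_
    have := mul_le_mul_of_nonneg_right (hale lam hlam) (norm_nonneg j)
    refine this.trans (le_of_eq ?_)
    ring
  -- resolvent identity
  have hdiff : ∀ lam mu, 0 < lam → 0 < mu →
      Q lam - Q mu = (lam - mu) * inner ℝ (R (u mu)) (u lam) := by
    intro lam mu hlam hmu
    have h := hsymm _ (hu mu hmu) _ (hu lam hlam)
    simp only [inner_sub_right, real_inner_smul_right] at h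
    rw [hRs (u mu) j, hRs (u lam) j, hj, inner_neg_right, inner_neg_right,
      real_inner_comm j (u mu), real_inner_comm j (u lam), hRs (u lam) (u mu),
      real_inner_comm (R (u mu)) (u lam)] at h
    simp only [hQ]
    linarith
  -- continuity
  have hcont : ∀ lam mu, 0 < lam → 0 < mu → ‖u lam - u mu‖ ≤ lam⁻¹ * (|mu - lam| * ‖u mu‖) := by
    intro lam mu hlam hmu
    have h := hdis0 _ (G.sub_mem (hu lam hlam) (hu mu hmu))
    have := norm_sub_le_of_dissipative h lam
    simp only [Prod.mk_sub_mk] at this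
    rw [← div_eq_inv_mul, le_div_iff₀ hlam, mul_comm]
    refine this.trans (le_of_eq ?_)
    rw [← Real.norm_eq_abs, ← norm_smul]
    congr 1
    module
  have hucont : ∀ mu, 0 < mu → Tendsto u (𝓝 mu) (𝓝 (u mu)) := by
    intro mu hmu
    refine tendsto_iff_norm_sub_tendsto_zero.2 (squeeze_zero' (Eventually.of_forall fun _ =>
      norm_nonneg _) ?_ (show Tendsto (fun lam => lam⁻¹ * (|mu - lam| * ‖u mu‖)) (𝓝 mu) (𝓝 0) from ?_))
    · filter_upwards [lt_mem_nhds hmu] with lam hlam using hcont lam mu hlam hmu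
    · have h1 : ContinuousAt (fun lam : ℝ => lam⁻¹ * (|mu - lam| * ‖u mu‖)) mu := by
        have : mu ≠ 0 := hmu.ne'
        fun_prop (disch := assumption)
      simpa [ContinuousAt] using h1
  have hderiv : ∀ mu, 0 < mu → HasDerivAt Q (inner ℝ (R (u mu)) (u mu)) mu := by
    intro mu hmu
    rw [hasDerivAt_iff_tendsto_slope]
    have h1 : Tendsto (fun lam => (inner ℝ (R (u mu)) (u lam) : ℝ)) (𝓝[≠] mu)
        (𝓝 (inner ℝ (R (u mu)) (u mu))) :=
      (Tendsto.inner tendsto_const_nhds (hucont mu hmu)).mono_left nhdsWithin_le_nhds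
    refine h1.congr' ?_
    filter_upwards [nhdsWithin_le_nhds (lt_mem_nhds hmu), self_mem_nhdsWithin] with lam hlam hne
    rw [slope_def_field, hdiff lam mu hlam hmu, mul_comm, mul_div_assoc, div_self, mul_one]
    exact sub_ne_zero.2 hne
  -- The derivative of `Q` is $\langle Ru,u\rangle=\|u\|^2-2a^2$. The even part of $u$ may blow up
  -- as $\lambda\downarrow0$, but $a\le\|j\|/c$ keeps the derivative above $-D$.
  set D := 2 * (‖j‖ / c) ^ 2 with hD
  have hlow : ∀ mu, 0 < mu → -D ≤ inner ℝ (R (u mu)) (u mu) := by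
    intro mu hmu
    have h1 : ‖u mu - R (u mu)‖ ^ 2 = 2 * ‖u mu‖ ^ 2 - 2 * inner ℝ (R (u mu)) (u mu) := by
      rw [norm_sub_sq_real, hR, real_inner_comm]; ring
    have h2 : a mu ^ 2 = ‖u mu - R (u mu)‖ ^ 2 / 4 := by simp only [ha]; ring
    have h3 : a mu ^ 2 ≤ (‖j‖ / c) ^ 2 := pow_le_pow_left₀ (ha0 mu) (hale mu hmu) 2
    have h4 := sq_nonneg ‖u mu‖
    simp only [hD]
    linarith
  have hmono : MonotoneOn (fun lam => Q lam + D * lam) (Set.Ioi 0) := by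
    have hd : ∀ mu ∈ Set.Ioi (0 : ℝ), HasDerivAt (fun lam => Q lam + D * lam)
        (inner ℝ (R (u mu)) (u mu) + D * 1) mu := fun mu hmu =>
      (hderiv mu hmu).add ((hasDerivAt_id mu).const_mul D)
    refine monotoneOn_of_deriv_nonneg (convex_Ioi 0)
      (fun mu hmu => (hd mu hmu).continuousAt.continuousWithinAt)
      (fun mu hmu => ?_) (fun mu hmu => ?_)
    · rw [interior_Ioi] at hmu
      exact (hd mu hmu).differentiableAt.differentiableWithinAt
    · rw [interior_Ioi] at hmu
      rw [(hd mu hmu).deriv]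
      have := hlow mu hmu
      linarith
  have hD0 : 0 ≤ D := by positivity
  have hlim1 := hmono.tendsto_nhdsGT (x := 0) ⟨0, by
    rintro _ ⟨lam, hlam, rfl⟩
    have h1 := hQ0 lam hlam
    have h2 : 0 ≤ D * lam := mul_nonneg hD0 (le_of_lt hlam)
    simp only
    linarith⟩
  have hlim2 : Tendsto (fun lam : ℝ => D * lam) (𝓝[>] 0) (𝓝 0) := by
    have : Tendsto (fun lam : ℝ => D * lam) (𝓝 0) (𝓝 (D * 0)) :=
      (continuous_const.mul continuous_id).tendsto 0
    rw [mul_zero] at this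
    exact this.mono_left nhdsWithin_le_nhds
  have hlim := hlim1.sub hlim2
  simp only [add_sub_cancel_right] at hlim
  refine ⟨_, hlim, ge_of_tendsto hlim ?_, le_of_tendsto hlim ?_⟩
  · filter_upwards [self_mem_nhdsWithin] with lam hlam using hQ0 lam hlam
  · filter_upwards [self_mem_nhdsWithin] with lam hlam using hQb lam hlam

end Dissipative

/-! ### One-site Gibbs measures and integration by parts -/

section Tilted

theorem measurePreserving_neg_tilted {f : ℝ → ℝ} (hf : Measurable f) (heven : ∀ r, f (-r) = f r) :
    MeasurePreserving (fun r : ℝ => -r) (volume.tilted f) (volume.tilted f) := by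
  refine ⟨measurable_neg, ?_⟩
  ext s hs
  rw [Measure.map_apply measurable_neg hs, tilted_apply' _ _ (measurable_neg hs),
    tilted_apply' _ _ hs, ← lintegral_indicator (measurable_neg hs), ← lintegral_indicator hs]
  have h := (Measure.measurePreserving_neg (volume : Measure ℝ)).lintegral_comp
    (f := s.indicator fun a => ENNReal.ofReal (Real.exp (f a) / ∫ x, Real.exp (f x)))
    (((hf.exp.div_const _).ennreal_ofReal).indicator hs)
  rw [← h]
  refine lintegral_congr fun r => ?_
  simp only [Set.indicator, heven]
  rfl

theorem integral_deriv_tilted {U U' g g' : ℝ → ℝ} (hU : ∀ r, HasDerivAt U (U' r) r)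
    (hg : ∀ r, HasDerivAt g (g' r) r) (hint : Integrable fun r => Real.exp (U r))
    (hint' : Integrable fun r => U' r * Real.exp (U r)) {C C' : ℝ} (hgb : ∀ r, |g r| ≤ C)
    (hgb' : ∀ r, |g' r| ≤ C') (hgm : Measurable g') :
    ∫ r, g' r ∂(volume.tilted U) = ∫ r, -U' r * g r ∂(volume.tilted U) := by
  have hgc : Continuous g := continuous_iff_continuousAt.2 fun r => (hg r).continuousAt
  rw [integral_tilted, integral_tilted]
  simp only [smul_eq_mul]
  set Z := ∫ x, Real.exp (U x)
  have i1 : Integrable fun r => g' r * Real.exp (U r) :=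
    hint.bdd_mul (c := C') hgm.aestronglyMeasurable (Eventually.of_forall hgb')
  have i2 : Integrable fun r => g r * (U' r * Real.exp (U r)) :=
    hint'.bdd_mul (c := C) hgc.aestronglyMeasurable (Eventually.of_forall hgb)
  have i3 : Integrable fun r => g r * Real.exp (U r) :=
    hint.bdd_mul (c := C) hgc.aestronglyMeasurable (Eventually.of_forall hgb)
  have h := integral_eq_zero_of_hasDerivAt_of_integrable
    (f := fun r => g r * Real.exp (U r))
    (f' := fun r => g' r * Real.exp (U r) + g r * (U' r * Real.exp (U r)))
    (fun r => by
      have := (hg r).mul (hU r).exp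
      refine this.congr_deriv ?_
      ring) (i1.add i2) i3
  rw [integral_add i1 i2] at h
  have e1 : ∀ r, Real.exp (U r) / Z * g' r = Z⁻¹ * (g' r * Real.exp (U r)) := fun r => by ring
  have e2 : ∀ r, Real.exp (U r) / Z * (-U' r * g r) = -Z⁻¹ * (g r * (U' r * Real.exp (U r))) :=
    fun r => by ring
  simp only [e1, e2, integral_const_mul]
  linear_combination Z⁻¹ * h

end Tilted

/-- Regularity of the potential at temperature `T`: smooth, even, with integrable Gibbs weight and
square integrable force. -/
structure GibbsRegular (V : ℝ → ℝ) (T : ℝ) : Prop where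
  smooth : ContDiff ℝ (⊤ : ℕ∞) V
  even : ∀ r, V (-r) = V r
  pos : 0 < T
  integrable_exp : Integrable fun r => Real.exp (-V r / T)
  integrable_force_sq : Integrable fun r => deriv V r ^ 2 * Real.exp (-V r / T)

/-- Law of the interparticle distance at one site. -/
def posMeasure (V : ℝ → ℝ) (T : ℝ) : Measure ℝ := volume.tilted fun r => -V r / T

/-- Law of the momentum at one site. -/
def momMeasure (T : ℝ) : Measure ℝ := gaussianReal 0 T.toNNReal

instance (T : ℝ) : IsProbabilityMeasure (momMeasure T) := by
  unfold momMeasure; infer_instance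

/-- The Gaussian form supplies the moments, the tilted form the integration by parts and the
factorization of the one-site measure. -/
theorem momMeasure_eq_tilted {T : ℝ} (hT : 0 < T) :
    momMeasure T = volume.tilted fun p => -(p ^ 2 / 2) / T := by
  have hv : T.toNNReal ≠ 0 := by simpa using hT
  unfold momMeasure Measure.tilted
  rw [gaussianReal_of_var_ne_zero _ hv]
  congr 1
  funext p
  unfold gaussianPDF gaussianPDFReal
  rw [Real.coe_toNNReal _ hT.le]
  congr 1
  have e : ∀ p : ℝ, -(p ^ 2 / 2) / T = -(1 / (2 * T)) * p ^ 2 := fun p => by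
    field_simp
  have h : ∫ x : ℝ, Real.exp (-(x ^ 2 / 2) / T) = √(2 * Real.pi * T) := by
    simp only [e]
    rw [integral_gaussian]
    congr 1
    field_simp
  have e2 : -(p - 0) ^ 2 / (2 * T) = -(p ^ 2 / 2) / T := by
    rw [sub_zero]
    field_simp
  rw [h, e2, inv_mul_eq_div]

theorem integrable_exp_kinetic {T : ℝ} (hT : 0 < T) :
    Integrable fun p : ℝ => Real.exp (-(p ^ 2 / 2) / T) := by
  have := integrable_exp_neg_mul_sq (b := 1 / (2 * T)) (by positivity)
  refine this.congr (Eventually.of_forall fun p => ?_)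
  simp only
  congr 1
  field_simp

theorem integrable_mul_exp_kinetic {T : ℝ} (hT : 0 < T) :
    Integrable fun p : ℝ => (-p / T) * Real.exp (-(p ^ 2 / 2) / T) := by
  have := (integrable_mul_exp_neg_mul_sq (b := 1 / (2 * T)) (by positivity)).const_mul (-1 / T)
  refine this.congr (Eventually.of_forall fun p => ?_)
  simp only
  have : -(1 / (2 * T)) * p ^ 2 = -(p ^ 2 / 2) / T := by field_simp
  rw [this]
  ring

namespace GibbsRegular

variable {V : ℝ → ℝ} {T : ℝ}

theorem continuous (h : GibbsRegular V T) : Continuous V := h.smooth.continuous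

theorem differentiable (h : GibbsRegular V T) : Differentiable ℝ V :=
  h.smooth.differentiable (by simp)

theorem continuous_deriv (h : GibbsRegular V T) : Continuous (deriv V) :=
  h.smooth.continuous_deriv (by simp)

theorem deriv_neg (h : GibbsRegular V T) (r : ℝ) : deriv V (-r) = -deriv V r := by
  have h1 : V = fun r => V (-r) := funext fun r => (h.even r).symm
  conv_rhs => rw [h1]
  rw [deriv_comp_neg]
  simp

theorem isProbabilityMeasure_pos (h : GibbsRegular V T) :
    IsProbabilityMeasure (posMeasure V T) :=
  isProbabilityMeasure_tilted h.integrable_exp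

/-- The density splits into a function of $r$ times a function of $p$. Its integrability puts
`siteMeasure` in its first branch, so the default Dirac mass plays no role. -/
theorem siteMeasure_eq (h : GibbsRegular V T) :
    siteMeasure V T = (posMeasure V T).prod (momMeasure T) := by
  have hV := h.continuous
  have e : ∀ z : ℝ × ℝ, Real.exp (-siteEnergy V z / T)
      = Real.exp (-V z.1 / T) * Real.exp (-(z.2 ^ 2 / 2) / T) := fun z => by
    rw [← Real.exp_add, siteEnergy]
    congr 1
    ring
  have hint : Integrable (fun z : ℝ × ℝ => Real.exp (-siteEnergy V z / T)) volume := by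
    simp only [e]
    exact h.integrable_exp.mul_prod (integrable_exp_kinetic h.pos)
  rw [siteMeasure, if_pos hint, momMeasure_eq_tilted h.pos, posMeasure, Measure.tilted,
    Measure.tilted, Measure.tilted, prod_withDensity (by fun_prop) (by fun_prop),
    ← Measure.volume_eq_prod]
  congr 1
  funext z
  rw [← ENNReal.ofReal_mul (by positivity)]
  congr 1
  simp only [e]
  rw [Measure.volume_eq_prod, integral_prod_mul (fun r => Real.exp (-V r / T))
    (fun p : ℝ => Real.exp (-(p ^ 2 / 2) / T))]
  ring

theorem memLp_force (h : GibbsRegular V T) : MemLp (deriv V) 2 (posMeasure V T) := by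
  rw [memLp_two_iff_integrable_sq h.continuous_deriv.aestronglyMeasurable, posMeasure,
    integrable_tilted_iff h.integrable_exp]
  refine h.integrable_force_sq.congr (Eventually.of_forall fun r => ?_)
  simp only [smul_eq_mul]
  ring

theorem measurePreserving_neg_pos (h : GibbsRegular V T) :
    MeasurePreserving (fun r : ℝ => -r) (posMeasure V T) (posMeasure V T) :=
  measurePreserving_neg_tilted (by have := h.continuous; fun_prop) fun r => by rw [h.even]

theorem integrable_force_exp (h : GibbsRegular V T) :
    Integrable fun r => (-deriv V r / T) * Real.exp (-V r / T) := by
  have := h.isProbabilityMeasure_pos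
  have h1 : Integrable (deriv V) (posMeasure V T) := h.memLp_force.integrable (by norm_num)
  rw [posMeasure, integrable_tilted_iff h.integrable_exp] at h1
  refine (h1.const_mul (-1 / T)).congr (Eventually.of_forall fun r => ?_)
  simp only [smul_eq_mul]
  ring

/-- Integration by parts in the position of one site. -/
theorem integral_deriv_pos (h : GibbsRegular V T) {g g' : ℝ → ℝ}
    (hg : ∀ r, HasDerivAt g (g' r) r) {C C' : ℝ} (hgb : ∀ r, |g r| ≤ C)
    (hgb' : ∀ r, |g' r| ≤ C') (hgm : Measurable g') :
    ∫ r, g' r ∂(posMeasure V T) = ∫ r, deriv V r / T * g r ∂(posMeasure V T) := by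
  have := integral_deriv_tilted (U := fun r => -V r / T) (U' := fun r => -deriv V r / T)
    (fun r => ((h.differentiable r).hasDerivAt.neg.div_const T)) hg h.integrable_exp
    h.integrable_force_exp hgb hgb' hgm
  rw [posMeasure, this]
  refine integral_congr_ae (Eventually.of_forall fun r => ?_)
  simp only
  ring

end GibbsRegular

/-- Integration by parts in the momentum of one site. -/
theorem integral_deriv_mom {T : ℝ} (hT : 0 < T) {g g' : ℝ → ℝ}
    (hg : ∀ r, HasDerivAt g (g' r) r) {C C' : ℝ} (hgb : ∀ r, |g r| ≤ C)
    (hgb' : ∀ r, |g' r| ≤ C') (hgm : Measurable g') :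
    ∫ p, g' p ∂(momMeasure T) = ∫ p, p / T * g p ∂(momMeasure T) := by
  rw [momMeasure_eq_tilted hT]
  have := integral_deriv_tilted (U := fun p => -(p ^ 2 / 2) / T) (U' := fun p => -p / T)
    (fun p => by
      have h1 : HasDerivAt (fun p : ℝ => p ^ 2) (2 * p) p := by simpa using hasDerivAt_pow 2 p
      refine ((h1.div_const 2).neg.div_const T).congr_deriv ?_
      ring) hg (integrable_exp_kinetic hT) (integrable_mul_exp_kinetic hT) hgb hgb' hgm
  rw [this]
  refine integral_congr_ae (Eventually.of_forall fun r => ?_)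
  simp only
  ring

theorem measurePreserving_neg_mom {T : ℝ} (hT : 0 < T) :
    MeasurePreserving (fun p : ℝ => -p) (momMeasure T) (momMeasure T) := by
  rw [momMeasure_eq_tilted hT]
  exact measurePreserving_neg_tilted (by fun_prop) fun p => by ring

theorem memLp_mom (T : ℝ) : MemLp (fun p : ℝ => p) 2 (momMeasure T) :=
  memLp_id_gaussianReal 2

theorem integral_sq_mom {T : ℝ} (hT : 0 < T) : ∫ p, p ^ 2 ∂(momMeasure T) = T := by
  have h := variance_fun_id_gaussianReal (μ := 0) (v := T.toNNReal)
  rw [Real.coe_toNNReal _ hT.le, variance_of_integral_eq_zero (by fun_prop)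
    (by simp [integral_id_gaussianReal])] at h
  exact h

/-! ### Resampling one coordinate and reversing momenta -/

/-- An independent fresh copy of one coordinate leaves a product measure unchanged, as is checked on
finite boxes. Through Fubini this turns integrals over configurations into integrals in a single
site variable. -/
theorem measurePreserving_resample (V : ℝ → ℝ) (T : ℝ) (x : ℤ) :
    MeasurePreserving (fun q : Config × (ℝ × ℝ) => Function.update q.1 x q.2)
      ((gibbs V T).prod (siteMeasure V T)) (gibbs V T) := by
  have hm : Measurable fun q : Config × (ℝ × ℝ) => Function.update q.1 x q.2 := by
    refine measurable_pi_lambda _ fun z => ?_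
    by_cases hz : z = x
    · subst hz; simpa using measurable_snd
    · simp only [Function.update_of_ne hz]
      exact (measurable_pi_apply z).comp measurable_fst
  refine ⟨hm, ?_⟩
  refine Measure.eq_infinitePi _ fun s t ht => ?_
  rw [Measure.map_apply hm (.pi s.countable_toSet fun _ _ => ht _)]
  by_cases hx : x ∈ s
  · have e : (fun q : Config × (ℝ × ℝ) => Function.update q.1 x q.2) ⁻¹' ((s : Set ℤ).pi t)
        = (((s.erase x : Finset ℤ) : Set ℤ).pi t) ×ˢ (t x) := by
      ext ⟨ω, z⟩
      simp only [Set.mem_preimage, Set.mem_pi, Set.mem_prod, Finset.mem_coe, Finset.mem_erase]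
      constructor
      · intro h
        refine ⟨fun i hi => ?_, by simpa using h x hx⟩
        simpa [Function.update_of_ne hi.1] using h i hi.2
      · rintro ⟨h1, h2⟩ i hi
        by_cases hix : i = x
        · subst hix; simpa using h2
        · simpa [Function.update_of_ne hix] using h1 i ⟨hix, hi⟩
    rw [e, Measure.prod_prod, gibbs, Measure.infinitePi_pi _ (fun i _ => ht i),
      Finset.prod_erase_mul _ _ hx]
  · have e : (fun q : Config × (ℝ × ℝ) => Function.update q.1 x q.2) ⁻¹' ((s : Set ℤ).pi t)
        = ((s : Set ℤ).pi t) ×ˢ Set.univ := by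
      ext ⟨ω, z⟩
      simp only [Set.mem_preimage, Set.mem_pi, Set.mem_prod, Finset.mem_coe, Set.mem_univ, and_true]
      refine forall₂_congr fun i hi => ?_
      rw [Function.update_of_ne (fun h : i = x => hx (h ▸ hi))]
    rw [e, Measure.prod_prod, gibbs, Measure.infinitePi_pi _ (fun i _ => ht i), measure_univ,
      mul_one]

/-- Replacing the site `x` after a measure preserving map of the site variables. -/
theorem measurePreserving_resample_of_site {V : ℝ → ℝ} {T : ℝ} (x : ℤ) {ν : Measure ℝ}
    [IsProbabilityMeasure ν] {k : (ℝ × ℝ) × ℝ → ℝ × ℝ}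
    (hk : MeasurePreserving k ((siteMeasure V T).prod ν) (siteMeasure V T)) :
    MeasurePreserving (fun q : Config × ℝ => Function.update q.1 x (k (q.1 x, q.2)))
      ((gibbs V T).prod ν) (gibbs V T) := by
  have h1 := measurePreserving_resample V T x
  have hm : Measurable fun q : Config × ℝ => Function.update q.1 x (k (q.1 x, q.2)) := by
    refine measurable_pi_lambda _ fun z => ?_
    by_cases hz : z = x
    · subst hz
      simp only [Function.update_self]
      exact hk.measurable.comp (by fun_prop)
    · simp only [Function.update_of_ne hz]
      exact (measurable_pi_apply z).comp measurable_fst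
  -- Representing the configuration itself as a resampled one makes the value at `x` an independent
  -- variable. The map `k` then acts on that variable alone, and its result is one more fresh
  -- sample.
  have h2 : MeasurePreserving (fun q : (Config × (ℝ × ℝ)) × ℝ => (Function.update q.1.1 x q.1.2, q.2))
      (((gibbs V T).prod (siteMeasure V T)).prod ν) ((gibbs V T).prod ν) :=
    h1.prod (MeasurePreserving.id ν)
  have h3 : MeasurePreserving
      (fun q : (Config × (ℝ × ℝ)) × ℝ => Function.update q.1.1 x (k (q.1.2, q.2)))
      (((gibbs V T).prod (siteMeasure V T)).prod ν) (gibbs V T) := by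
    have h4 : MeasurePreserving (fun q : Config × ((ℝ × ℝ) × ℝ) => (q.1, k q.2))
        ((gibbs V T).prod ((siteMeasure V T).prod ν)) ((gibbs V T).prod (siteMeasure V T)) :=
      (MeasurePreserving.id _).prod hk
    exact (h1.comp h4).comp (measurePreserving_prodAssoc _ _ _)
  refine ⟨hm, ?_⟩
  rw [← h2.map_eq, Measure.map_map hm h2.measurable]
  refine Eq.trans ?_ h3.map_eq
  congr 1
  funext q
  simp

theorem GibbsRegular.measurePreserving_resample_pos {V : ℝ → ℝ} {T : ℝ} (h : GibbsRegular V T)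
    (x : ℤ) : MeasurePreserving (fun q : Config × ℝ => Function.update q.1 x (q.2, (q.1 x).2))
      ((gibbs V T).prod (posMeasure V T)) (gibbs V T) := by
  have := h.isProbabilityMeasure_pos
  refine measurePreserving_resample_of_site x (k := fun q => (q.2, q.1.2)) ?_
  rw [h.siteMeasure_eq]
  have h1 : MeasurePreserving (fun q : (ℝ × ℝ) × ℝ => (q.1.2, q.2))
      (((posMeasure V T).prod (momMeasure T)).prod (posMeasure V T))
      ((momMeasure T).prod (posMeasure V T)) :=
    (measurePreserving_snd).prod (MeasurePreserving.id _)
  exact Measure.measurePreserving_swap.comp h1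

theorem GibbsRegular.measurePreserving_resample_mom {V : ℝ → ℝ} {T : ℝ} (h : GibbsRegular V T)
    (x : ℤ) : MeasurePreserving (fun q : Config × ℝ => Function.update q.1 x ((q.1 x).1, q.2))
      ((gibbs V T).prod (momMeasure T)) (gibbs V T) := by
  have := h.isProbabilityMeasure_pos
  refine measurePreserving_resample_of_site x (k := fun q => (q.1.1, q.2)) ?_
  rw [h.siteMeasure_eq]
  exact (measurePreserving_fst).prod (MeasurePreserving.id _)

open Classical in
/-- Reversal of the momenta in a set of sites. -/
def flipOn (S : Set ℤ) (ω : Config) : Config :=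
  fun z => if z ∈ S then ((ω z).1, -(ω z).2) else ω z

theorem measurable_flipOn (S : Set ℤ) : Measurable (flipOn S) := by
  classical
  refine measurable_pi_lambda _ fun z => ?_
  by_cases hz : z ∈ S
  · simp only [flipOn, hz, if_true]; fun_prop
  · simp only [flipOn, hz, if_false]; fun_prop

theorem flip_eq_flipOn (x : ℤ) : flip x = flipOn {x} := by
  funext ω z
  by_cases hz : z = x
  · subst hz; simp [flip, flipOn]
  · simp [flip, flipOn, hz]

theorem flipOn_flipOn (S : Set ℤ) (ω : Config) : flipOn S (flipOn S ω) = ω := by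
  funext z
  by_cases hz : z ∈ S <;> simp [flipOn, hz]

theorem GibbsRegular.measurePreserving_flipOn {V : ℝ → ℝ} {T : ℝ} (h : GibbsRegular V T)
    (S : Set ℤ) : MeasurePreserving (flipOn S) (gibbs V T) (gibbs V T) := by
  classical
  have := h.isProbabilityMeasure_pos
  refine ⟨measurable_flipOn S, ?_⟩
  set f : ℤ → ℝ × ℝ → ℝ × ℝ := fun z w => if z ∈ S then (w.1, -w.2) else w with hf
  have hfm : ∀ z, Measurable (f z) := fun z => by
    by_cases hz : z ∈ S
    · simp only [hf, hz, if_true]; fun_prop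
    · simp only [hf, hz, if_false]; fun_prop
  have e : flipOn S = fun (ω : Config) z => f z (ω z) := by
    funext ω z
    simp only [flipOn, hf]
  have hpres : MeasurePreserving (fun w : ℝ × ℝ => (w.1, -w.2)) (siteMeasure V T)
      (siteMeasure V T) := by
    rw [h.siteMeasure_eq]
    exact (MeasurePreserving.id _).prod (measurePreserving_neg_mom h.pos)
  rw [e, gibbs, Measure.infinitePi_map_pi _ hfm]
  congr 1
  funext z
  by_cases hz : z ∈ S
  · simp only [hf, hz, if_true]; exact hpres.map_eq
  · simp only [hf, hz, if_false]; exact Measure.map_id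

theorem measurePreserving_eval_gibbs (V : ℝ → ℝ) (T : ℝ) (x : ℤ) :
    MeasurePreserving (fun ω : Config => ω x) (gibbs V T) (siteMeasure V T) :=
  measurePreserving_eval_infinitePi (fun _ : ℤ => siteMeasure V T) x

theorem GibbsRegular.measurePreserving_eval_pos {V : ℝ → ℝ} {T : ℝ} (h : GibbsRegular V T)
    (x : ℤ) : MeasurePreserving (fun ω : Config => (ω x).1) (gibbs V T) (posMeasure V T) := by
  have := h.isProbabilityMeasure_pos
  have h1 : MeasurePreserving Prod.fst (siteMeasure V T) (posMeasure V T) := by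
    rw [h.siteMeasure_eq]; exact measurePreserving_fst
  exact h1.comp (measurePreserving_eval_gibbs V T x)

theorem GibbsRegular.measurePreserving_eval_mom {V : ℝ → ℝ} {T : ℝ} (h : GibbsRegular V T)
    (x : ℤ) : MeasurePreserving (fun ω : Config => (ω x).2) (gibbs V T) (momMeasure T) := by
  have := h.isProbabilityMeasure_pos
  have h1 : MeasurePreserving Prod.snd (siteMeasure V T) (momMeasure T) := by
    rw [h.siteMeasure_eq]; exact measurePreserving_snd
  exact h1.comp (measurePreserving_eval_gibbs V T x)

/-! ### Positivity of Toeplitz averages -/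

/-- A finitely supported sequence on `ℤ` with nonnegative Toeplitz sums has nonnegative sum. -/
theorem finsum_nonneg_of_toeplitz {c : ℤ → ℝ} (hfin : (Function.support c).Finite)
    (hpos : ∀ N : ℕ, 0 ≤ ∑ i ∈ Finset.range N, ∑ j ∈ Finset.range N, c ((j : ℤ) - i)) :
    0 ≤ ∑ᶠ x, c x := by
  classical
  set s := hfin.toFinset with hs
  have hsum : ∑ᶠ x, c x = ∑ x ∈ s, c x := finsum_eq_sum_of_support_subset _ (by simp [hs])
  -- the number of pairs with a given difference
  set m : ℕ → ℤ → ℝ := fun N x =>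
    (((Finset.range N ×ˢ Finset.range N).filter fun p : ℕ × ℕ => (p.2 : ℤ) - p.1 = x).card : ℝ)
    with hm
  have hrew : ∀ N : ℕ, ∑ i ∈ Finset.range N, ∑ j ∈ Finset.range N, c ((j : ℤ) - i)
      = ∑ x ∈ s, m N x * c x := by
    intro N
    rw [← Finset.sum_product' (Finset.range N) (Finset.range N) fun i j => c ((j : ℤ) - i)]
    have h1 : ∀ x ∈ s, m N x * c x = ∑ p ∈ (Finset.range N ×ˢ Finset.range N),
        if (p.2 : ℤ) - p.1 = x then c x else 0 := by
      intro x _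
      rw [← Finset.sum_filter, Finset.sum_const, nsmul_eq_mul]
    rw [Finset.sum_congr rfl h1, Finset.sum_comm]
    refine Finset.sum_congr rfl fun p _ => ?_
    rw [Finset.sum_ite_eq]
    split_ifs with h
    · rfl
    · by_contra hne
      exact h (by simpa [hs] using hne)
  -- Divided by `N`, the number of pairs on each fixed diagonal tends to $1$, so the normalized
  -- Toeplitz sum tends to the full sum.
  have hcard : ∀ (N : ℕ) (x : ℤ), (N : ℝ) - |x| ≤ m N x ∧ m N x ≤ N := by
    intro N x
    constructor
    · have h1 : ((Finset.Ico (-x).toNat (N - x.toNat)).image fun i : ℕ => (i, ((i : ℤ) + x).toNat))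
          ⊆ (Finset.range N ×ˢ Finset.range N).filter fun p : ℕ × ℕ => (p.2 : ℤ) - p.1 = x := by
        intro p hp
        obtain ⟨i, hi, rfl⟩ := Finset.mem_image.1 hp
        have hi' := Finset.mem_Ico.1 hi
        simp only [Finset.mem_filter, Finset.mem_product, Finset.mem_range]
        refine ⟨⟨?_, ?_⟩, ?_⟩ <;> omega
      have h2 := Finset.card_le_card h1
      rw [Finset.card_image_of_injective _ (fun a b hab => (Prod.ext_iff.1 hab).1), Nat.card_Ico] at h2
      have h3 : (N : ℤ) - |x| ≤ ((N - x.toNat - (-x).toNat : ℕ) : ℤ) := by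
        rcases abs_cases x with ⟨h, _⟩ | ⟨h, _⟩ <;> rw [h] <;> omega
      have h4 : (N : ℤ) - |x| ≤ (((Finset.range N ×ˢ Finset.range N).filter
          fun p : ℕ × ℕ => (p.2 : ℤ) - p.1 = x).card : ℤ) := h3.trans (by exact_mod_cast h2)
      simp only [hm]
      exact_mod_cast h4
    · simp only [hm]
      have h1 : ((Finset.range N ×ˢ Finset.range N).filter
          fun p : ℕ × ℕ => (p.2 : ℤ) - p.1 = x).card ≤ (Finset.range N).card := by
        refine Finset.card_le_card_of_injOn Prod.fst (fun p hp => ?_) fun p hp q hq h => ?_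
        · exact (Finset.mem_product.1 (Finset.mem_filter.1 hp).1).1
        · have h2 := (Finset.mem_filter.1 hp).2
          have h3 := (Finset.mem_filter.1 hq).2
          refine Prod.ext h ?_
          omega
      rw [Finset.card_range] at h1
      exact_mod_cast h1
  have hlim : Tendsto (fun N : ℕ => ∑ x ∈ s, (m N x / N) * c x) atTop (𝓝 (∑ x ∈ s, 1 * c x)) := by
    refine tendsto_finsetSum _ fun x _ => Tendsto.mul_const _ ?_
    have hl : Tendsto (fun N : ℕ => 1 - (|x| : ℝ) / N) atTop (𝓝 1) := by
      simpa using (tendsto_const_div_atTop_nhds_zero_nat (|x| : ℝ)).const_sub 1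
    refine tendsto_of_tendsto_of_tendsto_of_le_of_le' hl tendsto_const_nhds ?_ ?_
    · filter_upwards [eventually_gt_atTop 0] with N hN
      have hN' : (0 : ℝ) < N := by exact_mod_cast hN
      have := (hcard N x).1
      push_cast at this
      rw [le_div_iff₀ hN', sub_mul, one_mul, div_mul_cancel₀ _ hN'.ne']
      exact this
    · filter_upwards [eventually_gt_atTop 0] with N hN
      have hN' : (0 : ℝ) < N := by exact_mod_cast hN
      rw [div_le_one hN']
      exact (hcard N x).2
  simp only [one_mul] at hlim
  rw [hsum]
  refine ge_of_tendsto' hlim fun N => ?_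
  have e : ∑ x ∈ s, (m N x / N) * c x = (∑ x ∈ s, m N x * c x) / N := by
    rw [Finset.sum_div]
    exact Finset.sum_congr rfl fun x _ => by ring
  rw [e, ← hrew]
  exact div_nonneg (hpos N) N.cast_nonneg

/-! ### Linear operators on local functions -/
section Operators

variable {V : ℝ → ℝ} {T : ℝ}

/-- The function underlying an element of `LocalFun V T`. -/
def LocalFun.fn (f : LocalFun V T) : Config → ℝ :=
  (show ↥(localL2 (gibbs V T)) from f).1

/-- A local function as an element of `LocalFun V T`. -/
def LocalFun.mk (f : Config → ℝ) (hf : f ∈ localL2 (gibbs V T)) : LocalFun V T :=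
  (⟨f, hf⟩ : ↥(localL2 (gibbs V T)))

theorem LocalFun.mem (f : LocalFun V T) : f.fn ∈ localL2 (gibbs V T) :=
  (show ↥(localL2 (gibbs V T)) from f).2

theorem LocalFun.ext {f g : LocalFun V T} (h : f.fn = g.fn) : f = g :=
  Subtype.ext (p := fun f => f ∈ localL2 (gibbs V T)) h

theorem LocalFun.fn_sum {ι : Type*} (s : Finset ι) (u : ι → LocalFun V T) :
    (∑ i ∈ s, u i).fn = ∑ i ∈ s, (u i).fn :=
  map_sum (localL2 (gibbs V T)).subtype u s

theorem LocalFun.inner_def (f g : LocalFun V T) :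
    (inner ℝ f g : ℝ) = ∑ᶠ x : ℤ, cov[f.fn, fun ω => g.fn (shift x ω); gibbs V T] := rfl

/-- The shift of local functions. -/
def shiftL (x : ℤ) : LocalFun V T →ₗ[ℝ] LocalFun V T where
  toFun f := LocalFun.mk (fun ω => f.fn (shift x ω)) (shift_mem f.mem x)
  map_add' _ _ := rfl
  map_smul' _ _ := rfl

/-- Positivity for the ordinary covariance passes to $\ll\cdot,\cdot\gg$: tested on block sums of
the shifts of $f$, it gives nonnegative Toeplitz sums of the shifted covariances. This is how
inequalities proved under $\mu_T$ enter $\mathcal H_T$. -/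
theorem semiInner_map_nonneg {A : LocalFun V T →ₗ[ℝ] LocalFun V T}
    (hA : ∀ x f, A (shiftL x f) = shiftL x (A f))
    (hpos : ∀ f, 0 ≤ cov[f.fn, (A f).fn; gibbs V T]) (f : LocalFun V T) :
    0 ≤ (inner ℝ f (A f) : ℝ) := by
  rw [LocalFun.inner_def]
  refine finsum_nonneg_of_toeplitz (finite_support f.mem (A f).mem) fun N => ?_
  have h := hpos (∑ i ∈ Finset.range N, shiftL (i : ℤ) f)
  rw [map_sum, LocalFun.fn_sum, LocalFun.fn_sum,
    covariance_sum_sum' (X := fun i : ℕ => (shiftL (i : ℤ) f).fn)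
    (Y := fun i : ℕ => (A (shiftL (i : ℤ) f)).fn)
    (fun i _ => (shiftL (i : ℤ) f).mem.2.2) (fun i _ => (A (shiftL (i : ℤ) f)).mem.2.2)] at h
  refine h.trans (le_of_eq (Finset.sum_congr rfl fun i _ => Finset.sum_congr rfl fun j _ => ?_))
  rw [hA]
  exact cov_shift_shift f.mem (A f).mem i j

theorem dependsOn_flipOn {f : Config → ℝ} {Λ : Finset ℤ} (hΛ : DependsOn f (Λ : Set ℤ))
    (S : Set ℤ) : DependsOn (fun ω => f (flipOn S ω)) (Λ : Set ℤ) := fun a b hab =>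
  hΛ fun i hi => by simp only [flipOn, hab i hi]

theorem GibbsRegular.flipOn_mem (h : GibbsRegular V T) {f : Config → ℝ}
    (hf : f ∈ localL2 (gibbs V T)) (S : Set ℤ) :
    (fun ω => f (flipOn S ω)) ∈ localL2 (gibbs V T) := by
  obtain ⟨hm, ⟨Λ, hΛ⟩, h2⟩ := hf
  exact ⟨hm.comp (measurable_flipOn S), ⟨Λ, dependsOn_flipOn hΛ S⟩,
    h2.comp_measurePreserving (h.measurePreserving_flipOn S)⟩

/-- Reversal of momenta on local functions. -/
def flipL (h : GibbsRegular V T) (S : Set ℤ) : LocalFun V T →ₗ[ℝ] LocalFun V T where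
  toFun f := LocalFun.mk (fun ω => f.fn (flipOn S ω)) (h.flipOn_mem f.mem S)
  map_add' _ _ := rfl
  map_smul' _ _ := rfl

theorem GibbsRegular.cov_flipOn (h : GibbsRegular V T) {f g : Config → ℝ}
    (hf : Measurable f) (hg : Measurable g) (S : Set ℤ) :
    cov[fun ω => f (flipOn S ω), fun ω => g (flipOn S ω); gibbs V T] = cov[f, g; gibbs V T] := by
  have hp := h.measurePreserving_flipOn S
  conv_rhs => rw [← hp.map_eq]
  rw [covariance_map_fun hf.aestronglyMeasurable hg.aestronglyMeasurable
    (measurable_flipOn S).aemeasurable]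

theorem GibbsRegular.cov_flipOn_left (h : GibbsRegular V T) {f g : Config → ℝ}
    (hf : Measurable f) (hg : Measurable g) (S : Set ℤ) :
    cov[fun ω => f (flipOn S ω), g; gibbs V T] = cov[f, fun ω => g (flipOn S ω); gibbs V T] := by
  have := h.cov_flipOn hf (hg.comp (measurable_flipOn S)) S
  simp only [Function.comp_apply, flipOn_flipOn] at this
  exact this

theorem shift_flipOn_univ (x : ℤ) (ω : Config) :
    shift x (flipOn Set.univ ω) = flipOn Set.univ (shift x ω) := by
  funext z; simp [shift, flipOn]

theorem shift_flip (x y : ℤ) (ω : Config) : shift x (flip (x + y) ω) = flip y (shift x ω) := by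
  funext z
  simp only [shift, flip_eq_flipOn, flipOn, Set.mem_singleton_iff, add_right_inj]

theorem inner_flipL_left (h : GibbsRegular V T) (f g : LocalFun V T) :
    (inner ℝ (flipL h Set.univ f) g : ℝ) = inner ℝ f (flipL h Set.univ g) := by
  simp only [LocalFun.inner_def]
  refine finsum_congr fun x => ?_
  have := h.cov_flipOn_left f.mem.1 (g.mem.1.comp (measurable_shift x)) Set.univ
  refine this.trans ?_
  simp only [Function.comp_apply, shift_flipOn_univ]
  rfl

theorem flipL_flipL (h : GibbsRegular V T) (f : LocalFun V T) (S : Set ℤ) :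
    flipL h S (flipL h S f) = f := by
  refine LocalFun.ext (funext fun ω => ?_)
  show f.fn (flipOn S (flipOn S ω)) = f.fn ω
  rw [flipOn_flipOn]

theorem flip_apply_of_dependsOn {f : Config → ℝ} {Λ : Finset ℤ} (hΛ : DependsOn f (Λ : Set ℤ))
    {x : ℤ} (hx : x ∉ Λ) (ω : Config) : f (flip x ω) = f ω :=
  hΛ fun i hi => by
    have : i ≠ x := fun h => hx (h ▸ hi)
    simp [flip, this]

theorem noise_eq_sum {f : Config → ℝ} {Λ : Finset ℤ} (hΛ : DependsOn f (Λ : Set ℤ)) :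
    noise f = fun ω => ∑ x ∈ Λ, (f (flip x ω) - f ω) := by
  funext ω
  refine finsum_eq_sum_of_support_subset _ fun x hx => ?_
  by_contra hne
  exact hx (by simp [flip_apply_of_dependsOn hΛ hne])

theorem GibbsRegular.flip_mem (h : GibbsRegular V T) {f : Config → ℝ}
    (hf : f ∈ localL2 (gibbs V T)) (x : ℤ) : (fun ω => f (flip x ω)) ∈ localL2 (gibbs V T) := by
  rw [flip_eq_flipOn]; exact h.flipOn_mem hf _

theorem GibbsRegular.noise_mem (h : GibbsRegular V T) {f : Config → ℝ}
    (hf : f ∈ localL2 (gibbs V T)) : noise f ∈ localL2 (gibbs V T) := by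
  obtain ⟨Λ, hΛ⟩ := hf.2.1
  rw [noise_eq_sum hΛ]
  have := Submodule.sum_mem (localL2 (gibbs V T)) (t := Λ)
    (f := fun x => (fun ω => f (flip x ω)) - f) fun x _ => Submodule.sub_mem _ (h.flip_mem hf x) hf
  convert! this using 1
  funext ω
  simp

theorem noise_support_finite {f : Config → ℝ} (hf : ∃ Λ : Finset ℤ, DependsOn f (Λ : Set ℤ))
    (ω : Config) : (Function.support fun x : ℤ => f (flip x ω) - f ω).Finite := by
  obtain ⟨Λ, hΛ⟩ := hf
  refine Λ.finite_toSet.subset fun x hx => ?_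
  by_contra hne
  exact hx (by simp [flip_apply_of_dependsOn hΛ hne])

/-- The noise operator on local functions. -/
def noiseL (h : GibbsRegular V T) : LocalFun V T →ₗ[ℝ] LocalFun V T where
  toFun f := LocalFun.mk (noise f.fn) (h.noise_mem f.mem)
  map_add' f g := by
    refine LocalFun.ext (funext fun ω => ?_)
    show noise (f.fn + g.fn) ω = noise f.fn ω + noise g.fn ω
    unfold noise
    rw [← finsum_add_distrib (noise_support_finite f.mem.2.1 ω) (noise_support_finite g.mem.2.1 ω)]
    refine finsum_congr fun x => ?_
    simp only [Pi.add_apply]; ring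
  map_smul' c f := by
    refine LocalFun.ext (funext fun ω => ?_)
    show noise (c • f.fn) ω = c • noise f.fn ω
    unfold noise
    rw [smul_finsum]
    refine finsum_congr fun x => ?_
    simp only [Pi.smul_apply, smul_eq_mul]; ring

theorem noise_shift (f : Config → ℝ) (x : ℤ) :
    noise (fun ω => f (shift x ω)) = fun ω => noise f (shift x ω) := by
  funext ω
  unfold noise
  rw [← finsum_comp_equiv (Equiv.addLeft x)]
  refine finsum_congr fun y => ?_
  simp only [Equiv.coe_addLeft, shift_flip]

/-- Each flip is a measure-preserving involution, hence symmetric for the covariance. Both noise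
sums are taken over a common support, so that they can be matched term by term. -/
theorem GibbsRegular.cov_noise_left (h : GibbsRegular V T) {f g : Config → ℝ}
    (hf : f ∈ localL2 (gibbs V T)) (hg : g ∈ localL2 (gibbs V T)) :
    cov[noise f, g; gibbs V T] = cov[f, noise g; gibbs V T] := by
  classical
  obtain ⟨Λ, hΛ⟩ := hf.2.1
  obtain ⟨Λ', hΛ'⟩ := hg.2.1
  have h1 : DependsOn f ((Λ ∪ Λ' : Finset ℤ) : Set ℤ) := fun a b hab =>
    hΛ fun i hi => hab i (by simp_all)
  have h2 : DependsOn g ((Λ ∪ Λ' : Finset ℤ) : Set ℤ) := fun a b hab =>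
    hΛ' fun i hi => hab i (by simp_all)
  rw [noise_eq_sum h1, noise_eq_sum h2,
    covariance_fun_sum_left' (X := fun x ω => f (flip x ω) - f ω) (fun x _ => ((h.flip_mem hf x).2.2.sub hf.2.2)) hg.2.2,
    covariance_fun_sum_right' (X := fun x ω => g (flip x ω) - g ω) (fun x _ => ((h.flip_mem hg x).2.2.sub hg.2.2)) hf.2.2]
  refine Finset.sum_congr rfl fun x _ => ?_
  rw [covariance_fun_sub_left (h.flip_mem hf x).2.2 hf.2.2 hg.2.2,
    covariance_fun_sub_right hf.2.2 (h.flip_mem hg x).2.2 hg.2.2]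
  simp only [flip_eq_flipOn]
  rw [h.cov_flipOn_left hf.1 hg.1]

theorem inner_noiseL_left (h : GibbsRegular V T) (f g : LocalFun V T) :
    (inner ℝ (noiseL h f) g : ℝ) = inner ℝ f (noiseL h g) := by
  simp only [LocalFun.inner_def]
  refine finsum_congr fun x => ?_
  have := h.cov_noise_left f.mem (shift_mem g.mem x)
  refine this.trans ?_
  rw [noise_shift]
  rfl

theorem noise_flipOn_univ (f : Config → ℝ) :
    noise (fun ω => f (flipOn Set.univ ω)) = fun ω => noise f (flipOn Set.univ ω) := by
  funext ω
  unfold noise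
  refine finsum_congr fun y => ?_
  have : flipOn Set.univ (flip y ω) = flip y (flipOn Set.univ ω) := by
    funext z
    by_cases hz : z = y <;> simp [flip_eq_flipOn, flipOn, hz]
  simp only [this]

/-- `∫ F (F - F ∘ φ_S)` is subadditive over the sites of `S`. -/
theorem GibbsRegular.cov_sub_flipOn_le (h : GibbsRegular V T) {f : Config → ℝ}
    (hf : f ∈ localL2 (gibbs V T)) (Λ : Finset ℤ) :
    cov[f, fun ω => f ω - f (flipOn (Λ : Set ℤ) ω); gibbs V T]
      ≤ ∑ x ∈ Λ, cov[f, fun ω => f ω - f (flip x ω); gibbs V T] := by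
  classical
  induction Λ using Finset.induction_on with
  | empty =>
    have : ∀ ω, flipOn ∅ ω = ω := fun ω => by
      funext z; simp [flipOn]
    simp [this]
  | insert x Λ hx ih =>
    rw [Finset.sum_insert hx]
    refine le_trans ?_ (add_le_add_right ih _)
    set S : Set ℤ := (Λ : Set ℤ)
    have hins : ∀ ω, flipOn (((insert x Λ : Finset ℤ)) : Set ℤ) ω = flipOn {x} (flipOn S ω) := by
      intro ω; funext z
      by_cases hz : z = x
      · subst hz; simp [flipOn, S, hx]
      · simp [flipOn, S, hz]
    have hcomm : ∀ ω, flipOn {x} (flipOn S ω) = flipOn S (flipOn {x} ω) := by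
      intro ω; funext z
      by_cases hz : z = x
      · subst hz; simp [flipOn, S, hx]
      · simp [flipOn, hz]
    simp only [hins, flip_eq_flipOn]
    set f1 : Config → ℝ := fun ω => f (flipOn {x} ω) with hf1
    set f2 : Config → ℝ := fun ω => f (flipOn S ω) with hf2
    set f3 : Config → ℝ := fun ω => f (flipOn {x} (flipOn S ω)) with hf3
    have m1 : f1 ∈ localL2 (gibbs V T) := h.flipOn_mem hf _
    have m2 : f2 ∈ localL2 (gibbs V T) := h.flipOn_mem hf _
    have m3 : f3 ∈ localL2 (gibbs V T) := h.flipOn_mem m1 S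
    have c11 : cov[f1, f1; gibbs V T] = cov[f, f; gibbs V T] := h.cov_flipOn hf.1 hf.1 _
    have c22 : cov[f2, f2; gibbs V T] = cov[f, f; gibbs V T] := h.cov_flipOn hf.1 hf.1 _
    have c33 : cov[f3, f3; gibbs V T] = cov[f, f; gibbs V T] :=
      (h.cov_flipOn m1.1 m1.1 S).trans c11
    have c12 : cov[f1, f2; gibbs V T] = cov[f, f3; gibbs V T] := by
      have := h.cov_flipOn_left hf.1 m2.1 {x}
      rw [hf1, this]
      simp only [hf2, hf3, hcomm]
    have c13 : cov[f1, f3; gibbs V T] = cov[f, f2; gibbs V T] := by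
      rw [← h.cov_flipOn hf.1 m2.1 {x}]
      simp only [hf1, hf2, hf3, hcomm]
    have c23 : cov[f2, f3; gibbs V T] = cov[f, f1; gibbs V T] := h.cov_flipOn hf.1 m1.1 S
    -- With $a,b$ the flips at `x` and on `S`, commuting symmetric involutions,
    -- $\|(1-a)(1-b)f\|^2=4\langle f,(1-a)(1-b)f\rangle$ for the centred $f$. Nonnegativity says
    -- $1-ab\le(1-a)+(1-b)$, which is the induction step.
    have hnn : 0 ≤ cov[f - f1 - f2 + f3, f - f1 - f2 + f3; gibbs V T] := by
      rw [covariance_self]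
      · exact variance_nonneg _ _
      · exact (((hf.1.sub m1.1).sub m2.1).add m3.1).aemeasurable
    have l0 := hf.2.2
    have l1 := m1.2.2
    have l2 := m2.2.2
    have l3 := m3.2.2
    have expand : ∀ g : Config → ℝ, MemLp g 2 (gibbs V T) →
        cov[f - f1 - f2 + f3, g; gibbs V T] = cov[f, g; gibbs V T] - cov[f1, g; gibbs V T]
          - cov[f2, g; gibbs V T] + cov[f3, g; gibbs V T] := fun g hg => by
      rw [covariance_add_left ((l0.sub l1).sub l2) l3 hg, covariance_sub_left (l0.sub l1) l2 hg,
        covariance_sub_left l0 l1 hg]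
    have l4 : MemLp (f - f1 - f2 + f3) 2 (gibbs V T) := ((l0.sub l1).sub l2).add l3
    rw [expand _ l4, covariance_comm f, covariance_comm f1, covariance_comm f2, covariance_comm f3,
      expand _ l0, expand _ l1, expand _ l2, expand _ l3, covariance_comm f1 f, covariance_comm f2 f,
      covariance_comm f3 f, covariance_comm f2 f1, covariance_comm f3 f1,
      covariance_comm f3 f2, c11, c22, c33, c12, c13, c23] at hnn
    rw [covariance_fun_sub_right l0 l0 l3, covariance_fun_sub_right l0 l0 l1,
      covariance_fun_sub_right l0 l0 l2]
    linarith

/-- The spectral gap of the noise. On a function supported in $\Lambda$ the full reversal is the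
product of the flips in $\Lambda$, and $1$ minus a product of commuting involutions is at most the
sum of the terms $1$ minus each of them. Shift invariance carries this over to $\ll\cdot,\cdot\gg$.
-/
theorem inner_noiseL_le (h : GibbsRegular V T) (f : LocalFun V T) :
    (inner ℝ f (noiseL h f) : ℝ) ≤ -inner ℝ f (f - flipL h Set.univ f) := by
  have key := semiInner_map_nonneg (A := -noiseL h - (LinearMap.id - flipL h Set.univ)) ?_ ?_ f
  · simp only [LinearMap.sub_apply, LinearMap.neg_apply, inner_sub_right, inner_neg_right,
      LinearMap.id_apply] at key ⊢
    linarith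
  · intro x g
    refine LocalFun.ext (funext fun ω => ?_)
    have h1 := congrFun (noise_shift g.fn x) ω
    have h2 : g.fn (shift x (flipOn Set.univ ω)) = g.fn (flipOn Set.univ (shift x ω)) := by
      rw [shift_flipOn_univ]
    show -noise (fun ω => g.fn (shift x ω)) ω - (g.fn (shift x ω) - g.fn (shift x (flipOn Set.univ ω)))
      = -noise g.fn (shift x ω) - (g.fn (shift x ω) - g.fn (flipOn Set.univ (shift x ω)))
    rw [h1, h2]
  · intro g
    obtain ⟨Λ, hΛ⟩ := g.mem.2.1
    have h1 := h.cov_sub_flipOn_le g.mem Λ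
    have e1 : ∀ ω, g.fn (flipOn (Λ : Set ℤ) ω) = g.fn (flipOn Set.univ ω) := fun ω =>
      hΛ fun i hi => by
        have : i ∈ Λ := hi
        simp [flipOn, this]
    have l0 := g.mem.2.2
    have lR := (h.flipOn_mem g.mem Set.univ).2.2
    have hn := (h.noise_mem g.mem).2.2
    have e2 : cov[g.fn, noise g.fn; gibbs V T]
        = -∑ x ∈ Λ, cov[g.fn, fun ω => g.fn ω - g.fn (flip x ω); gibbs V T] := by
      rw [noise_eq_sum hΛ,
        covariance_fun_sum_right' (X := fun x ω => g.fn (flip x ω) - g.fn ω)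
          (fun x _ => ((h.flip_mem g.mem x).2.2.sub l0)) l0,
        ← Finset.sum_neg_distrib]
      refine Finset.sum_congr rfl fun x _ => ?_
      rw [covariance_fun_sub_right l0 (h.flip_mem g.mem x).2.2 l0,
        covariance_fun_sub_right l0 l0 (h.flip_mem g.mem x).2.2]
      ring
    simp only [e1] at h1
    have e3 : ((-noiseL h - (LinearMap.id - flipL h Set.univ) : LocalFun V T →ₗ[ℝ] _) g).fn
        = -noise g.fn - fun ω => g.fn ω - g.fn (flipOn Set.univ ω) := rfl
    rw [e3, covariance_sub_right (Z := fun ω => g.fn ω - g.fn (flipOn Set.univ ω)) l0 hn.neg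
      (l0.sub lR), covariance_neg_right, e2]
    linarith

end Operators

/-! ### Differentiable local functions -/

/-- Bounded local functions with bounded partial derivatives. -/
structure IsBddC1Local (f : Config → ℝ) : Prop where
  measurable : Measurable f
  dependsOn : ∃ Λ : Finset ℤ, DependsOn f (Λ : Set ℤ)
  bdd : ∃ C : ℝ, ∀ ω, |f ω| ≤ C
  differentiableAt_pos : ∀ x ω,
    DifferentiableAt ℝ (fun s : ℝ => f (Function.update ω x (s, (ω x).2))) (ω x).1
  differentiableAt_mom : ∀ x ω,
    DifferentiableAt ℝ (fun s : ℝ => f (Function.update ω x ((ω x).1, s))) (ω x).2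
  measurable_partialR : ∀ x, Measurable (partialR x f)
  measurable_partialP : ∀ x, Measurable (partialP x f)
  bdd_partialR : ∀ x, ∃ C : ℝ, ∀ ω, |partialR x f ω| ≤ C
  bdd_partialP : ∀ x, ∃ C : ℝ, ∀ ω, |partialP x f ω| ≤ C

theorem partialR_eq_zero {f : Config → ℝ} {Λ : Finset ℤ} (hΛ : DependsOn f (Λ : Set ℤ)) {x : ℤ}
    (hx : x ∉ Λ) (ω : Config) : partialR x f ω = 0 := by
  have : (fun s : ℝ => f (Function.update ω x (s, (ω x).2))) = fun _ => f ω := by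
    funext s
    refine hΛ fun i hi => ?_
    rw [Function.update_of_ne (fun h : i = x => hx (h ▸ hi))]
  rw [partialR, this, deriv_const]

theorem partialP_eq_zero {f : Config → ℝ} {Λ : Finset ℤ} (hΛ : DependsOn f (Λ : Set ℤ)) {x : ℤ}
    (hx : x ∉ Λ) (ω : Config) : partialP x f ω = 0 := by
  have : (fun s : ℝ => f (Function.update ω x ((ω x).1, s))) = fun _ => f ω := by
    funext s
    refine hΛ fun i hi => ?_
    rw [Function.update_of_ne (fun h : i = x => hx (h ▸ hi))]
  rw [partialP, this, deriv_const]

theorem dependsOn_partialR {f : Config → ℝ} {Λ : Finset ℤ} (hΛ : DependsOn f (Λ : Set ℤ)) (x : ℤ) :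
    DependsOn (partialR x f) (Λ : Set ℤ) := by
  intro a b hab
  by_cases hx : x ∈ Λ
  · have hxab : a x = b x := hab x hx
    unfold partialR
    rw [hxab]
    congr 1
    funext s
    refine hΛ fun i hi => ?_
    by_cases hix : i = x
    · subst hix; simp
    · simp [hix, hab i hi]
  · rw [partialR_eq_zero hΛ hx, partialR_eq_zero hΛ hx]

theorem dependsOn_partialP {f : Config → ℝ} {Λ : Finset ℤ} (hΛ : DependsOn f (Λ : Set ℤ)) (x : ℤ) :
    DependsOn (partialP x f) (Λ : Set ℤ) := by
  intro a b hab
  by_cases hx : x ∈ Λ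
  · have hxab : a x = b x := hab x hx
    unfold partialP
    rw [hxab]
    congr 1
    funext s
    refine hΛ fun i hi => ?_
    by_cases hix : i = x
    · subst hix; simp
    · simp [hix, hab i hi]
  · rw [partialP_eq_zero hΛ hx, partialP_eq_zero hΛ hx]

/-- On sites of the support the partial derivatives are values of `fderiv` on coordinate vectors,
and compact support bounds both the function and its derivative. The larger class allows products
and shifts without tracking compact supports. -/
theorem IsC01.isBddC1Local {f : Config → ℝ} (hf : IsC01 f) : IsBddC1Local f := by
  classical
  obtain ⟨Λ, φ, hφ, hc, rfl⟩ := hf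
  have hres : Measurable fun (ω : Config) (i : Λ) => ω i :=
    measurable_pi_lambda _ fun i => measurable_pi_apply _
  have hdep : DependsOn (fun ω : Config => φ fun i => ω i) (Λ : Set ℤ) := by
    intro a b hab
    simp only
    congr 1
    funext i
    exact hab i i.2
  have hupd : ∀ (ω : Config) (x : ℤ) (hx : x ∈ Λ) (z : ℝ × ℝ),
      (fun i : Λ => Function.update ω x z i) = Function.update (fun i : Λ => ω i) ⟨x, hx⟩ z := by
    intro ω x hx z
    funext i
    by_cases hi : (i : ℤ) = x
    · have : i = ⟨x, hx⟩ := Subtype.ext hi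
      subst this; simp
    · have : i ≠ ⟨x, hx⟩ := fun h => hi (congrArg Subtype.val h)
      simp [hi, this]
  have hderiv : ∀ (ω : Config) (x : ℤ) (hx : x ∈ Λ) (c : ℝ → ℝ × ℝ) (v : ℝ × ℝ) (s : ℝ),
      HasDerivAt c v s → c s = ω x → HasDerivAt
        (fun s => φ fun i => Function.update ω x (c s) i)
        (fderiv ℝ φ (fun i : Λ => ω i) (Pi.single ⟨x, hx⟩ v)) s := by
    intro ω x hx c v s hcs hs
    have h1 : HasDerivAt (fun s => fun i : Λ => Function.update ω x (c s) i)
        (Pi.single ⟨x, hx⟩ v) s := by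
      rw [funext fun s => hupd ω x hx (c s), hasDerivAt_pi]
      intro i
      by_cases hi : i = ⟨x, hx⟩
      · subst hi; simpa using hcs
      · simpa [hi] using hasDerivAt_const s (ω i)
    have h2 : (fun i : Λ => Function.update ω x (c s) i) = fun i : Λ => ω i := by
      rw [hs, Function.update_eq_self]
    have h3 : HasFDerivAt φ (fderiv ℝ φ (fun i : Λ => ω i))
        (fun i : Λ => Function.update ω x (c s) i) := by
      rw [h2]
      exact ((hφ.differentiable (by simp)) _).hasFDerivAt
    exact h3.comp_hasDerivAt s h1
  have hdR : ∀ (ω : Config) (x : ℤ) (hx : x ∈ Λ), HasDerivAt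
      (fun s : ℝ => φ fun i => Function.update ω x (s, (ω x).2) i)
      (fderiv ℝ φ (fun i : Λ => ω i) (Pi.single ⟨x, hx⟩ (1, 0))) (ω x).1 := fun ω x hx =>
    hderiv ω x hx (fun s => (s, (ω x).2)) (1, 0) _ ((hasDerivAt_id _).prodMk (hasDerivAt_const _ _))
      rfl
  have hdP : ∀ (ω : Config) (x : ℤ) (hx : x ∈ Λ), HasDerivAt
      (fun s : ℝ => φ fun i => Function.update ω x ((ω x).1, s) i)
      (fderiv ℝ φ (fun i : Λ => ω i) (Pi.single ⟨x, hx⟩ (0, 1))) (ω x).2 := fun ω x hx =>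
    hderiv ω x hx (fun s => ((ω x).1, s)) (0, 1) _ ((hasDerivAt_const _ _).prodMk (hasDerivAt_id _))
      rfl
  have hfc : Continuous (fderiv ℝ φ) := hφ.continuous_fderiv (by simp)
  obtain ⟨C, hC⟩ := hc.exists_bound_of_continuous hφ.continuous
  obtain ⟨C', hC'⟩ := (hc.fderiv (𝕜 := ℝ)).exists_bound_of_continuous hfc
  have hmeas : ∀ v, Measurable fun ω : Config => fderiv ℝ φ (fun i : Λ => ω i) v := fun v =>
    (by fun_prop : Continuous fun y => fderiv ℝ φ y v).measurable.comp hres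
  have hb : ∀ (v : Λ → ℝ × ℝ) (ω : Config), |fderiv ℝ φ (fun i : Λ => ω i) v| ≤ C' * ‖v‖ :=
    fun v ω => ((fderiv ℝ φ (fun i : Λ => ω i)).le_opNorm v).trans (by gcongr; exact hC' _)
  have eR : ∀ x (hx : x ∈ Λ), partialR x (fun ω : Config => φ fun i => ω i)
      = fun ω => fderiv ℝ φ (fun i : Λ => ω i) (Pi.single ⟨x, hx⟩ (1, 0)) := fun x hx =>
    funext fun ω => (hdR ω x hx).deriv
  have eP : ∀ x (hx : x ∈ Λ), partialP x (fun ω : Config => φ fun i => ω i)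
      = fun ω => fderiv ℝ φ (fun i : Λ => ω i) (Pi.single ⟨x, hx⟩ (0, 1)) := fun x hx =>
    funext fun ω => (hdP ω x hx).deriv
  have zR : ∀ x, x ∉ Λ → partialR x (fun ω : Config => φ fun i => ω i) = fun _ => 0 := fun x hx =>
    funext fun ω => partialR_eq_zero hdep hx ω
  have zP : ∀ x, x ∉ Λ → partialP x (fun ω : Config => φ fun i => ω i) = fun _ => 0 := fun x hx =>
    funext fun ω => partialP_eq_zero hdep hx ω
  have hconst : ∀ (ω : Config) (x : ℤ), x ∉ Λ → ∀ c : ℝ → ℝ × ℝ,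
      (fun s => φ fun i : Λ => Function.update ω x (c s) i) = fun _ => φ fun i => ω i := by
    intro ω x hx c
    funext s
    exact hdep fun i hi => by rw [Function.update_of_ne (fun h : i = x => hx (h ▸ hi))]
  refine ⟨hφ.continuous.measurable.comp hres, ⟨Λ, hdep⟩, ⟨C, fun ω => hC _⟩, ?_, ?_, ?_, ?_, ?_, ?_⟩
  · intro x ω
    by_cases hx : x ∈ Λ
    · exact (hdR ω x hx).differentiableAt
    · rw [hconst ω x hx]; exact differentiableAt_const _
  · intro x ω
    by_cases hx : x ∈ Λ
    · exact (hdP ω x hx).differentiableAt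
    · rw [hconst ω x hx]; exact differentiableAt_const _
  · intro x
    by_cases hx : x ∈ Λ
    · rw [eR x hx]; exact hmeas _
    · rw [zR x hx]; exact measurable_const
  · intro x
    by_cases hx : x ∈ Λ
    · rw [eP x hx]; exact hmeas _
    · rw [zP x hx]; exact measurable_const
  · intro x
    by_cases hx : x ∈ Λ
    · rw [eR x hx]; exact ⟨_, hb _⟩
    · rw [zR x hx]; exact ⟨0, by simp⟩
  · intro x
    by_cases hx : x ∈ Λ
    · rw [eP x hx]; exact ⟨_, hb _⟩
    · rw [zP x hx]; exact ⟨0, by simp⟩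

namespace IsBddC1Local

variable {f g : Config → ℝ}

/-- Differentiability is recorded at the coordinate of the configuration itself; applying it to the
updated configuration gives it along the whole line. -/
theorem hasDerivAt_pos (hf : IsBddC1Local f) (x : ℤ) (ω : Config) (r : ℝ) :
    HasDerivAt (fun s : ℝ => f (Function.update ω x (s, (ω x).2)))
      (partialR x f (Function.update ω x (r, (ω x).2))) r := by
  have h := (hf.differentiableAt_pos x (Function.update ω x (r, (ω x).2))).hasDerivAt
  simpa only [partialR, Function.update_self, Function.update_idem] using h

theorem hasDerivAt_mom (hf : IsBddC1Local f) (x : ℤ) (ω : Config) (p : ℝ) :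
    HasDerivAt (fun s : ℝ => f (Function.update ω x ((ω x).1, s)))
      (partialP x f (Function.update ω x ((ω x).1, p))) p := by
  have h := (hf.differentiableAt_mom x (Function.update ω x ((ω x).1, p))).hasDerivAt
  simpa only [partialP, Function.update_self, Function.update_idem] using h

theorem partialR_mul (hf : IsBddC1Local f) (hg : IsBddC1Local g) (x : ℤ) (ω : Config) :
    partialR x (fun ω => f ω * g ω) ω = partialR x f ω * g ω + f ω * partialR x g ω := by
  have := ((hf.differentiableAt_pos x ω).hasDerivAt.mul
    (hg.differentiableAt_pos x ω).hasDerivAt).deriv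
  simp only [Prod.mk.eta, Function.update_eq_self] at this
  exact this

theorem partialP_mul (hf : IsBddC1Local f) (hg : IsBddC1Local g) (x : ℤ) (ω : Config) :
    partialP x (fun ω => f ω * g ω) ω = partialP x f ω * g ω + f ω * partialP x g ω := by
  have := ((hf.differentiableAt_mom x ω).hasDerivAt.mul
    (hg.differentiableAt_mom x ω).hasDerivAt).deriv
  simp only [Prod.mk.eta, Function.update_eq_self] at this
  exact this

theorem exists_dependsOn_both (hf : IsBddC1Local f) (hg : IsBddC1Local g) :
    ∃ Λ : Finset ℤ, DependsOn f (Λ : Set ℤ) ∧ DependsOn g (Λ : Set ℤ) := by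
  classical
  obtain ⟨Λ, hΛ⟩ := hf.dependsOn
  obtain ⟨Λ', hΛ'⟩ := hg.dependsOn
  exact ⟨Λ ∪ Λ', hΛ.mono (by simp), hΛ'.mono (by simp)⟩

theorem bdd_mul_aux {a b : Config → ℝ} (ha : ∃ C : ℝ, ∀ ω, |a ω| ≤ C)
    (hb : ∃ C : ℝ, ∀ ω, |b ω| ≤ C) : ∃ C : ℝ, ∀ ω, |a ω * b ω| ≤ C := by
  obtain ⟨C, hC⟩ := ha
  obtain ⟨D, hD⟩ := hb
  refine ⟨C * D, fun ω => ?_⟩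
  rw [abs_mul]
  exact mul_le_mul (hC ω) (hD ω) (abs_nonneg _) ((abs_nonneg _).trans (hC ω))

theorem bdd_add_aux {a b : Config → ℝ} (ha : ∃ C : ℝ, ∀ ω, |a ω| ≤ C)
    (hb : ∃ C : ℝ, ∀ ω, |b ω| ≤ C) : ∃ C : ℝ, ∀ ω, |a ω + b ω| ≤ C := by
  obtain ⟨C, hC⟩ := ha
  obtain ⟨D, hD⟩ := hb
  exact ⟨C + D, fun ω => (abs_add_le _ _).trans (add_le_add (hC ω) (hD ω))⟩

theorem mul (hf : IsBddC1Local f) (hg : IsBddC1Local g) : IsBddC1Local fun ω => f ω * g ω := by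
  obtain ⟨Λ, h1, h2⟩ := hf.exists_dependsOn_both hg
  have eR : ∀ x, partialR x (fun ω => f ω * g ω)
      = fun ω => partialR x f ω * g ω + f ω * partialR x g ω :=
    fun x => funext fun ω => hf.partialR_mul hg x ω
  have eP : ∀ x, partialP x (fun ω => f ω * g ω)
      = fun ω => partialP x f ω * g ω + f ω * partialP x g ω :=
    fun x => funext fun ω => hf.partialP_mul hg x ω
  refine ⟨hf.measurable.mul hg.measurable, ⟨Λ, fun a b hab => ?_⟩, bdd_mul_aux hf.bdd hg.bdd,
    fun x ω => (hf.differentiableAt_pos x ω).mul (hg.differentiableAt_pos x ω),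
    fun x ω => (hf.differentiableAt_mom x ω).mul (hg.differentiableAt_mom x ω),
    fun x => ?_, fun x => ?_, fun x => ?_, fun x => ?_⟩
  · simp only [h1 hab, h2 hab]
  · rw [eR]
    exact ((hf.measurable_partialR x).mul hg.measurable).add
      (hf.measurable.mul (hg.measurable_partialR x))
  · rw [eP]
    exact ((hf.measurable_partialP x).mul hg.measurable).add
      (hf.measurable.mul (hg.measurable_partialP x))
  · rw [eR]
    exact bdd_add_aux (bdd_mul_aux (hf.bdd_partialR x) hg.bdd)
      (bdd_mul_aux hf.bdd (hg.bdd_partialR x))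
  · rw [eP]
    exact bdd_add_aux (bdd_mul_aux (hf.bdd_partialP x) hg.bdd)
      (bdd_mul_aux hf.bdd (hg.bdd_partialP x))

end IsBddC1Local

theorem shift_update (y x : ℤ) (ω : Config) (z : ℝ × ℝ) :
    shift y (Function.update ω (y + x) z) = Function.update (shift y ω) x z := by
  funext i
  by_cases hi : i = x
  · subst hi; simp [shift]
  · simp [shift, hi]

theorem partialR_shift (f : Config → ℝ) (y x : ℤ) (ω : Config) :
    partialR (y + x) (fun ω => f (shift y ω)) ω = partialR x f (shift y ω) := by
  simp only [partialR, shift_update]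
  rfl

theorem partialP_shift (f : Config → ℝ) (y x : ℤ) (ω : Config) :
    partialP (y + x) (fun ω => f (shift y ω)) ω = partialP x f (shift y ω) := by
  simp only [partialP, shift_update]
  rfl

theorem IsBddC1Local.shift {f : Config → ℝ} (hf : IsBddC1Local f) (y : ℤ) :
    IsBddC1Local fun ω => f (shift y ω) := by
  have eR : ∀ x, partialR x (fun ω => f (FlipChain.shift y ω))
      = fun ω => partialR (x - y) f (FlipChain.shift y ω) := fun x => funext fun ω => by
    rw [← partialR_shift f y (x - y) ω, add_sub_cancel]
  have eP : ∀ x, partialP x (fun ω => f (FlipChain.shift y ω))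
      = fun ω => partialP (x - y) f (FlipChain.shift y ω) := fun x => funext fun ω => by
    rw [← partialP_shift f y (x - y) ω, add_sub_cancel]
  have hm := measurable_shift y
  have hupd : ∀ x ω z, FlipChain.shift y (Function.update ω x z)
      = Function.update (FlipChain.shift y ω) (x - y) z := fun x ω z => by
    rw [← shift_update, add_sub_cancel]
  have hval : ∀ x (ω : Config), ω x = FlipChain.shift y ω (x - y) := fun x ω => by
    simp [FlipChain.shift]
  refine ⟨hf.measurable.comp hm, ?_, ?_, ?_, ?_, ?_, ?_, ?_, ?_⟩
  · obtain ⟨Λ, hΛ⟩ := hf.dependsOn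
    exact ⟨Λ.image fun z => y + z, fun a b hab => hΛ fun i hi => hab (y + i) (by simpa using hi)⟩
  · obtain ⟨C, hC⟩ := hf.bdd
    exact ⟨C, fun ω => hC _⟩
  · intro x ω
    simp only [hupd]
    rw [hval x ω]
    exact hf.differentiableAt_pos (x - y) (FlipChain.shift y ω)
  · intro x ω
    simp only [hupd]
    rw [hval x ω]
    exact hf.differentiableAt_mom (x - y) (FlipChain.shift y ω)
  · intro x; rw [eR]; exact (hf.measurable_partialR _).comp hm
  · intro x; rw [eP]; exact (hf.measurable_partialP _).comp hm
  · intro x; rw [eR]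
    obtain ⟨C, hC⟩ := hf.bdd_partialR (x - y)
    exact ⟨C, fun ω => hC _⟩
  · intro x; rw [eP]
    obtain ⟨C, hC⟩ := hf.bdd_partialP (x - y)
    exact ⟨C, fun ω => hC _⟩

theorem flipOn_univ_update (x : ℤ) (ω : Config) (z : ℝ × ℝ) :
    flipOn Set.univ (Function.update ω x z) = Function.update (flipOn Set.univ ω) x (z.1, -z.2) := by
  funext i
  by_cases hi : i = x
  · subst hi; simp [flipOn]
  · simp [flipOn, hi]

theorem partialR_flipOn (f : Config → ℝ) (x : ℤ) (ω : Config) :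
    partialR x (fun ω => f (flipOn Set.univ ω)) ω = partialR x f (flipOn Set.univ ω) := by
  simp only [partialR, flipOn_univ_update]
  simp [flipOn]

theorem partialP_flipOn (f : Config → ℝ) (x : ℤ) (ω : Config) :
    partialP x (fun ω => f (flipOn Set.univ ω)) ω = -partialP x f (flipOn Set.univ ω) := by
  simp only [partialP, flipOn_univ_update]
  have := deriv_comp_neg (fun s : ℝ => f (Function.update (flipOn Set.univ ω) x ((ω x).1, s)))
    (ω x).2
  rw [this]
  simp [flipOn]

theorem IsBddC1Local.flipOn {f : Config → ℝ} (hf : IsBddC1Local f) :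
    IsBddC1Local fun ω => f (flipOn Set.univ ω) := by
  have hm := measurable_flipOn Set.univ
  have eR : ∀ x, partialR x (fun ω => f (FlipChain.flipOn Set.univ ω))
      = fun ω => partialR x f (FlipChain.flipOn Set.univ ω) :=
    fun x => funext fun ω => partialR_flipOn f x ω
  have eP : ∀ x, partialP x (fun ω => f (FlipChain.flipOn Set.univ ω))
      = fun ω => -partialP x f (FlipChain.flipOn Set.univ ω) :=
    fun x => funext fun ω => partialP_flipOn f x ω
  have hval : ∀ x (ω : Config), FlipChain.flipOn Set.univ ω x = ((ω x).1, -(ω x).2) :=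
    fun x ω => by simp [FlipChain.flipOn]
  refine ⟨hf.measurable.comp hm, ?_, ?_, ?_, ?_, ?_, ?_, ?_, ?_⟩
  · obtain ⟨Λ, hΛ⟩ := hf.dependsOn
    exact ⟨Λ, dependsOn_flipOn hΛ _⟩
  · obtain ⟨C, hC⟩ := hf.bdd
    exact ⟨C, fun ω => hC _⟩
  · intro x ω
    simp only [flipOn_univ_update]
    have := hf.differentiableAt_pos x (FlipChain.flipOn Set.univ ω)
    simpa only [hval] using this
  · intro x ω
    simp only [flipOn_univ_update]
    have := hf.differentiableAt_mom x (FlipChain.flipOn Set.univ ω)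
    simp only [hval] at this
    exact this.comp (ω x).2 differentiableAt_id.neg
  · intro x; rw [eR]; exact (hf.measurable_partialR _).comp hm
  · intro x; rw [eP]; exact ((hf.measurable_partialP _).comp hm).neg
  · intro x; rw [eR]
    obtain ⟨C, hC⟩ := hf.bdd_partialR x
    exact ⟨C, fun ω => hC _⟩
  · intro x; rw [eP]
    obtain ⟨C, hC⟩ := hf.bdd_partialP x
    exact ⟨C, fun ω => by rw [abs_neg]; exact hC _⟩

/-! ### The Liouville operator -/

theorem liouville_eq_sum (V : ℝ → ℝ) {f : Config → ℝ} {Λ : Finset ℤ}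
    (hΛ : DependsOn f (Λ : Set ℤ)) (ω : Config) :
    liouville V f ω = ∑ x ∈ Λ, (((ω x).2 - (ω (x - 1)).2) * partialR x f ω
      + (deriv V (ω (x + 1)).1 - deriv V (ω x).1) * partialP x f ω) := by
  refine finsum_eq_sum_of_support_subset _ fun x hx => ?_
  by_contra hne
  exact hx (by simp only [partialR_eq_zero hΛ hne, partialP_eq_zero hΛ hne, mul_zero, add_zero])

theorem liouville_shift (V : ℝ → ℝ) (f : Config → ℝ) (y : ℤ) :
    liouville V (fun ω => f (shift y ω)) = fun ω => liouville V f (shift y ω) := by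
  funext ω
  unfold liouville
  rw [← finsum_comp_equiv (Equiv.addLeft y)]
  refine finsum_congr fun x => ?_
  simp only [Equiv.coe_addLeft, partialR_shift, partialP_shift, shift, add_sub_assoc, add_assoc]

/-- Hamiltonian flow is odd under time reversal: the momentum prefactors change sign, and so do the
derivatives in $p$. -/
theorem liouville_flipOn {V : ℝ → ℝ} (f : Config → ℝ) :
    liouville V (fun ω => f (flipOn Set.univ ω)) = fun ω => -liouville V f (flipOn Set.univ ω) := by
  funext ω
  unfold liouville
  rw [← finsum_neg_distrib]
  refine finsum_congr fun x => ?_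
  simp only [partialR_flipOn, partialP_flipOn, flipOn, Set.mem_univ, if_true]
  ring

theorem liouville_mul (V : ℝ → ℝ) {f g : Config → ℝ} (hf : IsBddC1Local f) (hg : IsBddC1Local g)
    (ω : Config) : liouville V (fun ω => f ω * g ω) ω
      = liouville V f ω * g ω + f ω * liouville V g ω := by
  obtain ⟨Λ, h1, h2⟩ := hf.exists_dependsOn_both hg
  have h3 : DependsOn (fun ω => f ω * g ω) (Λ : Set ℤ) := fun a b hab => by
    simp only [h1 hab, h2 hab]
  rw [liouville_eq_sum V h1, liouville_eq_sum V h2, liouville_eq_sum V h3, Finset.sum_mul,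
    Finset.mul_sum, ← Finset.sum_add_distrib]
  refine Finset.sum_congr rfl fun x _ => ?_
  rw [hf.partialR_mul hg, hf.partialP_mul hg]
  ring

namespace GibbsRegular

variable {V : ℝ → ℝ} {T : ℝ} {f g : Config → ℝ}

theorem memLp_mom_site (h : GibbsRegular V T) (x : ℤ) :
    MemLp (fun ω : Config => (ω x).2) 2 (gibbs V T) :=
  (memLp_mom T).comp_measurePreserving (h.measurePreserving_eval_mom x)

theorem memLp_force_site (h : GibbsRegular V T) (x : ℤ) :
    MemLp (fun ω : Config => deriv V (ω x).1) 2 (gibbs V T) :=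
  h.memLp_force.comp_measurePreserving (h.measurePreserving_eval_pos x)

theorem memLp_mul_bdd {K : Config → ℝ} (hK : MemLp K 2 (gibbs V T)) (hf : Measurable f)
    (hb : ∃ C : ℝ, ∀ ω, |f ω| ≤ C) : MemLp (fun ω => K ω * f ω) 2 (gibbs V T) := by
  obtain ⟨C, hC⟩ := hb
  exact MemLp.mul' (memLp_top_of_bound hf.aestronglyMeasurable C (Eventually.of_forall hC)) hK

theorem memLp_bdd (hf : Measurable f) (hb : ∃ C : ℝ, ∀ ω, |f ω| ≤ C) :
    MemLp f 2 (gibbs V T) := by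
  obtain ⟨C, hC⟩ := hb
  exact MemLp.of_bound hf.aestronglyMeasurable C (Eventually.of_forall hC)

theorem isBddC1Local_mem (hf : IsBddC1Local f) : f ∈ localL2 (gibbs V T) :=
  ⟨hf.measurable, hf.dependsOn, memLp_bdd hf.measurable hf.bdd⟩

/-- Each term is a square-integrable momentum or force times a bounded derivative. The dependence
set grows only by nearest neighbours. -/
theorem liouville_mem (h : GibbsRegular V T) (hf : IsBddC1Local f) :
    liouville V f ∈ localL2 (gibbs V T) := by
  classical
  obtain ⟨Λ, hΛ⟩ := hf.dependsOn
  have e : liouville V f = ∑ x ∈ Λ, fun ω : Config => (((ω x).2 - (ω (x - 1)).2) * partialR x f ω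
      + (deriv V (ω (x + 1)).1 - deriv V (ω x).1) * partialP x f ω) := by
    funext ω
    rw [liouville_eq_sum V hΛ, Finset.sum_apply]
  rw [e]
  refine Submodule.sum_mem _ fun x hx => ⟨?_, ⟨Λ ∪ {x - 1, x, x + 1}, ?_⟩, ?_⟩
  · have h1 := hf.measurable_partialR x
    have h2 := hf.measurable_partialP x
    have h3 := h.continuous_deriv.measurable
    have h4 : ∀ y : ℤ, Measurable fun ω : Config => ω y := fun y => measurable_pi_apply y
    exact (((h4 _).snd.sub (h4 _).snd).mul h1).add
      (((h3.comp (h4 _).fst).sub (h3.comp (h4 _).fst)).mul h2)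
  · intro a b hab
    have hab' : ∀ i ∈ (Λ : Set ℤ), a i = b i := fun i hi => hab i (by simp_all)
    have h1 := dependsOn_partialR hΛ x hab'
    have h2 := dependsOn_partialP hΛ x hab'
    simp only [h1, h2, hab x (by simp), hab (x - 1) (by simp), hab (x + 1) (by simp)]
  · exact (memLp_mul_bdd ((h.memLp_mom_site x).sub (h.memLp_mom_site (x - 1)))
      (hf.measurable_partialR x) (hf.bdd_partialR x)).add
      (memLp_mul_bdd ((h.memLp_force_site (x + 1)).sub (h.memLp_force_site x))
      (hf.measurable_partialP x) (hf.bdd_partialP x))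

/-- Integration by parts in `r_x` under the Gibbs measure. -/
theorem integral_mul_partialR (h : GibbsRegular V T) (hf : IsBddC1Local f) (x : ℤ) {K : Config → ℝ}
    (hK : MemLp K 2 (gibbs V T)) (hinv : ∀ ω s, K (Function.update ω x (s, (ω x).2)) = K ω) :
    ∫ ω, K ω * partialR x f ω ∂(gibbs V T)
      = ∫ ω, K ω * (deriv V (ω x).1 / T) * f ω ∂(gibbs V T) := by
  have := h.isProbabilityMeasure_pos
  have hmp := h.measurePreserving_resample_pos x
  have i1 : Integrable (fun ω => K ω * partialR x f ω) (gibbs V T) :=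
    (memLp_mul_bdd hK (hf.measurable_partialR x) (hf.bdd_partialR x)).integrable (by norm_num)
  have i2 : Integrable (fun ω => K ω * (deriv V (ω x).1 / T) * f ω) (gibbs V T) := by
    have h1 : Integrable (fun ω => (K ω * f ω) * (deriv V (ω x).1)) (gibbs V T) :=
      (memLp_mul_bdd hK hf.measurable hf.bdd).integrable_mul (h.memLp_force_site x)
    refine (h1.const_mul T⁻¹).congr (Eventually.of_forall fun ω => ?_)
    simp only
    ring
  -- Resampling $r_x$ and Fubini reduce the identity to one dimension, where `K` is a constant.
  have e : ∀ F : Config → ℝ, Integrable F (gibbs V T) → ∫ ω, F ω ∂(gibbs V T)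
      = ∫ ω, ∫ r, F (Function.update ω x (r, (ω x).2)) ∂(posMeasure V T) ∂(gibbs V T) := by
    intro F hF
    conv_lhs => rw [← hmp.map_eq]
    rw [integral_map hmp.measurable.aemeasurable (by rw [hmp.map_eq]; exact hF.1)]
    exact integral_prod _ (hmp.integrable_comp_of_integrable hF)
  rw [e _ i1, e _ i2]
  refine integral_congr_ae (Eventually.of_forall fun ω => ?_)
  simp only [hinv, Function.update_self, mul_assoc]
  rw [integral_const_mul, integral_const_mul]
  congr 1
  obtain ⟨C, hC⟩ := hf.bdd
  obtain ⟨C', hC'⟩ := hf.bdd_partialR x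
  refine h.integral_deriv_pos (fun r => hf.hasDerivAt_pos x ω r) (fun r => hC _) (fun r => hC' _) ?_
  exact ((hf.measurable_partialR x).comp hmp.measurable).comp measurable_prodMk_left

/-- Integration by parts in `p_x` under the Gibbs measure. -/
theorem integral_mul_partialP (h : GibbsRegular V T) (hf : IsBddC1Local f) (x : ℤ) {K : Config → ℝ}
    (hK : MemLp K 2 (gibbs V T)) (hinv : ∀ ω s, K (Function.update ω x ((ω x).1, s)) = K ω) :
    ∫ ω, K ω * partialP x f ω ∂(gibbs V T)
      = ∫ ω, K ω * ((ω x).2 / T) * f ω ∂(gibbs V T) := by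
  have hmp := h.measurePreserving_resample_mom x
  have i1 : Integrable (fun ω => K ω * partialP x f ω) (gibbs V T) :=
    (memLp_mul_bdd hK (hf.measurable_partialP x) (hf.bdd_partialP x)).integrable (by norm_num)
  have i2 : Integrable (fun ω => K ω * ((ω x).2 / T) * f ω) (gibbs V T) := by
    have h1 : Integrable (fun ω => (K ω * f ω) * (ω x).2) (gibbs V T) :=
      (memLp_mul_bdd hK hf.measurable hf.bdd).integrable_mul (h.memLp_mom_site x)
    refine (h1.const_mul T⁻¹).congr (Eventually.of_forall fun ω => ?_)
    simp only
    ring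
  have e : ∀ F : Config → ℝ, Integrable F (gibbs V T) → ∫ ω, F ω ∂(gibbs V T)
      = ∫ ω, ∫ p, F (Function.update ω x ((ω x).1, p)) ∂(momMeasure T) ∂(gibbs V T) := by
    intro F hF
    conv_lhs => rw [← hmp.map_eq]
    rw [integral_map hmp.measurable.aemeasurable (by rw [hmp.map_eq]; exact hF.1)]
    exact integral_prod _ (hmp.integrable_comp_of_integrable hF)
  rw [e _ i1, e _ i2]
  refine integral_congr_ae (Eventually.of_forall fun ω => ?_)
  simp only [hinv, Function.update_self, mul_assoc]
  rw [integral_const_mul, integral_const_mul]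
  congr 1
  obtain ⟨C, hC⟩ := hf.bdd
  obtain ⟨C', hC'⟩ := hf.bdd_partialP x
  refine integral_deriv_mom h.pos (fun r => hf.hasDerivAt_mom x ω r) (fun r => hC _)
    (fun r => hC' _) ?_
  exact ((hf.measurable_partialP x).comp hmp.measurable).comp measurable_prodMk_left

theorem integral_eq_zero_of_flipOn_neg (h : GibbsRegular V T) {F : Config → ℝ} (hF : Measurable F)
    (S : Set ℤ) (hodd : ∀ ω, F (flipOn S ω) = -F ω) : ∫ ω, F ω ∂(gibbs V T) = 0 := by
  have hp := h.measurePreserving_flipOn S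
  have h1 : ∫ ω, F ω ∂(gibbs V T) = ∫ ω, F (flipOn S ω) ∂(gibbs V T) := by
    conv_lhs => rw [← hp.map_eq]
    rw [integral_map hp.measurable.aemeasurable hF.aestronglyMeasurable]
  simp only [hodd, integral_neg] at h1
  linarith

/-- The Gibbs measure is stationary for the Hamiltonian dynamics. -/
theorem integral_liouville (h : GibbsRegular V T) (hf : IsBddC1Local f) :
    ∫ ω, liouville V f ω ∂(gibbs V T) = 0 := by
  classical
  obtain ⟨Λ, hΛ⟩ := hf.dependsOn
  -- Integration by parts turns the term at $x$ into $T^{-1}(b(x+1)-b(x))$, the products of momentum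
  -- and force at the same site cancelling. Where $f$ ignores site $x-1$ the integrand is odd in
  -- $p_{x-1}$ and $b(x)=0$, so the sum telescopes to zero.
  set b : ℤ → ℝ := fun x => ∫ ω, (ω (x - 1)).2 * deriv V (ω x).1 * f ω ∂(gibbs V T) with hb
  have hVm := h.continuous_deriv.measurable
  have h4 : ∀ y : ℤ, Measurable fun ω : Config => ω y := fun y => measurable_pi_apply y
  have hb0 : ∀ x, x - 1 ∉ Λ → b x = 0 := by
    intro x hx
    refine h.integral_eq_zero_of_flipOn_neg
      ((((h4 _).snd.mul (hVm.comp (h4 _).fst))).mul hf.measurable) {x - 1} fun ω => ?_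
    have e1 : f (flipOn {x - 1} ω) = f ω := by
      rw [← flip_eq_flipOn]; exact flip_apply_of_dependsOn hΛ hx ω
    have e2 : flipOn {x - 1} ω (x - 1) = ((ω (x - 1)).1, -(ω (x - 1)).2) := by simp [flipOn]
    have e3 : flipOn {x - 1} ω x = ω x := by
      have : x ≠ x - 1 := by omega
      simp [flipOn, this]
    rw [e1, e2, e3]
    ring
  have hint : ∀ x y : ℤ, Integrable (fun ω : Config => (ω x).2 * deriv V (ω y).1 * f ω)
      (gibbs V T) := fun x y => by
    have := (memLp_mul_bdd (h.memLp_mom_site x) hf.measurable hf.bdd).integrable_mul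
      (h.memLp_force_site y)
    refine this.congr (Eventually.of_forall fun ω => ?_)
    simp only [Pi.mul_apply]
    ring
  have hterm : ∀ x : ℤ, ∫ ω, (((ω x).2 - (ω (x - 1)).2) * partialR x f ω
      + (deriv V (ω (x + 1)).1 - deriv V (ω x).1) * partialP x f ω) ∂(gibbs V T)
        = T⁻¹ * (b (x + 1) - b x) := by
    intro x
    have m1 : MemLp (fun ω : Config => (ω x).2 - (ω (x - 1)).2) 2 (gibbs V T) :=
      (h.memLp_mom_site x).sub (h.memLp_mom_site (x - 1))
    have m2 : MemLp (fun ω : Config => deriv V (ω (x + 1)).1 - deriv V (ω x).1) 2 (gibbs V T) :=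
      (h.memLp_force_site (x + 1)).sub (h.memLp_force_site x)
    have hne1 : x - 1 ≠ x := by omega
    have hne2 : x + 1 ≠ x := by omega
    rw [integral_add ((memLp_mul_bdd m1 (hf.measurable_partialR x) (hf.bdd_partialR x)).integrable
        (by norm_num)) ((memLp_mul_bdd m2 (hf.measurable_partialP x) (hf.bdd_partialP x)).integrable
        (by norm_num)),
      h.integral_mul_partialR hf x m1 (fun ω s => by simp [hne1]),
      h.integral_mul_partialP hf x m2 (fun ω s => by simp [hne2])]
    have e1 : ∀ ω : Config, ((ω x).2 - (ω (x - 1)).2)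
        * (deriv V (ω x).1 / T) * f ω = T⁻¹ * ((ω x).2 * deriv V (ω x).1 * f ω
          - (ω (x - 1)).2 * deriv V (ω x).1 * f ω) := fun ω => by ring
    have e2 : ∀ ω : Config, (deriv V (ω (x + 1)).1 - deriv V (ω x).1)
        * ((ω x).2 / T) * f ω = T⁻¹ * ((ω x).2 * deriv V (ω (x + 1)).1 * f ω
          - (ω x).2 * deriv V (ω x).1 * f ω) := fun ω => by ring
    simp only [e1, e2, integral_const_mul]
    rw [integral_sub (hint _ _) (hint _ _), integral_sub (hint _ _) (hint _ _)]
    simp only [hb, add_sub_cancel_right]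
    ring
  set s : Finset ℤ := Λ ∪ Λ.image (fun x => x + 1) with hs
  have hsum : ∫ ω, liouville V f ω ∂(gibbs V T) = ∑ x ∈ s, T⁻¹ * (b (x + 1) - b x) := by
    have hΛs : DependsOn f (s : Set ℤ) := hΛ.mono (by simp [hs])
    simp only [liouville_eq_sum V hΛs]
    rw [integral_finsetSum]
    · exact Finset.sum_congr rfl fun x _ => hterm x
    · intro x _
      exact ((memLp_mul_bdd ((h.memLp_mom_site x).sub (h.memLp_mom_site (x - 1)))
        (hf.measurable_partialR x) (hf.bdd_partialR x)).add
        (memLp_mul_bdd ((h.memLp_force_site (x + 1)).sub (h.memLp_force_site x))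
        (hf.measurable_partialP x) (hf.bdd_partialP x))).integrable (by norm_num)
  rw [hsum, ← Finset.mul_sum, Finset.sum_sub_distrib]
  have s1 : ∑ᶠ x, b (x + 1) = ∑ x ∈ s, b (x + 1) := by
    refine finsum_eq_sum_of_support_subset _ fun x hx => ?_
    by_contra hne
    refine hx (hb0 _ ?_)
    rw [add_sub_cancel_right]
    exact fun hx' => hne (by simp [hs, hx'])
  have s2 : ∑ᶠ x, b x = ∑ x ∈ s, b x := by
    refine finsum_eq_sum_of_support_subset _ fun x hx => ?_
    by_contra hne
    refine hx (hb0 _ fun hx' => hne ?_)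
    simp only [hs, Finset.coe_union, Finset.coe_image, Set.mem_union, Set.mem_image,
      Finset.mem_coe]
    exact Or.inr ⟨x - 1, hx', by ring⟩
  have s3 : ∑ᶠ x, b (x + 1) = ∑ᶠ x, b x := finsum_comp_equiv (Equiv.addRight 1)
  rw [← s1, ← s2, s3, sub_self, mul_zero]

/-- Stationarity applied to the product $gf$, together with the Leibniz rule; stationarity for each
factor removes the product of means. -/
theorem cov_liouville (h : GibbsRegular V T) (hf : IsBddC1Local f) (hg : IsBddC1Local g) :
    cov[g, liouville V f; gibbs V T] = -cov[liouville V g, f; gibbs V T] := by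
  have m1 := (h.liouville_mem hf).2.2
  have m2 := (h.liouville_mem hg).2.2
  have m3 := (isBddC1Local_mem (V := V) (T := T) hf).2.2
  have m4 := (isBddC1Local_mem (V := V) (T := T) hg).2.2
  rw [covariance_eq_sub m4 m1, covariance_eq_sub m2 m3, h.integral_liouville hf,
    h.integral_liouville hg]
  have h1 := h.integral_liouville (hg.mul hf)
  simp only [liouville_mul V hg hf] at h1
  rw [integral_add (f := fun ω => liouville V g ω * f ω) (g := fun ω => g ω * liouville V f ω)
    (m2.integrable_mul m3) (m4.integrable_mul m1)] at h1
  simp only [Pi.mul_apply]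
  linarith

end GibbsRegular

/-- The Liouville operator is antisymmetric. -/
theorem semiInner_liouville {V : ℝ → ℝ} {T : ℝ} (h : GibbsRegular V T) {f g : Config → ℝ}
    (hf : IsBddC1Local f) (hg : IsBddC1Local g) :
    semiInner (gibbs V T) g (liouville V f) = -semiInner (gibbs V T) (liouville V g) f := by
  unfold semiInner
  rw [← finsum_neg_distrib]
  refine finsum_congr fun x => ?_
  rw [← liouville_shift]
  exact h.cov_liouville (hf.shift x) hg

/-! ### The closed generator and momentum reversal -/

variable {V : ℝ → ℝ} {T γ : ℝ}

theorem cls_of_mem {f : Config → ℝ} (hf : f ∈ localL2 (gibbs V T)) :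
    cls V T f = ((LocalFun.mk f hf : LocalFun V T) : HilbertH V T) := by
  unfold cls
  rw [dif_pos hf]
  rfl

namespace GibbsRegular

theorem formalGen_mem (h : GibbsRegular V T) {f : Config → ℝ} (hf : IsBddC1Local f) :
    formalGen V γ f ∈ localL2 (gibbs V T) :=
  Submodule.add_mem _ (h.liouville_mem hf)
    (Submodule.smul_mem _ γ (h.noise_mem (isBddC1Local_mem hf)))

theorem mk_formalGen (h : GibbsRegular V T) {f : Config → ℝ} (hf : IsBddC1Local f) :
    (LocalFun.mk (formalGen V γ f) (h.formalGen_mem hf) : LocalFun V T)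
      = LocalFun.mk (liouville V f) (h.liouville_mem hf)
        + γ • noiseL h (LocalFun.mk f (isBddC1Local_mem hf)) := rfl

theorem inner_formalGen (h : GibbsRegular V T) {f : Config → ℝ} (hf : IsBddC1Local f)
    (g : LocalFun V T) :
    (inner ℝ g (LocalFun.mk (formalGen V γ f) (h.formalGen_mem hf)) : ℝ)
      = semiInner (gibbs V T) g.fn (liouville V f)
        + γ * inner ℝ g (noiseL h (LocalFun.mk f (isBddC1Local_mem hf))) := by
  rw [h.mk_formalGen hf, inner_add_right, real_inner_smul_right]
  rfl

/-- The momentum reversal on `ℋ`. -/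
def reversal (h : GibbsRegular V T) : HilbertH V T → HilbertH V T :=
  UniformSpace.Completion.map (flipL h Set.univ)

theorem norm_flipL (h : GibbsRegular V T) (f : LocalFun V T) : ‖flipL h Set.univ f‖ = ‖f‖ := by
  have : ‖flipL h Set.univ f‖ ^ 2 = ‖f‖ ^ 2 := by
    rw [← real_inner_self_eq_norm_sq, ← real_inner_self_eq_norm_sq, inner_flipL_left, flipL_flipL]
  exact (sq_eq_sq₀ (norm_nonneg _) (norm_nonneg _)).1 this

theorem continuous_reversal (h : GibbsRegular V T) : Continuous h.reversal :=
  UniformSpace.Completion.continuous_map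

theorem reversal_coe (h : GibbsRegular V T) (f : LocalFun V T) :
    h.reversal (f : HilbertH V T) = ((flipL h Set.univ f : LocalFun V T) : HilbertH V T) := by
  refine UniformSpace.Completion.map_coe ?_ f
  refine AddMonoidHomClass.uniformContinuous_of_bound (flipL h Set.univ) 1 fun f => ?_
  rw [h.norm_flipL, one_mul]

theorem norm_reversal (h : GibbsRegular V T) (u : HilbertH V T) : ‖h.reversal u‖ = ‖u‖ := by
  induction u using UniformSpace.Completion.induction_on with
  | hp => exact isClosed_eq h.continuous_reversal.norm continuous_norm
  | ih f => rw [h.reversal_coe, UniformSpace.Completion.norm_coe, UniformSpace.Completion.norm_coe,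
      h.norm_flipL]

theorem inner_reversal_left (h : GibbsRegular V T) (u v : HilbertH V T) :
    inner ℝ (h.reversal u) v = (inner ℝ u (h.reversal v) : ℝ) := by
  have hc := h.continuous_reversal
  induction u, v using UniformSpace.Completion.induction_on₂ with
  | hp =>
    exact isClosed_eq (Continuous.inner (𝕜 := ℝ) (hc.comp continuous_fst) continuous_snd)
      (Continuous.inner (𝕜 := ℝ) continuous_fst (hc.comp continuous_snd))
  | ih f g =>
    rw [h.reversal_coe, h.reversal_coe, UniformSpace.Completion.inner_coe,
      UniformSpace.Completion.inner_coe, inner_flipL_left]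

/-- On the core the Liouville part contributes nothing by antisymmetry, and the noise gap gives the
right-hand side. The inequality is a closed condition on pairs, so it survives closure. -/
theorem genGraph_dissipative (h : GibbsRegular V T) (hγ : 0 ≤ γ) (z : HilbertH V T × HilbertH V T)
    (hz : z ∈ genGraph V γ T) :
    inner ℝ z.1 z.2 ≤ -(2 * γ * (‖z.1 - h.reversal z.1‖ / 2) ^ 2) := by
  have hc := h.continuous_reversal
  have hcl : IsClosed {z : HilbertH V T × HilbertH V T |
      inner ℝ z.1 z.2 ≤ -(2 * γ * (‖z.1 - h.reversal z.1‖ / 2) ^ 2)} := by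
    refine isClosed_le (continuous_fst.inner continuous_snd) ?_
    have : Continuous fun z : HilbertH V T × HilbertH V T => ‖z.1 - h.reversal z.1‖ :=
      (continuous_fst.sub (hc.comp continuous_fst)).norm
    fun_prop
  refine closure_minimal ?_ hcl hz
  rintro _ ⟨f, hf, rfl⟩
  have hf' := hf.isBddC1Local
  have hm := isBddC1Local_mem (V := V) (T := T) hf'
  set F : LocalFun V T := LocalFun.mk f hm
  rw [Set.mem_ofPred_eq, cls_of_mem hm, cls_of_mem (h.formalGen_mem hf'), h.reversal_coe,
    UniformSpace.Completion.inner_coe, ← UniformSpace.Completion.coe_sub,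
    UniformSpace.Completion.norm_coe, h.inner_formalGen hf']
  have h1 : semiInner (gibbs V T) f (liouville V f) = 0 := by
    have h2 := semiInner_liouville h hf' hf'
    rw [semiInner_comm (h.liouville_mem hf') hm] at h2
    linarith
  have h2 := inner_noiseL_le h F
  -- As reversal is a symmetric isometric involution, $\|F-RF\|^2=2\langle F,F-RF\rangle$; this is
  -- the source of the constant $2\gamma$.
  have h3 : ‖F - flipL h Set.univ F‖ ^ 2 = 2 * inner ℝ F (F - flipL h Set.univ F) := by
    rw [norm_sub_sq_real, h.norm_flipL, inner_sub_right, real_inner_self_eq_norm_sq]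
    ring
  have h4 : semiInner (gibbs V T) F.fn (liouville V f) = 0 := h1
  rw [h4, div_pow, h3]
  have h5 := mul_le_mul_of_nonneg_left h2 hγ
  show 0 + γ * inner ℝ F (noiseL h F) ≤ _
  linarith

/-- Antisymmetry and oddness under reversal each contribute a sign, and the two cancel. -/
theorem liouville_flipL (h : GibbsRegular V T) {f g : Config → ℝ} (hf : IsBddC1Local f)
    (hg : IsBddC1Local g) :
    semiInner (gibbs V T) (fun ω => g (flipOn Set.univ ω)) (liouville V f)
      = semiInner (gibbs V T) (fun ω => f (flipOn Set.univ ω)) (liouville V g) := by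
  set F : LocalFun V T := LocalFun.mk f (isBddC1Local_mem hf) with hF
  set B : LocalFun V T := LocalFun.mk (liouville V g) (h.liouville_mem hg) with hB
  have e4 := inner_flipL_left h B F
  have e5 : semiInner (gibbs V T) (fun ω => -liouville V g (flipOn Set.univ ω)) f
      = inner ℝ (-flipL h Set.univ B) F := rfl
  have e6 : semiInner (gibbs V T) (fun ω => f (flipOn Set.univ ω)) (liouville V g)
      = inner ℝ (flipL h Set.univ F) B := rfl
  rw [semiInner_liouville h hf hg.flipOn, liouville_flipOn, e5, e6, inner_neg_left, e4,
    real_inner_comm, neg_neg]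

/-- Reversal composed with the generator is symmetric: the Liouville part by cancellation of signs,
the noise because it is symmetric and commutes with reversal. -/
theorem formalGen_flipL (h : GibbsRegular V T) {f g : Config → ℝ} (hf : IsBddC1Local f)
    (hg : IsBddC1Local g) :
    (inner ℝ (flipL h Set.univ (LocalFun.mk g (isBddC1Local_mem hg)))
        (LocalFun.mk (formalGen V γ f) (h.formalGen_mem hf)) : ℝ)
      = inner ℝ (flipL h Set.univ (LocalFun.mk f (isBddC1Local_mem hf)))
        (LocalFun.mk (formalGen V γ g) (h.formalGen_mem hg)) := by
  rw [h.inner_formalGen hf, h.inner_formalGen hg]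
  have h1 := h.liouville_flipL hf hg
  have e1 : noiseL h (flipL h Set.univ (LocalFun.mk g (isBddC1Local_mem hg)))
      = flipL h Set.univ (noiseL h (LocalFun.mk g (isBddC1Local_mem hg))) :=
    LocalFun.ext (noise_flipOn_univ g)
  congr 1
  congr 1
  rw [← inner_noiseL_left, e1, inner_flipL_left, real_inner_comm]

theorem inner_reversal_cls_formalGen (h : GibbsRegular V T) {f g : Config → ℝ} (hf : IsC01 f)
    (hg : IsC01 g) :
    (inner ℝ (h.reversal (cls V T g)) (cls V T (formalGen V γ f)) : ℝ)
      = inner ℝ (h.reversal (cls V T f)) (cls V T (formalGen V γ g)) := by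
  have hf' := hf.isBddC1Local
  have hg' := hg.isBddC1Local
  rw [cls_of_mem (isBddC1Local_mem hf'), cls_of_mem (isBddC1Local_mem hg'),
    cls_of_mem (h.formalGen_mem hf'), cls_of_mem (h.formalGen_mem hg'), h.reversal_coe,
    h.reversal_coe, UniformSpace.Completion.inner_coe, UniformSpace.Completion.inner_coe]
  exact h.formalGen_flipL hf' hg'

/-- The identity is closed in each pair separately, so the closure is taken first in `w` with `z` in
the core, then in `z`. -/
theorem genGraph_reversal_symm (h : GibbsRegular V T) (z w : HilbertH V T × HilbertH V T)
    (hz : z ∈ genGraph V γ T) (hw : w ∈ genGraph V γ T) :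
    inner ℝ (h.reversal z.1) w.2 = (inner ℝ (h.reversal w.1) z.2 : ℝ) := by
  have hc := h.continuous_reversal
  have hcl1 : ∀ z : HilbertH V T × HilbertH V T, IsClosed {w : HilbertH V T × HilbertH V T |
      inner ℝ (h.reversal z.1) w.2 = (inner ℝ (h.reversal w.1) z.2 : ℝ)} := fun z =>
    isClosed_eq (Continuous.inner (𝕜 := ℝ) continuous_const continuous_snd)
      (Continuous.inner (𝕜 := ℝ) (hc.comp continuous_fst) continuous_const)
  have hcl2 : ∀ w : HilbertH V T × HilbertH V T, IsClosed {z : HilbertH V T × HilbertH V T |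
      inner ℝ (h.reversal z.1) w.2 = (inner ℝ (h.reversal w.1) z.2 : ℝ)} := fun w =>
    isClosed_eq (Continuous.inner (𝕜 := ℝ) (hc.comp continuous_fst) continuous_const)
      (Continuous.inner (𝕜 := ℝ) continuous_const continuous_snd)
  have hstep : ∀ g : Config → ℝ, IsC01 g → ∀ w ∈ genGraph V γ T,
      (inner ℝ (h.reversal (cls V T g)) w.2 : ℝ)
        = inner ℝ (h.reversal w.1) (cls V T (formalGen V γ g)) := by
    intro g hg w hw
    refine closure_minimal ?_ (hcl1 (cls V T g, cls V T (formalGen V γ g))) hw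
    rintro _ ⟨f, hf, rfl⟩
    exact h.inner_reversal_cls_formalGen hf hg
  refine closure_minimal ?_ (hcl2 w) hz
  rintro _ ⟨g, hg, rfl⟩
  exact hstep g hg w hw

/-! ### The energy current -/

theorem measurable_current (h : GibbsRegular V T) : Measurable (current V) := by
  have h4 : ∀ y : ℤ, Measurable fun ω : Config => ω y := fun y => measurable_pi_apply y
  exact (h4 0).snd.neg.mul (h.continuous_deriv.measurable.comp (h4 1).fst)

theorem indepFun_sq (h : GibbsRegular V T) :
    IndepFun (fun ω : Config => (ω 0).2 ^ 2) (fun ω : Config => deriv V (ω 1).1 ^ 2)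
      (gibbs V T) := by
  have hi : iIndepFun (fun (i : ℤ) (ω : Config) => ω i) (gibbs V T) :=
    iIndepFun_infinitePi (P := fun _ : ℤ => siteMeasure V T) (X := fun _ z => z)
      (fun _ => measurable_id)
  exact (hi.indepFun (show (0 : ℤ) ≠ 1 by norm_num)).comp (φ := fun z : ℝ × ℝ => z.2 ^ 2)
    (ψ := fun z : ℝ × ℝ => deriv V z.1 ^ 2) (by fun_prop)
    ((h.continuous_deriv.measurable.comp measurable_fst).pow_const 2)

theorem current_mem (h : GibbsRegular V T) : current V ∈ localL2 (gibbs V T) := by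
  refine ⟨h.measurable_current, ⟨{0, 1}, fun a b hab => ?_⟩, ?_⟩
  · simp only [current, hab 0 (by simp), hab 1 (by simp)]
  · rw [memLp_two_iff_integrable_sq h.measurable_current.aestronglyMeasurable]
    have h1 := h.indepFun_sq.integrable_mul (h.memLp_mom_site 0).integrable_sq
      (h.memLp_force_site 1).integrable_sq
    refine h1.congr (Eventually.of_forall fun ω => ?_)
    simp only [Pi.mul_apply, current]
    ring

/-- The potential is even, so the force is odd under a symmetric law. -/
theorem integral_force_site (h : GibbsRegular V T) (x : ℤ) :
    ∫ ω, deriv V (ω x).1 ∂(gibbs V T) = 0 := by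
  have hp := (h.measurePreserving_eval_pos x)
  have e1 : ∫ ω, deriv V (ω x).1 ∂(gibbs V T) = ∫ r, deriv V r ∂(posMeasure V T) := by
    rw [← hp.map_eq, integral_map hp.measurable.aemeasurable
      h.continuous_deriv.aestronglyMeasurable]
  have hn := h.measurePreserving_neg_pos
  have e2 : ∫ r, deriv V r ∂(posMeasure V T) = ∫ r, deriv V (-r) ∂(posMeasure V T) := by
    conv_lhs => rw [← hn.map_eq]
    rw [integral_map hn.measurable.aemeasurable h.continuous_deriv.aestronglyMeasurable]
  simp only [h.deriv_neg, integral_neg] at e2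
  rw [e1]
  linarith

theorem integral_force_sq_site (h : GibbsRegular V T) (x : ℤ) :
    ∫ ω, deriv V (ω x).1 ^ 2 ∂(gibbs V T) = ∫ r, deriv V r ^ 2 ∂(posMeasure V T) := by
  have hp := (h.measurePreserving_eval_pos x)
  have hc := h.continuous_deriv
  rw [← hp.map_eq, integral_map hp.measurable.aemeasurable
    (by fun_prop : Continuous fun r => deriv V r ^ 2).aestronglyMeasurable]

theorem forceVar_eq (h : GibbsRegular V T) :
    forceVar V T = ∫ r, deriv V r ^ 2 ∂(posMeasure V T) := by
  unfold forceVar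
  rw [variance_of_integral_eq_zero (h.memLp_force_site 0).aemeasurable (h.integral_force_site 0)]
  exact h.integral_force_sq_site 0

/-- Only the unshifted term survives: for $x\ne0$ the product of the current with its shift is odd
in $p_0$. In the remaining term $p_0$ and $r_1$ are independent. -/
theorem semiInner_current (h : GibbsRegular V T) :
    semiInner (gibbs V T) (current V) (current V) = T * forceVar V T := by
  have h0 : shift 0 = id := by funext ω z; simp [shift]
  have hodd : ∀ ω, current V (flipOn {0} ω) = -current V ω := fun ω => by
    simp [current, flipOn]
  have hz : ∫ ω, current V ω ∂(gibbs V T) = 0 :=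
    h.integral_eq_zero_of_flipOn_neg h.measurable_current {0} hodd
  unfold semiInner
  rw [finsum_eq_single _ 0]
  · have hp := h.measurePreserving_eval_mom 0
    have e2 : ∫ ω : Config, (ω 0).2 ^ 2 ∂(gibbs V T) = T := by
      refine Eq.trans ?_ (integral_sq_mom h.pos)
      rw [← hp.map_eq, integral_map hp.measurable.aemeasurable (by fun_prop)]
    have e1 := h.indepFun_sq.integral_mul_eq_mul_integral
      (h.memLp_mom_site 0).integrable_sq.aestronglyMeasurable
      (h.memLp_force_site 1).integrable_sq.aestronglyMeasurable
    rw [covariance_eq_sub h.current_mem.2.2 (shift_mem h.current_mem 0).2.2, hz, zero_mul, sub_zero,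
      h.forceVar_eq, ← h.integral_force_sq_site 1]
    rw [e2] at e1
    rw [← e1]
    refine integral_congr_ae (Eventually.of_forall fun ω => ?_)
    simp only [Pi.mul_apply, h0, id, current]
    ring
  · intro x hx
    rw [covariance_eq_sub h.current_mem.2.2 (shift_mem h.current_mem x).2.2, hz, zero_mul, sub_zero]
    refine h.integral_eq_zero_of_flipOn_neg
      (h.measurable_current.mul (h.measurable_current.comp (measurable_shift x))) {0} fun ω => ?_
    have e : current V (shift x (flipOn {0} ω)) = current V (shift x ω) := by
      by_cases hx1 : x + 1 = 0 <;> simp [current, flipOn, shift, hx, hx1]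
    simp only [Pi.mul_apply, hodd, e]
    ring

theorem reversal_current (h : GibbsRegular V T) :
    h.reversal (cls V T (current V)) = -cls V T (current V) := by
  rw [cls_of_mem h.current_mem, h.reversal_coe, ← UniformSpace.Completion.coe_neg]
  congr 1
  refine LocalFun.ext (funext fun ω => ?_)
  show current V (flipOn Set.univ ω) = -current V ω
  simp [current, flipOn]

theorem norm_sq_current (h : GibbsRegular V T) :
    ‖cls V T (current V)‖ ^ 2 = T * forceVar V T := by
  rw [cls_of_mem h.current_mem, UniformSpace.Completion.norm_coe, ← real_inner_self_eq_norm_sq,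
    ← h.semiInner_current]
  rfl

/-- The Green-Kubo formula converges, and the conductivity is at most `Var_T(V') / (2 γ T)`. -/
theorem greenKubo_bound (h : GibbsRegular V T) (hγ : 0 < γ) (hdyn : DynamicsExists V γ T) :
    GreenKuboConverges V γ T ∧ 0 ≤ conductivity V γ T ∧
      conductivity V γ T ≤ forceVar V T / (2 * γ * T) := by
  obtain ⟨P, hP, hG⟩ := hdyn
  have hGs : (semigroupGenSubmodule P : Set (HilbertH V T × HilbertH V T)) = genGraph V γ T := hG
  have hmem : ∀ z, z ∈ semigroupGenSubmodule P ↔ z ∈ genGraph V γ T := fun z => by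
    rw [← hGs]; rfl
  have hdis := h.genGraph_dissipative hγ.le
  have hdis0 : ∀ z ∈ genGraph V γ T, inner ℝ z.1 z.2 ≤ (0 : ℝ) := fun z hz =>
    (hdis z hz).trans (by
      have : 0 ≤ 2 * γ * (‖z.1 - h.reversal z.1‖ / 2) ^ 2 := by positivity
      linarith)
  set j := cls V T (current V) with hj
  have hex : ∀ lam : ℝ, 0 < lam → ∃ u, (u, lam • u - j) ∈ genGraph V γ T := by
    intro lam hlam
    rw [← hG]
    refine exists_resolvent_of_dissipative hP ?_ (by rw [hG]; exact hdis0) hlam j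
    rw [hG]
    exact isClosed_closure
  have huniq : ∀ lam : ℝ, 0 < lam → ∃! u, (u, lam • u - j) ∈ genGraph V γ T := by
    intro lam hlam
    obtain ⟨u, hu⟩ := hex lam hlam
    refine ⟨u, hu, fun u' hu' => ?_⟩
    exact resolvent_unique (G := semigroupGenSubmodule P)
      (fun z hz => hdis0 z ((hmem z).1 hz)) hlam ((hmem _).2 hu') ((hmem _).2 hu)
  have hres : ∀ lam : ℝ, 0 < lam →
      (resolvent V γ T lam j, lam • resolvent V γ T lam j - j) ∈ genGraph V γ T := by
    intro lam hlam
    unfold resolvent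
    rw [dif_pos (hex lam hlam)]
    exact (hex lam hlam).choose_spec
  -- Here $c=2\gamma$ is the dissipation rate of odd vectors; with $\|j\|^2=T\,\mathrm{Var}_T$ and
  -- the prefactor $T^{-2}$ it yields the stated bound.
  obtain ⟨q, hq, hq0, hqle⟩ := exists_tendsto_resolvent_form (G := semigroupGenSubmodule P)
    (R := h.reversal) (c := 2 * γ) (by positivity) h.norm_reversal h.inner_reversal_left
    (fun z hz => hdis z ((hmem z).1 hz))
    (fun z hz w hw => h.genGraph_reversal_symm z w ((hmem z).1 hz) ((hmem w).1 hw))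
    h.reversal_current (fun lam hlam => (hmem _).2 (hres lam hlam))
  have hlim : Tendsto (greenKubo V γ T) (𝓝[>] 0) (𝓝 ((T ^ 2)⁻¹ * q)) := hq.const_mul _
  have hcond : conductivity V γ T = (T ^ 2)⁻¹ * q := hlim.limUnder_eq
  have hT := h.pos
  refine ⟨⟨huniq, by rw [hcond]; exact hlim⟩, by rw [hcond]; positivity, ?_⟩
  rw [h.norm_sq_current] at hqle
  rw [hcond]
  refine (mul_le_mul_of_nonneg_left hqle (by positivity)).trans (le_of_eq ?_)
  field_simp

end GibbsRegular

/-! ### Integrability and scaling asymptotics of the force variance -/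

theorem integrable_of_even {f : ℝ → ℝ} (hf : IntegrableOn f (Set.Ioi 0))
    (heven : ∀ r, f (-r) = f r) : Integrable f := by
  have h1 : IntegrableOn f (Set.Iic 0) := by
    rw [← Measure.map_neg_eq_self (volume : Measure ℝ)]
    have m : MeasurableEmbedding fun x : ℝ => -x := (Homeomorph.neg ℝ).measurableEmbedding
    rw [m.integrableOn_map_iff]
    simp_rw [Function.comp_def, heven, Set.neg_preimage, Set.neg_Iic, neg_zero]
    exact Iff.mpr integrableOn_Ici_iff_integrableOn_Ioi hf
  rw [← integrableOn_univ, ← Set.Iic_union_Ioi (a := (0 : ℝ))]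
  exact h1.union hf

theorem integral_of_even {f : ℝ → ℝ} (heven : ∀ r, f (-r) = f r) :
    ∫ r, f r = 2 * ∫ r in Set.Ioi 0, f r := by
  rw [← integral_comp_abs]
  refine integral_congr_ae (Eventually.of_forall fun r => ?_)
  rcases abs_choice r with h | h <;> simp only [h, heven]

/-- Stretched exponential decay of the Gibbs weight and polynomial growth of the force give the
regularity needed for the Gibbs measure. -/
theorem gibbsRegular_of_growth {V : ℝ → ℝ} (hV : ContDiff ℝ (⊤ : ℕ∞) V) (heven : ∀ r, V (-r) = V r)
    {c K a m : ℝ} (hc : 0 < c) (ha : 0 < a) (hm : 0 ≤ m)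
    (hlow : ∀ r, 0 < r → c * r ^ a - K ≤ V r)
    (hforce : ∀ r, 0 < r → |deriv V r| ≤ K * (1 + r ^ m)) {T : ℝ} (hT : 0 < T) :
    GibbsRegular V T := by
  have hVc : Continuous V := hV.continuous
  have hV'c : Continuous (deriv V) := hV.continuous_deriv (by simp)
  have hodd : ∀ r, deriv V (-r) = -deriv V r := fun r => by
    have h1 : V = fun r => V (-r) := funext fun r => (heven r).symm
    conv_rhs => rw [h1]
    rw [deriv_comp_neg]
    simp
  have hexp : ∀ r, 0 < r → Real.exp (-V r / T) ≤ Real.exp (K / T) * Real.exp (-(c / T) * r ^ a) := by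
    intro r hr
    rw [← Real.exp_add]
    refine Real.exp_le_exp.2 ?_
    have := div_le_div_of_nonneg_right (hlow r hr) hT.le
    have e : K / T + -(c / T) * r ^ a = -((c * r ^ a - K) / T) := by ring
    rw [e, neg_div]
    exact neg_le_neg this
  have hi : ∀ q : ℝ, 0 ≤ q →
      IntegrableOn (fun r : ℝ => r ^ q * Real.exp (-(c / T) * r ^ a)) (Set.Ioi 0) := fun q hq =>
    integrableOn_rpow_mul_exp_neg_mul_rpow (by linarith) ha (by positivity)
  have hi0 : IntegrableOn (fun r : ℝ => Real.exp (-(c / T) * r ^ a)) (Set.Ioi 0) := by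
    simpa using hi 0 le_rfl
  refine ⟨hV, heven, hT, ?_, ?_⟩
  · refine integrable_of_even ?_ fun r => by rw [heven]
    refine (hi0.const_mul (Real.exp (K / T))).mono' (by fun_prop) ?_
    filter_upwards [ae_restrict_mem measurableSet_Ioi] with r hr
    rw [Real.norm_of_nonneg (Real.exp_pos _).le]
    exact hexp r hr
  · refine integrable_of_even ?_ fun r => by rw [heven, hodd, neg_sq]
    have hb := (((hi 0 le_rfl).add ((hi m hm).const_mul 2)).add (hi (m + m) (by linarith))).const_mul
      (K ^ 2 * Real.exp (K / T))
    refine hb.mono' (by fun_prop) ?_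
    filter_upwards [ae_restrict_mem measurableSet_Ioi] with r hr
    have hr' : 0 < r := hr
    rw [Real.norm_of_nonneg (by positivity)]
    have h1 : deriv V r ^ 2 ≤ (K * (1 + r ^ m)) ^ 2 :=
      sq_le_sq' (abs_le.1 (hforce r hr')).1 (abs_le.1 (hforce r hr')).2
    refine (mul_le_mul h1 (hexp r hr') (Real.exp_pos _).le (by positivity)).trans (le_of_eq ?_)
    simp only [Pi.add_apply, Real.rpow_add hr', Real.rpow_zero]
    ring

/-- The force has mean zero and both integrands are even, so the factors $2$ cancel. On the half
line the real powers and the scaling substitution can be used. -/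
theorem forceVar_eq_div {V : ℝ → ℝ} {T : ℝ} (h : GibbsRegular V T) :
    forceVar V T = (∫ r in Set.Ioi 0, deriv V r ^ 2 * Real.exp (-V r / T))
      / ∫ r in Set.Ioi 0, Real.exp (-V r / T) := by
  rw [h.forceVar_eq, posMeasure, integral_tilted]
  have e : ∀ r, (Real.exp (-V r / T) / ∫ x, Real.exp (-V x / T)) • deriv V r ^ 2
      = (∫ x, Real.exp (-V x / T))⁻¹ * (deriv V r ^ 2 * Real.exp (-V r / T)) := fun r => by
    rw [smul_eq_mul]; ring
  simp only [e, integral_const_mul]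
  rw [integral_of_even (f := fun r => deriv V r ^ 2 * Real.exp (-V r / T))
      fun r => by rw [h.even, h.deriv_neg, neg_sq],
    integral_of_even (f := fun r => Real.exp (-V r / T)) fun r => by rw [h.even], ← div_eq_inv_mul,
    mul_div_mul_left _ _ two_ne_zero]

/-- Both integrals are Gamma values; $a>1/2$ makes $s^{2a-2}$ integrable at $0$. -/
theorem varConst_pos {A a : ℝ} (hA : 0 < A) (ha : 1 / 2 < a) : 0 < varConst A a := by
  unfold varConst
  have ha0 : 0 < a := by linarith
  rw [integral_rpow_mul_exp_neg_mul_rpow ha0 (by linarith) hA, integral_exp_neg_mul_rpow ha0 hA]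
  have h1 : 0 < Real.Gamma ((2 * a - 2 + 1) / a) := Real.Gamma_pos_of_pos (by
    apply div_pos <;> linarith)
  have h2 : 0 < Real.Gamma (1 / a + 1) := Real.Gamma_pos_of_pos (by positivity)
  positivity

section Scaling

variable {a T s : ℝ}

theorem scale_rpow (ha : 0 < a) (hT : 0 < T) (hs : 0 < s) : (T ^ (1 / a) * s) ^ a = T * s ^ a := by
  rw [Real.mul_rpow (by positivity) hs.le, ← Real.rpow_mul hT.le, one_div_mul_cancel ha.ne',
    Real.rpow_one]

theorem scale_rpow_sub_one (ha : 0 < a) (hT : 0 < T) (hs : 0 < s) :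
    (T ^ (1 / a) * s) ^ (a - 1) = T ^ (1 - 1 / a) * s ^ (a - 1) := by
  rw [Real.mul_rpow (by positivity) hs.le, ← Real.rpow_mul hT.le]
  congr 2
  field_simp

end Scaling

/-- Laplace-type asymptotics of the force variance under the scaling `r = T^(1/a) s`. -/
theorem isEquivalent_forceVar {V : ℝ → ℝ} {l l' : Filter ℝ} [l.IsCountablyGenerated] {A a : ℝ}
    (hA : 0 < A) (ha : 1 < a) (hl : ∀ᶠ T in l, GibbsRegular V T)
    (hscale : ∀ s : ℝ, 0 < s → Tendsto (fun T : ℝ => T ^ (1 / a) * s) l l')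
    (hVlim : Tendsto (fun r => V r / r ^ a) l' (𝓝 A))
    (hV'lim : Tendsto (fun r => deriv V r / r ^ (a - 1)) l' (𝓝 (A * a)))
    {c K b₁ b₂ m₁ m₂ : ℝ} (hc : 0 < c) (hb₁ : 0 < b₁) (hb₂ : 0 < b₂) (hm₁ : 0 ≤ m₁) (hm₂ : 0 ≤ m₂)
    (hlow : ∀ᶠ T in l, ∀ s, 0 < s → c * min (s ^ b₁) (s ^ b₂) - K ≤ V (T ^ (1 / a) * s) / T)
    (hforce : ∀ᶠ T in l, ∀ s, 0 < s →
      |deriv V (T ^ (1 / a) * s)| / T ^ (1 - 1 / a) ≤ K * (s ^ m₁ + s ^ m₂)) :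
    Asymptotics.IsEquivalent l (forceVar V) (fun T => varConst A a * T ^ (2 - 2 / a)) := by
  have ha0 : 0 < a := by linarith
  -- The exponential of $-c$ times a minimum equals one of the two exponentials, hence is at most
  -- their sum, which beats every power of $s$.
  set w : ℝ → ℝ := fun s => Real.exp (-c * s ^ b₁) + Real.exp (-c * s ^ b₂) with hw
  have hexp : ∀ᶠ T in l, ∀ s, 0 < s →
      Real.exp (-(V (T ^ (1 / a) * s) / T)) ≤ Real.exp K * w s := by
    filter_upwards [hlow] with T hT s hs
    have h1 : Real.exp (-(V (T ^ (1 / a) * s) / T))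
        ≤ Real.exp K * Real.exp (-c * min (s ^ b₁) (s ^ b₂)) := by
      rw [← Real.exp_add]
      refine Real.exp_le_exp.2 ?_
      linarith [hT s hs]
    refine h1.trans (mul_le_mul_of_nonneg_left ?_ (Real.exp_pos _).le)
    have p1 := Real.exp_pos (-c * s ^ b₁)
    have p2 := Real.exp_pos (-c * s ^ b₂)
    rcases min_choice (s ^ b₁) (s ^ b₂) with h | h <;> rw [h] <;> simp only [hw] <;> linarith
  have hi : ∀ q : ℝ, 0 ≤ q → IntegrableOn (fun s : ℝ => s ^ q * w s) (Set.Ioi 0) := fun q hq => by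
    have h1 := integrableOn_rpow_mul_exp_neg_mul_rpow (p := b₁) (s := q) (b := c) (by linarith) hb₁ hc
    have h2 := integrableOn_rpow_mul_exp_neg_mul_rpow (p := b₂) (s := q) (b := c) (by linarith) hb₂ hc
    refine (h1.add h2).congr (Eventually.of_forall fun s => ?_)
    simp only [Pi.add_apply, hw]; ring
  have hiw : IntegrableOn w (Set.Ioi 0) := by simpa using hi 0 le_rfl
  -- pointwise limits
  have hVs : ∀ s, 0 < s → Tendsto (fun T => V (T ^ (1 / a) * s) / T) l (𝓝 (A * s ^ a)) := by
    intro s hs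
    refine ((hVlim.comp (hscale s hs)).mul_const (s ^ a)).congr' ?_
    filter_upwards [hl] with T hT
    have hT' := hT.pos
    have : s ^ a ≠ 0 := (Real.rpow_pos_of_pos hs a).ne'
    rw [Function.comp_apply, scale_rpow ha0 hT' hs]
    field_simp
  have hexps : ∀ s, 0 < s → Tendsto (fun T => Real.exp (-(V (T ^ (1 / a) * s) / T))) l
      (𝓝 (Real.exp (-A * s ^ a))) := fun s hs => by
    have := (Real.continuous_exp.tendsto _).comp (hVs s hs).neg
    rw [neg_mul]
    exact this
  have hV's : ∀ s, 0 < s → Tendsto (fun T => deriv V (T ^ (1 / a) * s) / T ^ (1 - 1 / a)) l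
      (𝓝 (A * a * s ^ (a - 1))) := by
    intro s hs
    refine ((hV'lim.comp (hscale s hs)).mul_const (s ^ (a - 1))).congr' ?_
    filter_upwards [hl] with T hT
    have hT' := hT.pos
    have h1 : s ^ (a - 1) ≠ 0 := (Real.rpow_pos_of_pos hs _).ne'
    have h2 : T ^ (1 - 1 / a) ≠ 0 := (Real.rpow_pos_of_pos hT' _).ne'
    rw [Function.comp_apply, scale_rpow_sub_one ha0 hT' hs]
    field_simp
  -- dominated convergence
  have hZ : Tendsto (fun T => ∫ s in Set.Ioi 0, Real.exp (-(V (T ^ (1 / a) * s) / T))) l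
      (𝓝 (∫ s in Set.Ioi (0 : ℝ), Real.exp (-A * s ^ a))) := by
    refine tendsto_integral_filter_of_dominated_convergence (fun s => Real.exp K * w s) ?_ ?_
      (hiw.const_mul _) ?_
    · filter_upwards [hl] with T hT
      have := hT.continuous
      exact (by fun_prop : Continuous fun s => Real.exp (-(V (T ^ (1 / a) * s) / T))).aestronglyMeasurable
    · filter_upwards [hexp] with T hT
      filter_upwards [ae_restrict_mem measurableSet_Ioi] with s hs
      rw [Real.norm_of_nonneg (Real.exp_pos _).le]
      exact hT s hs
    · filter_upwards [ae_restrict_mem measurableSet_Ioi] with s hs using hexps s hs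
  have hN : Tendsto (fun T => ∫ s in Set.Ioi 0, (deriv V (T ^ (1 / a) * s) / T ^ (1 - 1 / a)) ^ 2
        * Real.exp (-(V (T ^ (1 / a) * s) / T))) l
      (𝓝 (∫ s in Set.Ioi (0 : ℝ), (A * a * s ^ (a - 1)) ^ 2 * Real.exp (-A * s ^ a))) := by
    refine tendsto_integral_filter_of_dominated_convergence
      (fun s => K ^ 2 * Real.exp K * (s ^ (m₁ + m₁) * w s + 2 * (s ^ (m₁ + m₂) * w s)
        + s ^ (m₂ + m₂) * w s)) ?_ ?_ ?_ ?_
    · filter_upwards [hl] with T hT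
      have := hT.continuous
      have := hT.continuous_deriv
      exact (by fun_prop : Continuous fun s => (deriv V (T ^ (1 / a) * s) / T ^ (1 - 1 / a)) ^ 2
        * Real.exp (-(V (T ^ (1 / a) * s) / T))).aestronglyMeasurable
    · filter_upwards [hexp, hforce, hl] with T hT1 hT2 hT3
      filter_upwards [ae_restrict_mem measurableSet_Ioi] with s hs
      have hs' : 0 < s := hs
      rw [Real.norm_of_nonneg (by positivity)]
      have hTp : 0 < T ^ (1 - 1 / a) := Real.rpow_pos_of_pos hT3.pos _
      have h1 : |deriv V (T ^ (1 / a) * s) / T ^ (1 - 1 / a)| ≤ K * (s ^ m₁ + s ^ m₂) := by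
        rw [abs_div, abs_of_pos hTp]
        exact hT2 s hs'
      have h2 : (deriv V (T ^ (1 / a) * s) / T ^ (1 - 1 / a)) ^ 2 ≤ (K * (s ^ m₁ + s ^ m₂)) ^ 2 :=
        sq_le_sq' (abs_le.1 h1).1 (abs_le.1 h1).2
      refine (mul_le_mul h2 (hT1 s hs') (Real.exp_pos _).le (by positivity)).trans (le_of_eq ?_)
      simp only [Real.rpow_add hs']
      ring
    · exact (((hi _ (by linarith)).add ((hi _ (by linarith)).const_mul 2)).add
        (hi _ (by linarith))).const_mul _
    · filter_upwards [ae_restrict_mem measurableSet_Ioi] with s hs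
      exact ((hV's s hs).pow 2).mul (hexps s hs)
  have hconst : (∫ s in Set.Ioi (0 : ℝ), (A * a * s ^ (a - 1)) ^ 2 * Real.exp (-A * s ^ a))
      / (∫ s in Set.Ioi (0 : ℝ), Real.exp (-A * s ^ a)) = varConst A a := by
    unfold varConst
    rw [← integral_const_mul]
    congr 1
    refine setIntegral_congr_fun measurableSet_Ioi fun s hs => ?_
    have hs' : 0 < s := hs
    have e : s ^ (2 * a - 2) = s ^ (a - 1) * s ^ (a - 1) := by
      rw [← Real.rpow_add hs']; congr 1; ring
    rw [e]
    ring
  have hZ0 : (∫ s in Set.Ioi (0 : ℝ), Real.exp (-A * s ^ a)) ≠ 0 := by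
    rw [integral_exp_neg_mul_rpow ha0 hA]
    have h2 : 0 < Real.Gamma (1 / a + 1) := Real.Gamma_pos_of_pos (by positivity)
    positivity
  have hratio := hN.div hZ hZ0
  rw [hconst] at hratio
  have hvc := varConst_pos hA (show 1 / 2 < a by linarith)
  refine Asymptotics.isEquivalent_of_tendsto_one ?_
  have hfin := hratio.div_const (varConst A a)
  rw [div_self hvc.ne'] at hfin
  refine hfin.congr' ?_
  filter_upwards [hl] with T hT
  have hT' := hT.pos
  have hτ : 0 < T ^ (1 / a) := Real.rpow_pos_of_pos hT' _
  have hp : 0 < T ^ (1 - 1 / a) := Real.rpow_pos_of_pos hT' _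
  have e2 : T ^ (2 - 2 / a) = T ^ (1 - 1 / a) * T ^ (1 - 1 / a) := by
    rw [← Real.rpow_add hT']; congr 1; ring
  -- The Jacobian $T^{1/a}$ occurs in numerator and denominator and cancels, leaving the square
  -- $T^{2-2/a}$ of the force scale.
  have c1 := integral_comp_mul_left_Ioi (fun r => Real.exp (-V r / T)) 0 hτ
  have c2 := integral_comp_mul_left_Ioi (fun r => deriv V r ^ 2 * Real.exp (-V r / T)) 0 hτ
  rw [mul_zero, smul_eq_mul] at c1 c2
  have c3 : ∫ s in Set.Ioi 0, (deriv V (T ^ (1 / a) * s) / T ^ (1 - 1 / a)) ^ 2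
        * Real.exp (-(V (T ^ (1 / a) * s) / T))
      = (T ^ (2 - 2 / a))⁻¹ * ∫ s in Set.Ioi 0, deriv V (T ^ (1 / a) * s) ^ 2
        * Real.exp (-V (T ^ (1 / a) * s) / T) := by
    rw [← integral_const_mul]
    refine integral_congr_ae (Eventually.of_forall fun s => ?_)
    simp only
    rw [e2, neg_div]
    field_simp
  have c4 : ∫ s in Set.Ioi 0, Real.exp (-(V (T ^ (1 / a) * s) / T))
      = ∫ s in Set.Ioi 0, Real.exp (-V (T ^ (1 / a) * s) / T) := by
    simp only [neg_div]
  simp only [Pi.div_apply]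
  rw [c3, c4, c1, c2, forceVar_eq_div hT]
  have hq : T ^ (2 - 2 / a) ≠ 0 := (Real.rpow_pos_of_pos hT' _).ne'
  rw [mul_left_comm, mul_div_mul_left _ _ (inv_ne_zero hτ.ne'), div_div, mul_comm (varConst A a),
    ← div_div, ← div_div]
  congr 1
  rw [inv_mul_eq_div, div_div, mul_comm (T ^ (2 - 2 / a)), ← div_div]

/-- Bound on the conductivity from the asymptotics of the force variance. -/
theorem exists_conductivity_le {V : ℝ → ℝ} {γ : ℝ} (hγ : 0 < γ) {l : Filter ℝ} {A a : ℝ}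
    (hA : 0 < A) (ha : 1 < a) (hreg : ∀ᶠ T in l, GibbsRegular V T)
    (hdyn : ∀ T : ℝ, 0 < T → DynamicsExists V γ T)
    (hequiv : Asymptotics.IsEquivalent l (forceVar V) (fun T => varConst A a * T ^ (2 - 2 / a))) :
    ∃ C : ℝ, 0 < C ∧ ∀ᶠ T in l, 0 ≤ conductivity V γ T ∧
      conductivity V γ T ≤ C * T ^ (1 - 2 / a) := by
  have hvc := varConst_pos hA (show 1 / 2 < a by linarith)
  -- Eventually the variance is at most twice its equivalent; the factor $2$ cancels against the one
  -- in $2\gamma T$.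
  refine ⟨varConst A a / γ, by positivity, ?_⟩
  have h1 : ∀ᶠ T in l, |forceVar V T - varConst A a * T ^ (2 - 2 / a)|
      ≤ 1 * |varConst A a * T ^ (2 - 2 / a)| := by
    have := hequiv.isLittleO.def one_pos
    exact this
  filter_upwards [hreg, h1] with T hT hT1
  obtain ⟨-, h2, h3⟩ := hT.greenKubo_bound hγ (hdyn T hT.pos)
  have hTp := hT.pos
  refine ⟨h2, h3.trans ?_⟩
  have hpos : 0 < T ^ (2 - 2 / a) := Real.rpow_pos_of_pos hTp _
  rw [one_mul, abs_of_pos (show 0 < varConst A a * T ^ (2 - 2 / a) by positivity)] at hT1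
  have h4 := (abs_le.1 hT1).2
  have e : T ^ (2 - 2 / a) = T ^ (1 - 2 / a) * T := by
    rw [← Real.rpow_add_one hTp.ne']; congr 1; ring
  rw [e] at h4
  rw [div_le_iff₀ (by positivity)]
  have e3 : varConst A a / γ * T ^ (1 - 2 / a) * (2 * γ * T)
      = 2 * (varConst A a * (T ^ (1 - 2 / a) * T)) := by
    field_simp
  rw [e3]
  linarith

/-! ### Differentiating power asymptotics at the origin -/

/-- One-sided Taylor asymptotics at `0` of a smooth function whose first derivatives vanish. -/
theorem tendsto_div_pow_of_iteratedDeriv_eq_zero (n : ℕ) :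
    ∀ {f : ℝ → ℝ}, ContDiff ℝ (⊤ : ℕ∞) f → (∀ i < n, iteratedDeriv i f 0 = 0) →
      Tendsto (fun r => f r / r ^ n) (𝓝[>] 0) (𝓝 (iteratedDeriv n f 0 / n.factorial)) := by
  induction n with
  | zero =>
    intro f hf _
    simpa using (hf.continuous.tendsto 0).mono_left nhdsWithin_le_nhds
  | succ n ih =>
    intro f hf h0
    have hd : Differentiable ℝ f := hf.differentiable (by simp)
    have hd' : ContDiff ℝ (⊤ : ℕ∞) (deriv f) := ((contDiff_infty_iff_deriv).1 hf).2
    have h1 := ih hd' fun i hi => by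
      rw [← iteratedDeriv_succ']; exact h0 (i + 1) (by omega)
    -- Induction by L'Hôpital: the derivative satisfies the hypotheses at order $n$, and the factor
    -- $n+1$ from the denominator completes the factorial.
    refine HasDerivAt.lhopital_zero_nhdsGT (f' := deriv f) (g' := fun r => ((n + 1 : ℕ) : ℝ) * r ^ n)
      (Eventually.of_forall fun r => (hd r).hasDerivAt)
      (Eventually.of_forall fun r => by simpa using hasDerivAt_pow (n + 1) r) ?_ ?_ ?_ ?_
    · filter_upwards [self_mem_nhdsWithin] with r hr
      have : (0 : ℝ) < r := hr
      positivity
    · have := (hf.continuous.tendsto 0).mono_left (nhdsWithin_le_nhds (s := Set.Ioi 0))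
      rwa [show f 0 = 0 by simpa using h0 0 (by omega)] at this
    · have := ((continuous_pow (M := ℝ) (n + 1)).tendsto 0).mono_left
        (nhdsWithin_le_nhds (s := Set.Ioi 0))
      simpa using this
    · have h2 := h1.div_const ((n + 1 : ℕ) : ℝ)
      rw [← iteratedDeriv_succ', div_div, mul_comm, ← Nat.cast_mul, ← Nat.factorial_succ] at h2
      refine h2.congr fun r => ?_
      rw [div_div, mul_comm]

/-- Power asymptotics at `0+` of a smooth function can be differentiated. -/
theorem tendsto_deriv_div_rpow {V : ℝ → ℝ} (hV : ContDiff ℝ (⊤ : ℕ∞) V) {A δ : ℝ} (hA : A ≠ 0)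
    (hδ : 0 < δ) (h : Tendsto (fun r => V r / r ^ δ) (𝓝[>] 0) (𝓝 A)) :
    Tendsto (fun r => deriv V r / r ^ (δ - 1)) (𝓝[>] 0) (𝓝 (A * δ)) := by
  have hid : Tendsto (fun r : ℝ => r) (𝓝[>] 0) (𝓝 0) := tendsto_id.mono_left nhdsWithin_le_nhds
  have hpow0 : ∀ q : ℝ, 0 < q → Tendsto (fun r : ℝ => r ^ q) (𝓝[>] 0) (𝓝 0) := fun q hq => by
    simpa [Real.zero_rpow hq.ne'] using hid.rpow_const (Or.inr hq.le)
  have hrel : ∀ n : ℕ, ∀ r : ℝ, 0 < r → V r / r ^ δ = V r / r ^ n * r ^ ((n : ℝ) - δ) := by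
    intro n r hr
    rw [Real.rpow_sub hr, Real.rpow_natCast]
    have := (Real.rpow_pos_of_pos hr δ).ne'
    field_simp
  -- Vanishing to an order above $\delta$ would make $V/r^\delta$ tend to $0$ instead of $A\ne0$.
  -- Hence some derivative at $0$ is nonzero.
  have hcmp : ∀ n : ℕ, δ < n → (∀ i < n, iteratedDeriv i V 0 = 0) → False := by
    intro n hn h0
    have h1 := (tendsto_div_pow_of_iteratedDeriv_eq_zero n hV h0).mul
      (hpow0 ((n : ℝ) - δ) (by linarith))
    rw [mul_zero] at h1
    refine hA (tendsto_nhds_unique (h.congr' ?_) h1)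
    filter_upwards [self_mem_nhdsWithin] with r hr using hrel n r hr
  have hex : ∃ k : ℕ, iteratedDeriv k V 0 ≠ 0 := by
    by_contra! hall
    obtain ⟨n, hn⟩ := exists_nat_gt δ
    exact hcmp n hn fun i _ => hall i
  classical
  set k := Nat.find hex with hk
  have hk0 : iteratedDeriv k V 0 ≠ 0 := Nat.find_spec hex
  have hlt : ∀ i < k, iteratedDeriv i V 0 = 0 := fun i hi => by
    simpa using Nat.find_min hex hi
  have hlim := tendsto_div_pow_of_iteratedDeriv_eq_zero k hV hlt
  have hfac : ((k.factorial : ℕ) : ℝ) ≠ 0 := by exact_mod_cast k.factorial_ne_zero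
  -- The first nonvanishing order `k` cannot exceed $\delta$ by the preceding comparison. If it were
  -- smaller, $V/r^k$ would tend both to $0$ and to a nonzero Taylor coefficient.
  have hkδ : (k : ℝ) = δ := by
    refine le_antisymm (not_lt.1 fun hlt' => hcmp k hlt' hlt) (not_lt.1 fun hgt => ?_)
    have h1 := h.mul (hpow0 (δ - k) (by linarith))
    rw [mul_zero] at h1
    refine div_ne_zero hk0 hfac (tendsto_nhds_unique (hlim.congr' ?_) h1)
    filter_upwards [self_mem_nhdsWithin] with r hr
    have hr' : (0 : ℝ) < r := hr
    rw [hrel k r hr', mul_assoc, ← Real.rpow_add hr']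
    simp
  have hkpos : 0 < k := by
    have : (0 : ℝ) < k := by rw [hkδ]; exact hδ
    exact_mod_cast this
  have hAeq : iteratedDeriv k V 0 / k.factorial = A := by
    refine tendsto_nhds_unique hlim (h.congr fun r => ?_)
    rw [← hkδ, Real.rpow_natCast]
  have hd' : ContDiff ℝ (⊤ : ℕ∞) (deriv V) := ((contDiff_infty_iff_deriv).1 hV).2
  obtain ⟨m, hm⟩ : ∃ m, k = m + 1 := ⟨k - 1, by omega⟩
  have hl2 := tendsto_div_pow_of_iteratedDeriv_eq_zero m hd' fun i hi => by
    rw [← iteratedDeriv_succ']; exact hlt (i + 1) (by omega)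
  have hval : iteratedDeriv m (deriv V) 0 / m.factorial = A * δ := by
    rw [← hAeq, ← hkδ, ← iteratedDeriv_succ', hm, Nat.factorial_succ]
    push_cast
    have : ((m.factorial : ℕ) : ℝ) ≠ 0 := by exact_mod_cast m.factorial_ne_zero
    field_simp
  rw [hval] at hl2
  refine hl2.congr fun r => ?_
  rw [← hkδ, hm, Nat.cast_succ, add_sub_cancel_right, Real.rpow_natCast]

/-! ### Potentials with a power tail -/

/-- `V = A r^α + W` on `[1, ∞)` with `W` and `W'` bounded. -/
structure PowerTail (V : ℝ → ℝ) (A α M : ℝ) (W : ℝ → ℝ) : Prop where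
  smooth : ContDiff ℝ (⊤ : ℕ∞) V
  nonneg : ∀ r, 0 ≤ V r
  coeff_pos : 0 < A
  exp_pos : 0 < α
  smooth_rest : ContDiff ℝ (⊤ : ℕ∞) W
  bound : ∀ r : ℝ, 1 ≤ r → |W r| ≤ M ∧ |deriv W r| ≤ M
  eq : ∀ r : ℝ, 1 ≤ r → V r = A * r ^ α + W r

namespace PowerTail

variable {V W : ℝ → ℝ} {A α M : ℝ}

theorem bound_nonneg (h : PowerTail V A α M W) : 0 ≤ M :=
  (abs_nonneg _).trans (h.bound 1 le_rfl).1

/-- On the tail the loss is `M`. On $(0,1]$ the subtracted `A` makes the left side nonpositive, and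
$V\ge0$ suffices. -/
theorem lower (h : PowerTail V A α M W) {r : ℝ} (hr : 0 < r) : A * r ^ α - (M + A) ≤ V r := by
  have hA := h.coeff_pos
  have hM := h.bound_nonneg
  rcases le_total 1 r with h1 | h1
  · rw [h.eq r h1]
    linarith [(abs_le.1 (h.bound r h1).1).1]
  · have h2 : r ^ α ≤ 1 := Real.rpow_le_one hr.le h1 h.exp_pos.le
    nlinarith [h.nonneg r]

theorem deriv_eq (h : PowerTail V A α M W) {r : ℝ} (hr : 1 < r) :
    deriv V r = A * α * r ^ (α - 1) + deriv W r := by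
  have e : V =ᶠ[𝓝 r] fun r => A * r ^ α + W r := by
    filter_upwards [Ioi_mem_nhds hr] with x hx using h.eq x (le_of_lt hx)
  rw [e.deriv_eq]
  have h1 := (Real.hasDerivAt_rpow_const (x := r) (p := α) (Or.inl (by linarith))).const_mul A
  have h2 := (h.smooth_rest.differentiable (by simp) r).hasDerivAt
  rw [show deriv (fun r => A * r ^ α + W r) r = _ from (h1.add h2).deriv]
  ring

theorem abs_deriv_le (h : PowerTail V A α M W) {r : ℝ} (hr : 1 < r) :
    |deriv V r| ≤ A * α * r ^ (α - 1) + M := by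
  have hA := h.coeff_pos
  have hα := h.exp_pos
  rw [h.deriv_eq hr]
  refine (abs_add_le _ _).trans (add_le_add (le_of_eq (abs_of_nonneg ?_)) (h.bound r hr.le).2)
  have : 0 < r ^ (α - 1) := Real.rpow_pos_of_pos (by linarith) _
  positivity

/-- Polynomial growth of the force. -/
theorem force_le (h : PowerTail V A α M W) {m : ℝ} (hαm : α - 1 ≤ m) :
    ∃ K, 0 ≤ K ∧ ∀ r, 0 < r → |deriv V r| ≤ K * (1 + r ^ m) := by
  have hA := h.coeff_pos
  have hα := h.exp_pos
  have hM := h.bound_nonneg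
  have hc : Continuous (deriv V) := h.smooth.continuous_deriv (by simp)
  obtain ⟨D, hD⟩ := (isCompact_Icc (a := (0 : ℝ)) (b := 1)).exists_bound_of_continuousOn
    hc.continuousOn
  have hD0 : 0 ≤ D := (norm_nonneg _).trans (hD 0 (by simp))
  refine ⟨D + A * α + M, by positivity, fun r hr => ?_⟩
  have hp : 0 < r ^ m := Real.rpow_pos_of_pos hr _
  rcases le_or_gt r 1 with h1 | h1
  · have := hD r ⟨hr.le, h1⟩
    rw [Real.norm_eq_abs] at this
    nlinarith [mul_pos hA hα, mul_nonneg hD0 hp.le, mul_nonneg (mul_pos hA hα).le hp.le,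
      mul_nonneg hM hp.le]
  · have h2 := h.abs_deriv_le h1
    have h3 : r ^ (α - 1) ≤ r ^ m := Real.rpow_le_rpow_of_exponent_le h1.le hαm
    have h4 := mul_le_mul_of_nonneg_left h3 (mul_pos hA hα).le
    nlinarith [mul_pos hA hα, mul_nonneg hD0 hp.le, mul_nonneg hM hp.le]

theorem gibbsRegular (h : PowerTail V A α M W) (heven : ∀ r, V (-r) = V r) {T : ℝ} (hT : 0 < T) :
    GibbsRegular V T := by
  -- The exponent $\alpha$ replaces $\alpha-1$, which is negative when $\alpha<1$.
  obtain ⟨K, hK, hforce⟩ := h.force_le (m := α) (by linarith)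
  refine gibbsRegular_of_growth h.smooth heven h.coeff_pos h.exp_pos h.exp_pos.le
    (K := max K (M + A)) (fun r hr => ?_) (fun r hr => ?_) hT
  · linarith [h.lower hr, le_max_right K (M + A)]
  · refine (hforce r hr).trans (mul_le_mul_of_nonneg_right (le_max_left _ _) ?_)
    have := Real.rpow_pos_of_pos hr α
    linarith

theorem tendsto_div_rpow (h : PowerTail V A α M W) :
    Tendsto (fun r => V r / r ^ α) atTop (𝓝 A) := by
  have h1 : Tendsto (fun r : ℝ => W r * (r ^ α)⁻¹) atTop (𝓝 0) := by
    refine isBoundedUnder_le_mul_tendsto_zero (f := W) ?_ (tendsto_rpow_atTop h.exp_pos).inv_tendsto_atTop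
    refine ⟨M, ?_⟩
    rw [eventually_map]
    filter_upwards [eventually_ge_atTop 1] with r hr using (h.bound r hr).1
  have h2 := h1.const_add A
  rw [add_zero] at h2
  refine h2.congr' ?_
  filter_upwards [eventually_ge_atTop 1] with r hr
  have : r ^ α ≠ 0 := (Real.rpow_pos_of_pos (by linarith) _).ne'
  rw [h.eq r hr]
  field_simp

theorem tendsto_deriv_div_rpow (h : PowerTail V A α M W) (hα : 1 < α) :
    Tendsto (fun r => deriv V r / r ^ (α - 1)) atTop (𝓝 (A * α)) := by
  have h1 : Tendsto (fun r : ℝ => deriv W r * (r ^ (α - 1))⁻¹) atTop (𝓝 0) := by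
    refine isBoundedUnder_le_mul_tendsto_zero (f := deriv W) ?_
      (tendsto_rpow_atTop (by linarith)).inv_tendsto_atTop
    refine ⟨M, ?_⟩
    rw [eventually_map]
    filter_upwards [eventually_ge_atTop 1] with r hr using (h.bound r hr).2
  have h2 := h1.const_add (A * α)
  rw [add_zero] at h2
  refine h2.congr' ?_
  filter_upwards [eventually_gt_atTop 1] with r hr
  have : r ^ (α - 1) ≠ 0 := (Real.rpow_pos_of_pos (by linarith) _).ne'
  rw [h.deriv_eq hr]
  field_simp

/-- High temperature asymptotics of the force variance. -/
theorem isEquivalent_forceVar_atTop (h : PowerTail V A α M W) (heven : ∀ r, V (-r) = V r)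
    (hα : 1 < α) :
    Asymptotics.IsEquivalent atTop (forceVar V) (fun T => varConst A α * T ^ (2 - 2 / α)) := by
  have hα0 := h.exp_pos
  have hA := h.coeff_pos
  have hM := h.bound_nonneg
  obtain ⟨K, hK, hforce⟩ := h.force_le le_rfl
  -- One power suffices in the lower bound. For $T\ge1$ the additive constants only shrink after
  -- division by $T$ or by $T^{1-1/\alpha}\ge1$, so the bounds are uniform.
  refine isEquivalent_forceVar (l' := atTop) hA hα ?_ ?_ h.tendsto_div_rpow
    (h.tendsto_deriv_div_rpow hα) (c := A) (K := max K (M + A)) (b₁ := α) (b₂ := α) (m₁ := 0)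
    (m₂ := α - 1) hA hα0 hα0 le_rfl (by linarith) ?_ ?_
  · filter_upwards [eventually_gt_atTop 0] with T hT using h.gibbsRegular heven hT
  · intro s hs
    exact (tendsto_rpow_atTop (by positivity)).atTop_mul_const hs
  · filter_upwards [eventually_ge_atTop 1] with T hT s hs
    have hT0 : 0 < T := by linarith
    have hr : 0 < T ^ (1 / α) * s := mul_pos (Real.rpow_pos_of_pos hT0 _) hs
    have h1 := h.lower hr
    rw [scale_rpow hα0 hT0 hs] at h1
    rw [min_self, le_div_iff₀ hT0]
    have h2 := le_max_right K (M + A)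
    nlinarith [Real.rpow_pos_of_pos hs α]
  · filter_upwards [eventually_ge_atTop 1] with T hT s hs
    have hT0 : 0 < T := by linarith
    have hr : 0 < T ^ (1 / α) * s := mul_pos (Real.rpow_pos_of_pos hT0 _) hs
    have h1 := hforce _ hr
    rw [scale_rpow_sub_one hα0 hT0 hs] at h1
    have hq : 1 ≤ T ^ (1 - 1 / α) := Real.one_le_rpow hT (by
      rw [sub_nonneg, div_le_one hα0]; exact hα.le)
    rw [div_le_iff₀ (by linarith), Real.rpow_zero]
    refine h1.trans ?_
    have hp := Real.rpow_pos_of_pos hs (α - 1)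
    have h2 : 1 + T ^ (1 - 1 / α) * s ^ (α - 1) ≤ (1 + s ^ (α - 1)) * T ^ (1 - 1 / α) := by
      nlinarith
    calc K * (1 + T ^ (1 - 1 / α) * s ^ (α - 1))
        ≤ max K (M + A) * ((1 + s ^ (α - 1)) * T ^ (1 - 1 / α)) :=
          mul_le_mul (le_max_left _ _) h2 (by positivity) (hK.trans (le_max_left _ _))
      _ = _ := by ring

/-- A potential which vanishes only at the origin dominates the smaller of the powers describing
its behaviour at `0` and at infinity. -/
theorem exists_min_le (h : PowerTail V A α M W) {D δ : ℝ} (hD : 0 < D) (hδ : 0 < δ)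
    (hlim : Tendsto (fun r => V r / r ^ δ) (𝓝[>] 0) (𝓝 D)) (hpos : ∀ r, r ≠ 0 → 0 < V r) :
    ∃ c, 0 < c ∧ ∀ r, 0 < r → c * min (r ^ δ) (r ^ min α δ) ≤ V r := by
  have hA := h.coeff_pos
  have hα := h.exp_pos
  obtain ⟨ε, hε, hnear⟩ : ∃ ε > 0, ∀ r, 0 < r → r < ε → D / 2 < V r / r ^ δ := by
    have := hlim.eventually (lt_mem_nhds (show D / 2 < D by linarith))
    obtain ⟨u, hu, hsub⟩ := mem_nhdsGT_iff_exists_Ioo_subset.1 this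
    exact ⟨u, hu, fun r h1 h2 => hsub ⟨h1, h2⟩⟩
  obtain ⟨R, hR⟩ := eventually_atTop.1
    (h.tendsto_div_rpow.eventually (lt_mem_nhds (show A / 2 < A by linarith)))
  -- Three ranges: near $0$ the asymptotics there, beyond `R'` the tail, and on the compact range
  -- between them the positive minimum of $V$. Including `ε` keeps that range nonempty, and `1`
  -- orders the powers on the tail.
  set R' := max (max R 1) ε with hR'
  obtain ⟨x, hx, hmin⟩ := (isCompact_Icc (a := ε) (b := R')).exists_isMinOn
    ⟨ε, le_rfl, le_max_right _ _⟩ h.smooth.continuous.continuousOn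
  have hvx : 0 < V x := hpos x (by linarith [hx.1])
  have hR'0 : 0 < R' := hε.trans_le (le_max_right _ _)
  have hRδ := Real.rpow_pos_of_pos hR'0 δ
  refine ⟨min (min (D / 2) (A / 2)) (V x / R' ^ δ), by positivity, fun r hr => ?_⟩
  have hrδ := Real.rpow_pos_of_pos hr δ
  have hrm := Real.rpow_pos_of_pos hr (min α δ)
  set c := min (min (D / 2) (A / 2)) (V x / R' ^ δ)
  have c1 : c ≤ D / 2 := (min_le_left _ _).trans (min_le_left _ _)
  have c2 : c ≤ A / 2 := (min_le_left _ _).trans (min_le_right _ _)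
  have c3 : c ≤ V x / R' ^ δ := min_le_right _ _
  have hm0 : 0 ≤ min (r ^ δ) (r ^ min α δ) := le_min hrδ.le hrm.le
  rcases lt_or_ge r ε with h1 | h1
  · have h2 := hnear r hr h1
    rw [lt_div_iff₀ hrδ] at h2
    exact (mul_le_mul c1 (min_le_left _ _) hm0 (by positivity)).trans h2.le
  rcases le_or_gt r R' with h2 | h2
  · have h3 : V x ≤ V r := hmin ⟨h1, h2⟩
    refine le_trans ?_ h3
    refine (mul_le_mul c3 ((min_le_left _ _).trans (Real.rpow_le_rpow hr.le h2 hδ.le)) hm0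
      (by positivity)).trans (le_of_eq ?_)
    field_simp
  · have hRr : R ≤ r := ((le_max_left _ _).trans (le_max_left _ _)).trans h2.le
    have h1r : 1 ≤ r := ((le_max_right R 1).trans (le_max_left _ _)).trans h2.le
    have h3 := hR r hRr
    rw [lt_div_iff₀ (Real.rpow_pos_of_pos hr α)] at h3
    refine (mul_le_mul c2 ((min_le_right _ _).trans
      (Real.rpow_le_rpow_of_exponent_le h1r (min_le_left _ _))) hm0 (by positivity)).trans h3.le

/-- Bound of the force by the powers describing its behaviour at `0` and at infinity. -/
theorem exists_force_le (h : PowerTail V A α M W) {D δ : ℝ} (hδ : 1 ≤ δ)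
    (hlim : Tendsto (fun r => deriv V r / r ^ (δ - 1)) (𝓝[>] 0) (𝓝 D)) :
    ∃ K, 0 ≤ K ∧ ∀ r, 0 < r → |deriv V r| ≤ K * (r ^ (δ - 1) + r ^ max α δ) := by
  have hα := h.exp_pos
  obtain ⟨K, hK, hforce⟩ := h.force_le (m := max α δ)
    ((by linarith : α - 1 ≤ α).trans (le_max_left _ _))
  obtain ⟨ε, hε, hnear⟩ : ∃ ε > 0, ∀ r, 0 < r → r < ε → |deriv V r / r ^ (δ - 1)| < |D| + 1 := by
    have := hlim.abs.eventually (gt_mem_nhds (show |D| < |D| + 1 by linarith))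
    obtain ⟨u, hu, hsub⟩ := mem_nhdsGT_iff_exists_Ioo_subset.1 this
    exact ⟨u, hu, fun r h1 h2 => hsub ⟨h1, h2⟩⟩
  have hεδ := Real.rpow_pos_of_pos hε (δ - 1)
  -- Away from $0$ the constant $1$ in the growth bound is absorbed by
  -- $r^{\delta-1}\ge\varepsilon^{\delta-1}$. No constant term may remain, since it would blow up
  -- after division by $T^{1-1/\delta}$ as $T\downarrow0$.
  refine ⟨(|D| + 1) + K * (1 + 1 / ε ^ (δ - 1)), by positivity, fun r hr => ?_⟩
  have hp := Real.rpow_pos_of_pos hr (δ - 1)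
  have hq := Real.rpow_pos_of_pos hr (max α δ)
  rcases lt_or_ge r ε with h1 | h1
  · have h2 := hnear r hr h1
    rw [abs_div, abs_of_pos hp, div_lt_iff₀ hp] at h2
    refine h2.le.trans (mul_le_mul ?_ (by linarith) hp.le (by positivity))
    have : 0 ≤ K * (1 + 1 / ε ^ (δ - 1)) := by positivity
    linarith
  · refine (hforce r hr).trans ?_
    have h2 : ε ^ (δ - 1) ≤ r ^ (δ - 1) := Real.rpow_le_rpow hε.le h1 (by linarith)
    have h3 : 1 + r ^ max α δ ≤ (1 + 1 / ε ^ (δ - 1)) * (r ^ (δ - 1) + r ^ max α δ) := by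
      have h4 : 1 ≤ 1 / ε ^ (δ - 1) * r ^ (δ - 1) := by
        rw [one_div, inv_mul_eq_div, le_div_iff₀ hεδ]; linarith
      have h5 : 0 ≤ 1 / ε ^ (δ - 1) * r ^ max α δ := by positivity
      nlinarith
    have h6 := mul_le_mul_of_nonneg_left h3 hK
    have h7 : 0 ≤ (|D| + 1) * (r ^ (δ - 1) + r ^ max α δ) := by positivity
    nlinarith

/-- Low temperature asymptotics of the force variance. -/
theorem isEquivalent_forceVar_zero (h : PowerTail V A α M W) (heven : ∀ r, V (-r) = V r)
    {D δ : ℝ} (hD : 0 < D) (hδ : 1 < δ)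
    (hlim : Tendsto (fun r => V r / r ^ δ) (𝓝[>] 0) (𝓝 D)) (hpos : ∀ r, r ≠ 0 → 0 < V r) :
    Asymptotics.IsEquivalent (𝓝[>] 0) (forceVar V) (fun T => varConst D δ * T ^ (2 - 2 / δ)) := by
  have hα := h.exp_pos
  have hδ0 : 0 < δ := by linarith
  have hlim' := FlipChain.tendsto_deriv_div_rpow h.smooth hD.ne' hδ0 hlim
  obtain ⟨c, hc, hlow⟩ := h.exists_min_le hD hδ0 hlim hpos
  obtain ⟨K, hK, hforce⟩ := h.exists_force_le hδ.le hlim'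
  have hI : ∀ᶠ T : ℝ in 𝓝[>] 0, 0 < T ∧ T ≤ 1 := by
    filter_upwards [Ioc_mem_nhdsGT (zero_lt_one' ℝ)] with T hT using hT
  have hscale_le : ∀ {T : ℝ}, 0 < T → T ≤ 1 → ∀ {p q : ℝ}, p ≤ q →
      (T ^ (1 / δ)) ^ q ≤ (T ^ (1 / δ)) ^ p := fun {T} h0 h1 {p q} hpq =>
    Real.rpow_le_rpow_of_exponent_ge (Real.rpow_pos_of_pos h0 _)
      (Real.rpow_le_one h0.le h1 (by positivity)) hpq
  -- Since $T^{1/\delta}\le1$, an exponent at most $\delta$ keeps the rescaled lower bound at least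
  -- $T$ times the original, and an exponent at least $\delta-1$ keeps the rescaled force below
  -- $T^{1-1/\delta}$. Hence the tail enters through $\min(\alpha,\delta)$ and
  -- $\max(\alpha,\delta)$.
  refine isEquivalent_forceVar (l' := 𝓝[>] 0) hD hδ ?_ ?_ hlim hlim' (c := c) (K := K)
    (b₁ := δ) (b₂ := min α δ) (m₁ := δ - 1) (m₂ := max α δ) hc hδ0 (by positivity) (by linarith)
    (by positivity) ?_ ?_
  · filter_upwards [self_mem_nhdsWithin] with T hT using h.gibbsRegular heven hT
  · intro s hs
    refine tendsto_nhdsWithin_iff.2 ⟨?_, ?_⟩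
    · have h1 : Tendsto (fun T : ℝ => T ^ (1 / δ)) (𝓝[>] 0) (𝓝 0) := by
        have h0 : Tendsto (fun r : ℝ => r) (𝓝[>] 0) (𝓝 0) :=
          tendsto_id.mono_left nhdsWithin_le_nhds
        have h2 := h0.rpow_const (p := 1 / δ) (Or.inr (by positivity))
        rwa [Real.zero_rpow (by positivity)] at h2
      simpa using h1.mul_const s
    · filter_upwards [self_mem_nhdsWithin] with T hT
      exact mul_pos (Real.rpow_pos_of_pos hT _) hs
  · filter_upwards [hI] with T hT s hs
    have hr : 0 < T ^ (1 / δ) * s := mul_pos (Real.rpow_pos_of_pos hT.1 _) hs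
    have hτ := Real.rpow_pos_of_pos hT.1 (1 / δ)
    rw [le_div_iff₀ hT.1]
    refine le_trans ?_ (hlow _ hr)
    have e : (T ^ (1 / δ)) ^ δ = T := by
      rw [← Real.rpow_mul hT.1.le, one_div, inv_mul_cancel₀ hδ0.ne', Real.rpow_one]
    have h1 : T * min (s ^ δ) (s ^ min α δ) ≤
        min ((T ^ (1 / δ) * s) ^ δ) ((T ^ (1 / δ) * s) ^ min α δ) := by
      rw [scale_rpow hδ0 hT.1 hs, Real.mul_rpow hτ.le hs.le (z := min α δ)]
      refine le_min (mul_le_mul_of_nonneg_left (min_le_left _ _) hT.1.le) ?_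
      refine mul_le_mul ?_ (min_le_right _ _)
        (le_min (Real.rpow_pos_of_pos hs _).le (Real.rpow_pos_of_pos hs _).le) (by positivity)
      conv_lhs => rw [← e]
      exact hscale_le hT.1 hT.2 (min_le_right _ _)
    nlinarith [mul_le_mul_of_nonneg_left h1 hc.le, mul_nonneg hK hT.1.le]
  · filter_upwards [hI] with T hT s hs
    have hr : 0 < T ^ (1 / δ) * s := mul_pos (Real.rpow_pos_of_pos hT.1 _) hs
    have hτ := Real.rpow_pos_of_pos hT.1 (1 / δ)
    have hq : 0 < T ^ (1 - 1 / δ) := Real.rpow_pos_of_pos hT.1 _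
    rw [div_le_iff₀ hq, mul_assoc]
    refine (hforce _ hr).trans (mul_le_mul_of_nonneg_left ?_ hK)
    rw [scale_rpow_sub_one hδ0 hT.1 hs, Real.mul_rpow hτ.le hs.le (z := max α δ), add_mul,
      mul_comm (s ^ (δ - 1))]
    refine add_le_add le_rfl ?_
    rw [mul_comm (s ^ max α δ)]
    refine mul_le_mul_of_nonneg_right ?_ (Real.rpow_pos_of_pos hs _).le
    have e : T ^ (1 - 1 / δ) = (T ^ (1 / δ)) ^ (δ - 1) := by
      rw [← Real.rpow_mul hT.1.le]
      congr 1
      field_simp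
    rw [e]
    exact hscale_le hT.1 hT.2 ((by linarith : δ - 1 ≤ δ).trans (le_max_right _ _))

end PowerTail

end FlipChain

end

/-! ### The two temperature regimes -/

theorem corollary6p1 (V : ℝ → ℝ) (γ : ℝ) (hγ : 0 < γ)
    (hV : ContDiff ℝ (⊤ : ℕ∞) V) (hV_even : ∀ r, V (-r) = V r) (hV_nonneg : ∀ r, 0 ≤ V r)
    (hdyn : ∀ T : ℝ, 0 < T → FlipChain.DynamicsExists V γ T) :
    -- high temperature regime
    (∀ (A α : ℝ) (W : ℝ → ℝ), 0 < A → 1 < α → ContDiff ℝ (⊤ : ℕ∞) W →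
      (∃ M : ℝ, ∀ r : ℝ, 1 ≤ r → |W r| ≤ M ∧ |deriv W r| ≤ M) →
      (∀ r : ℝ, 1 ≤ r → V r = A * r ^ α + W r) →
      (∀ T : ℝ, 0 < T → FlipChain.GreenKuboConverges V γ T) ∧
      (∃ C : ℝ, 0 < C ∧ ∀ᶠ T in atTop,
        FlipChain.conductivity V γ T ≤ C / T ^ (2 / α - 1)) ∧
      (α < 2 → Tendsto (FlipChain.conductivity V γ) atTop (𝓝 0)) ∧
      Asymptotics.IsEquivalent atTop (FlipChain.forceVar V)
        (fun T => FlipChain.varConst A α * T ^ (2 - 2 / α))) ∧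
    -- low temperature regime
    (∀ (A δ B α : ℝ) (W : ℝ → ℝ), 0 < A → 2 ≤ δ → 0 < B → 0 < α → ContDiff ℝ (⊤ : ℕ∞) W →
      (∃ M : ℝ, ∀ r : ℝ, 1 ≤ r → |W r| ≤ M ∧ |deriv W r| ≤ M) →
      (∀ r : ℝ, 1 ≤ r → V r = B * r ^ α + W r) →
      Asymptotics.IsEquivalent (𝓝[>] 0) V (fun r => A * r ^ δ) →
      (∀ r : ℝ, r ≠ 0 → 0 < V r) →
      (∀ T : ℝ, 0 < T → FlipChain.GreenKuboConverges V γ T) ∧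
      (∃ C : ℝ, 0 < C ∧ ∀ᶠ T in 𝓝[>] 0,
        FlipChain.conductivity V γ T ≤ C * T ^ (1 - 2 / δ)) ∧
      (2 < δ → Tendsto (FlipChain.conductivity V γ) (𝓝[>] 0) (𝓝 0)) ∧
      Asymptotics.IsEquivalent (𝓝[>] 0) (FlipChain.forceVar V)
        (fun T => FlipChain.varConst A δ * T ^ (2 - 2 / δ))) := by
  refine ⟨fun A α W hA hα hW ⟨M, hM⟩ hVW => ?_, fun A δ B α W hA hδ hB hα hW ⟨M, hM⟩ hVW hlow hpos => ?_⟩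
  · have h : FlipChain.PowerTail V A α M W :=
      ⟨hV, hV_nonneg, hA, by linarith, hW, hM, hVW⟩
    have hreg : ∀ T : ℝ, 0 < T → FlipChain.GibbsRegular V T := fun T => h.gibbsRegular hV_even
    have hequiv := h.isEquivalent_forceVar_atTop hV_even hα
    obtain ⟨C, hC, hCT⟩ := FlipChain.exists_conductivity_le hγ hA hα
      ((eventually_gt_atTop 0).mono hreg) hdyn hequiv
    refine ⟨fun T hT => ((hreg T hT).greenKubo_bound hγ (hdyn T hT)).1, ⟨C, hC, ?_⟩,
      fun hα2 => ?_, hequiv⟩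
    · filter_upwards [hCT, eventually_gt_atTop 0] with T hT hT0
      rw [div_eq_mul_inv, ← Real.rpow_neg hT0.le, neg_sub]
      exact hT.2
    · have hlt : 0 < 2 / α - 1 := by
        rw [sub_pos, lt_div_iff₀ (by linarith)]; linarith
      have h0 : Tendsto (fun T : ℝ => C * T ^ (1 - 2 / α)) atTop (𝓝 0) := by
        simpa using (tendsto_rpow_neg_atTop hlt).const_mul C
      -- The upper bound alone would not give convergence; nonnegativity of the conductivity closes
      -- the squeeze.
      exact tendsto_of_tendsto_of_tendsto_of_le_of_le' tendsto_const_nhds h0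
        (hCT.mono fun T hT => hT.1) (hCT.mono fun T hT => hT.2)
  · have h : FlipChain.PowerTail V B α M W := ⟨hV, hV_nonneg, hB, hα, hW, hM, hVW⟩
    have hreg : ∀ T : ℝ, 0 < T → FlipChain.GibbsRegular V T := fun T => h.gibbsRegular hV_even
    have hlim : Tendsto (fun r => V r / r ^ δ) (𝓝[>] 0) (𝓝 A) := by
      have hne : ∀ᶠ r : ℝ in 𝓝[>] 0, A * r ^ δ ≠ 0 := by
        filter_upwards [self_mem_nhdsWithin] with r hr
        exact (mul_pos hA (Real.rpow_pos_of_pos hr _)).ne'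
      have h1 := ((Asymptotics.isEquivalent_iff_tendsto_one hne).1 hlow).const_mul A
      rw [mul_one] at h1
      refine h1.congr fun r => ?_
      rw [Pi.div_apply]
      field_simp
    have hequiv := h.isEquivalent_forceVar_zero hV_even hA (by linarith) hlim hpos
    obtain ⟨C, hC, hCT⟩ := FlipChain.exists_conductivity_le hγ hA (by linarith : 1 < δ)
      (eventually_mem_nhdsWithin.mono hreg) hdyn hequiv
    refine ⟨fun T hT => ((hreg T hT).greenKubo_bound hγ (hdyn T hT)).1,
      ⟨C, hC, hCT.mono fun T hT => hT.2⟩, fun hδ2 => ?_, hequiv⟩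
    have hlt : 0 < 1 - 2 / δ := by
      rw [sub_pos, div_lt_one (by linarith)]; exact hδ2
    have h0 : Tendsto (fun T : ℝ => C * T ^ (1 - 2 / δ)) (𝓝[>] 0) (𝓝 0) := by
      have hid : Tendsto (fun r : ℝ => r) (𝓝[>] 0) (𝓝 0) :=
        tendsto_id.mono_left nhdsWithin_le_nhds
      have h2 := (hid.rpow_const (p := 1 - 2 / δ) (Or.inr hlt.le)).const_mul C
      rwa [Real.zero_rpow hlt.ne', mul_zero] at h2
    exact tendsto_of_tendsto_of_tendsto_of_le_of_le' tendsto_const_nhds h0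
      (hCT.mono fun T hT => hT.1) (hCT.mono fun T hT => hT.2)
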